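/- **Setting.** Let $\Gamma:\mathbb R\to\mathbb R^3$ be an injective curve parametrized by arc length, $|\dot\Gamma(s)|=1$, with a (possibly glued) Frenet frame: there are a closed, at most countable set $Z\subset\mathbb R$ (for a global Frenet frame $Z=\emptyset$), vector functions $n,b:\mathbb R\to\mathbb R^3$ such that $(t,n,b)$ with $t=\dot\Gamma$ is orthonormal at every $s$, and functions $\gamma,\tau:\mathbb R\to\mathbb R$ (the curvature, possibly signed, and the torsion) with $$\dot t=\gamma n,\qquad \dot n=-\gamma t+\tau b,\qquad \dot b=-\tau n\qquad\text{on }\mathbb R\setminus Z .$$ Let $\alpha:\mathbb R\to\mathbb R$ be a function such that the rotated normal vectors $n\cos\alpha-b\sin\alpha$ and $n\sin\alpha+b\cos\alpha$ are continuous on $\mathbb R$. Let $M\subset\mathbb R^2$ be open, bounded and contain the origin. With polar coordinates $(r,\theta)$ on $M$, put $$x:\mathbb R\times M\to\mathbb R^3,\qquad x(s,r,\theta)=\Gamma(s)-r\big[n(s)\cos(\theta-\alpha(s))+b(s)\sin(\theta-\alpha(s))\big].$$ **Assumptions.** (a) $\Gamma$ is $C^2$. (b) Either $\gamma$ and $\tau$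 vanish outside $[-s_0,s_0]$ for some $s_0>0$, or $\Gamma$ is $C^4$, $\gamma$ is twice and $\tau$ once differentiable, $\tau$ and $\dot\tau$ are bounded, and $\gamma,\dot\gamma,\ddot\gamma$ tend to zero as $|s|\to\infty$ (all this on $\mathbb R\setminus Z$). (c) $|\Gamma(s)-\Gamma(s')|\to\infty$ as $|s-s'|\to\infty$. (d) The map $x$ is injective on $\mathbb R\times M$. (e) $\dot\alpha=\tau$ on $\mathbb R\setminus Z$. (f) $V\in L^\infty(\mathbb R^2)$ is real-valued, $V\ge 0$, $V$ is not a.e. zero, and $V=0$ a.e. outside $M$. Let $\tilde V:\mathbb R^3\to\mathbb R$ be given by $\tilde V(x(s,r,\theta))=V(r,\theta)$ on the tube $x(\mathbb R\times M)$ and $\tilde V=0$ outside it. Let $H_{\Gamma,V}=-\Delta-\tilde V$ in $L^2(\mathbb R^3)$ with domain $H^2(\mathbb R^3)$ and $h_V=-\Delta-V$ in $L^2(\mathbb R^2)$ with domain $H^2(\mathbb R^2)$. The discrete spectrum $\sigma_{\mathrm{disc}}$ consists of the isolated points of the spectrum that are eigenvalues of finite multiplicity, and $\sigma_{\mathrm{ess}}=\sigma\setminus\sigma_{\mathrm{disc}}$.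 **Proposition.** Under assumptions (a)–(f), the number $\epsilon_0:=\inf\sigma_{\mathrm{disc}}(h_V)$ is negative, it is the smallest element of $\sigma_{\mathrm{disc}}(h_V)$ and of $\sigma(h_V)$ (in particular, it is the ground-state eigenvalue of $h_V$), and $$\sigma_{\mathrm{ess}}(H_{\Gamma,V})=[\epsilon_0,\infty).$$ -/

import Mathlib

open MeasureTheory Filter Topology
open scoped SchwartzMap Laplacian

noncomputable section

namespace SoftWaveguide

/-- `ℝᵈ` with its Euclidean norm. -/
abbrev E (d : ℕ) : Type := EuclideanSpace ℝ (Fin d)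

/-- The complex Hilbert space `L²(ℝᵈ)`. -/
abbrev L2 (d : ℕ) : Type := Lp ℂ 2 (volume : Measure (E d))

/-! ### Spectrum of an unbounded operator -/

section Spectrum

variable {H : Type*} [NormedAddCommGroup H] [InnerProductSpace ℂ H]

/-- `z` is in the resolvent set of `T`: the map `T - z : D(T) → H` has a bounded everywhere defined
two-sided inverse. -/
def IsResolventPoint (T : H →ₗ.[ℂ] H) (z : ℂ) : Prop :=
  ∃ R : H →L[ℂ] H,
    (∀ f : H, ∃ h : R f ∈ T.domain, T ⟨R f, h⟩ - z • R f = f) ∧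
    ∀ ψ : T.domain, R (T ψ - z • (ψ : H)) = ψ

/-- The spectrum `σ(T) ⊆ ℂ`. -/
def spec (T : H →ₗ.[ℂ] H) : Set ℂ := {z | ¬ IsResolventPoint T z}

/-- The eigenspace `ker (T - z)`, as a subspace of the domain. -/
def eigenspace (T : H →ₗ.[ℂ] H) (z : ℂ) : Submodule ℂ T.domain :=
  LinearMap.ker (T.toFun - z • T.domain.subtype)

/-- The discrete spectrum (of a self-adjoint operator): isolated points of the spectrum that are
eigenvalues of finite multiplicity. -/
def discSpec (T : H →ₗ.[ℂ] H) : Set ℂ :=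
  {z | z ∈ spec T ∧ (∃ ε > 0, spec T ∩ Metric.ball z ε ⊆ {z}) ∧
    eigenspace T z ≠ ⊥ ∧ FiniteDimensional ℂ (eigenspace T z)}

/-- The essential spectrum: the complement of the discrete spectrum in the spectrum. -/
def essSpec (T : H →ₗ.[ℂ] H) : Set ℂ := spec T \ discSpec T

end Spectrum

/-! ### Schrödinger operators -/

theorem exists_laplacian {d : ℕ} {ψ : L2 d}
    (h : TemperedDistribution.MemSobolev 2 2 (ψ : 𝓢'(E d, ℂ))) :
    ∃ g : L2 d, Δ (ψ : 𝓢'(E d, ℂ)) = (g : 𝓢'(E d, ℂ)) :=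
  TemperedDistribution.memSobolev_zero_iff.1 (by simpa using h.laplacian)

theorem toTemperedDistribution_injective {d : ℕ} {f g : L2 d}
    (h : (f : 𝓢'(E d, ℂ)) = (g : 𝓢'(E d, ℂ))) : f = g :=
  LinearMap.ker_eq_bot.1
    (Lp.ker_toTemperedDistributionCLM_eq_bot (F := ℂ) (μ := (volume : Measure (E d))) (p := 2)) h

/-- The Sobolev space `H²(ℝᵈ)` as a subspace of `L²(ℝᵈ)`. -/
def sobolevTwo (d : ℕ) : Submodule ℂ (L2 d) where
  carrier := {ψ | TemperedDistribution.MemSobolev 2 2 (ψ : 𝓢'(E d, ℂ))}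
  add_mem' {f g} hf hg := by
    have := TemperedDistribution.MemSobolev.add hf hg
    simp only [← Lp.toTemperedDistributionCLM_apply, ← map_add] at this
    exact this
  zero_mem' := by
    have := TemperedDistribution.memSobolev_fun_zero (E d) ℂ 2 2
    rw [← map_zero (Lp.toTemperedDistributionCLM ℂ (volume : Measure (E d)) 2)] at this
    exact this
  smul_mem' c f hf := by
    have := TemperedDistribution.MemSobolev.smul c hf
    simp only [← Lp.toTemperedDistributionCLM_apply, ← map_smul] at this
    exact this

/-- The Laplacian in `L²(ℝᵈ)` with domain `H²(ℝᵈ)`: the value at `ψ` is the square integrable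
function which represents the distributional Laplacian of `ψ`. -/
def laplacianL2 (d : ℕ) : L2 d →ₗ.[ℂ] L2 d where
  domain := sobolevTwo d
  toFun :=
    { toFun := fun ψ => (exists_laplacian ψ.2).choose
      map_add' := fun f g => by
        apply toTemperedDistribution_injective
        rw [← (exists_laplacian (f + g).2).choose_spec]
        simp only [← Lp.toTemperedDistributionCLM_apply, map_add]
        simp only [Lp.toTemperedDistributionCLM_apply]
        rw [← (exists_laplacian f.2).choose_spec, ← (exists_laplacian g.2).choose_spec]
        simp only [← Lp.toTemperedDistributionCLM_apply, Submodule.coe_add, map_add]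
        simpa using map_add (LineDeriv.laplacianCLM ℂ (E d) 𝓢'(E d, ℂ))
          (Lp.toTemperedDistributionCLM ℂ volume 2 (f : L2 d))
          (Lp.toTemperedDistributionCLM ℂ volume 2 (g : L2 d))
      map_smul' := fun c f => by
        apply toTemperedDistribution_injective
        rw [← (exists_laplacian (c • f).2).choose_spec]
        simp only [← Lp.toTemperedDistributionCLM_apply, map_smul, RingHom.id_apply]
        simp only [Lp.toTemperedDistributionCLM_apply]
        rw [← (exists_laplacian f.2).choose_spec]
        simp only [← Lp.toTemperedDistributionCLM_apply, Submodule.coe_smul, map_smul]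
        have := map_smul (LineDeriv.laplacianCLM ℂ (E d) 𝓢'(E d, ℂ)) c
          (Lp.toTemperedDistributionCLM ℂ volume 2 (f : L2 d))
        rwa [TemperedDistribution.laplacianCLM_apply,
          TemperedDistribution.laplacianCLM_apply] at this }

/-- The maximal domain `{ψ ∈ L² | W ψ ∈ L²}` of the multiplication by `W`; it is all of `L²(ℝᵈ)` if
`W` is essentially bounded. -/
def mulDomain {d : ℕ} (W : E d → ℝ) : Submodule ℂ (L2 d) where
  carrier := {ψ | MemLp (fun x => (W x : ℂ) * ψ x) 2 volume}
  add_mem' {f g} hf hg := by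
    refine (MemLp.add hf hg).ae_eq ?_
    filter_upwards [Lp.coeFn_add f g] with x hx
    rw [hx, Pi.add_apply, Pi.add_apply, mul_add]
  zero_mem' := by
    refine (MemLp.zero (ε := ℂ)).ae_eq ?_
    filter_upwards [Lp.coeFn_zero ℂ 2 (volume : Measure (E d))] with x hx
    rw [hx, Pi.zero_apply, mul_zero]
  smul_mem' c f hf := by
    refine (MemLp.const_smul hf c).ae_eq ?_
    filter_upwards [Lp.coeFn_smul c f] with x hx
    rw [hx, Pi.smul_apply, Pi.smul_apply, smul_eq_mul, smul_eq_mul, mul_left_comm]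

theorem memLp_of_mem_mulDomain {d : ℕ} {W : E d → ℝ} (ψ : mulDomain W) :
    MemLp (fun x => (W x : ℂ) * (ψ : L2 d) x) 2 volume := ψ.2

/-- Multiplication by `W` in `L²(ℝᵈ)` on its maximal domain. -/
def mulL2 {d : ℕ} (W : E d → ℝ) : L2 d →ₗ.[ℂ] L2 d where
  domain := mulDomain W
  toFun :=
    { toFun := fun ψ => (memLp_of_mem_mulDomain ψ).toLp
      map_add' := fun f g => by
        rw [← MemLp.toLp_add (memLp_of_mem_mulDomain f) (memLp_of_mem_mulDomain g)]
        apply MemLp.toLp_congr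
        filter_upwards [Lp.coeFn_add (f : L2 d) (g : L2 d)] with x hx
        rw [Submodule.coe_add, hx, Pi.add_apply, Pi.add_apply, mul_add]
      map_smul' := fun c f => by
        rw [RingHom.id_apply, ← MemLp.toLp_const_smul c (memLp_of_mem_mulDomain f)]
        apply MemLp.toLp_congr
        filter_upwards [Lp.coeFn_smul c (f : L2 d)] with x hx
        rw [Submodule.coe_smul, hx, Pi.smul_apply, Pi.smul_apply, smul_eq_mul, smul_eq_mul,
          mul_left_comm] }

/-- The Schrödinger operator `-Δ - W` in `L²(ℝᵈ)` as an operator sum; its domain is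
`H²(ℝᵈ) ∩ {ψ | W ψ ∈ L²}`, that is `H²(ℝᵈ)` if `W` is essentially bounded. -/
def schrodinger {d : ℕ} (W : E d → ℝ) : L2 d →ₗ.[ℂ] L2 d := -laplacianL2 d - mulL2 W

/-- The ground-state energy of `-Δ - V` in `L²(ℝ²)`: the infimum of the discrete spectrum. -/
def groundEnergy (V : E 2 → ℝ) : ℝ := sInf {l : ℝ | (l : ℂ) ∈ discSpec (schrodinger V)}

/-! ### Geometry of the tube -/

/-- `(Γ', n, b)` is an orthonormal triad along `Γ` which satisfies the Frenet formulas with the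
curvature `γ` and the torsion `τ` away from the set `Z`. For `Z = ∅` this is a global Frenet frame;
in general local triads (not determined where `Γ''` vanishes) may be joined at the points of `Z`.
The function `γ` is allowed to change sign. -/
structure IsFrenetFrame (Γ n b : ℝ → E 3) (γ τ : ℝ → ℝ) (Z : Set ℝ) : Prop where
  orthonormal : ∀ s, Orthonormal ℝ ![deriv Γ s, n s, b s]
  deriv_t : ∀ s, s ∉ Z → HasDerivAt (deriv Γ) (γ s • n s) s
  deriv_n : ∀ s, s ∉ Z → HasDerivAt n (-γ s • deriv Γ s + τ s • b s) s
  deriv_b : ∀ s, s ∉ Z → HasDerivAt b (-τ s • n s) s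

/-- First vector of the normal frame `(n, b)` rotated by the angle `α`. -/
def rotatedNormal (n b : ℝ → E 3) (α : ℝ → ℝ) (s : ℝ) : E 3 :=
  Real.cos (α s) • n s - Real.sin (α s) • b s

/-- Second vector of the normal frame `(n, b)` rotated by the angle `α`. -/
def rotatedBinormal (n b : ℝ → E 3) (α : ℝ → ℝ) (s : ℝ) : E 3 :=
  Real.sin (α s) • n s + Real.cos (α s) • b s

/-- The tube map in Cartesian coordinates `u` of the cross section; the next lemma gives it in polar
coordinates. -/
def tubeMap (Γ n b : ℝ → E 3) (α : ℝ → ℝ) (p : ℝ × E 2) : E 3 :=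
  Γ p.1 - (p.2 0 • rotatedNormal n b α p.1 + p.2 1 • rotatedBinormal n b α p.1)

/-- `x(s, r, θ) = Γ(s) - r [n(s) cos(θ - α(s)) + b(s) sin(θ - α(s))]`. -/
theorem tubeMap_polar (Γ n b : ℝ → E 3) (α : ℝ → ℝ) (s r θ : ℝ) :
    tubeMap Γ n b α (s, !₂[r * Real.cos θ, r * Real.sin θ]) =
      Γ s - r • (Real.cos (θ - α s) • n s + Real.sin (θ - α s) • b s) := by
  ext i
  simp [tubeMap, rotatedNormal, rotatedBinormal, Real.cos_sub, Real.sin_sub]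
  ring

/-- The potential `Ṽ` on `ℝ³`: `Ṽ(x(s, u)) = V(u)` for `s ∈ ℝ`, `u ∈ M`, and `Ṽ = 0` outside the
tube `x(ℝ × M)`. -/
def tubePotential (Γ n b : ℝ → E 3) (α : ℝ → ℝ) (M : Set (E 2)) (V : E 2 → ℝ) : E 3 → ℝ :=
  Function.extend (fun p : {p : ℝ × E 2 // p.2 ∈ M} => tubeMap Γ n b α p.1)
    (fun p => V p.1.2) 0

/-- Asymptotic straightness: either curvature and torsion vanish outside a bounded interval, or `Γ`
is `C⁴`, `τ` and `τ'` are bounded, and `γ`, `γ'`, `γ''` tend to zero at infinity (everything off the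
set `Z` of points at which triads are joined). -/
def AsymptoticallyStraight (Γ : ℝ → E 3) (γ τ : ℝ → ℝ) (Z : Set ℝ) : Prop :=
  (∃ s₀ > 0, ∀ s, s ∉ Z → s₀ < |s| → γ s = 0 ∧ τ s = 0) ∨
  (ContDiff ℝ 4 Γ ∧
    (∀ s, s ∉ Z → DifferentiableAt ℝ γ s ∧ DifferentiableAt ℝ (deriv γ) s ∧
      DifferentiableAt ℝ τ s) ∧
    (∃ C, ∀ s, s ∉ Z → |τ s| ≤ C ∧ |deriv τ s| ≤ C) ∧
    Tendsto γ (cocompact ℝ ⊓ 𝓟 Zᶜ) (𝓝 0) ∧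
    Tendsto (deriv γ) (cocompact ℝ ⊓ 𝓟 Zᶜ) (𝓝 0) ∧
    Tendsto (deriv (deriv γ)) (cocompact ℝ ⊓ 𝓟 Zᶜ) (𝓝 0))

end SoftWaveguide

end

/-! The essential spectrum depends only on what happens far away, and there the tube looks like a
straight cylinder in every bounded window.

Geometry. Rotating the normals by `α` cancels the torsion, since `α' = τ`: the new normals `N`, `B`
turn only towards the tangent, at rates bounded by the curvature, and these tend to zero
(`exists_isParallelFrame`). On balls of fixed radius the tube map is then, far along the curve, a
Lipschitz-small perturbation of a rigid motion (`IsParallelFrame.exists_almost_straight`).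
Assumption (c) keeps other portions of the tube out of the window. As `V` is only bounded and
measurable, the potentials need not converge uniformly; what survives is convergence in `L²` on
balls, in the rigid frame at `Γ(s)`, to the cylinder potential `V ∘ proj`
(`IsTubePotential.exists_eLpNorm_le`).

Upper part. Each `e + p²`, with `e` the ground-state energy, is approached by products of a slowly
modulated plane wave of frequency `p` and an approximate ground state of `h_V`. For a fixed product
of compact support, moved far out along the curve, the error caused by the bending is an `L²` error
of the potential against a bounded function (`IsTubePotential.mem_spec_add_sq`). This gives the
whole half-line, whose points are not isolated in the spectrum.

Lower part. In three dimensions the Sobolev inequality controls `∫ U f²` by the `L²` norm of `U` and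
the Dirichlet integral of `f`, so functions supported far out in a fixed window have energy at least
`(e - δ)‖f‖²` (`IsTubePotential.exists_local_energy_ge`). A localization formula, obtained by
averaging over all translates of one cutoff, turns this into a global bound with an error on a ball
(`IsTubePotential.exists_energy_ge`). Such a bound and Rellich compactness make the spectrum below
`e` discrete (`mem_discSpec_of_form_ge`).

Ground state. In the plane, logarithmic cutoffs equal to one on `M` have arbitrarily small Dirichlet
integral while `∫ V > 0`, so the form takes negative values (`exists_energy_neg`). Its infimum lies
in the spectrum, and it is discrete by the same compactness criterion, because `V` vanishes outside
a ball (`groundEnergy_spec`). -/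

noncomputable section

namespace SoftWaveguide

open scoped ComplexInnerProductSpace ComplexConjugate ContDiff

/-! ### Self-adjoint operators and their spectrum -/

section MaximalSymmetric

variable {H : Type*} [NormedAddCommGroup H] [InnerProductSpace ℂ H]

/-- A symmetric operator which extends its own adjoint, that is, a self-adjoint operator. -/
structure IsMaxSymmetric (T : H →ₗ.[ℂ] H) : Prop where
  symm : ∀ x y : T.domain, ⟪T x, (y : H)⟫ = ⟪(x : H), T y⟫
  maximal : ∀ φ χ : H, (∀ ψ : T.domain, ⟪T ψ, φ⟫ = ⟪(ψ : H), χ⟫) →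
    ∃ h : φ ∈ T.domain, T ⟨φ, h⟩ = χ

variable {T : H →ₗ.[ℂ] H}

/-- The quadratic form of an operator. -/
def form (T : H →ₗ.[ℂ] H) (ψ : T.domain) : ℝ := (⟪T ψ, (ψ : H)⟫).re

theorem IsMaxSymmetric.inner_eq_form (hT : IsMaxSymmetric T) (ψ : T.domain) :
    ⟪T ψ, (ψ : H)⟫ = (form T ψ : ℂ) := by
  have h : conj ⟪T ψ, (ψ : H)⟫ = ⟪T ψ, (ψ : H)⟫ := by
    rw [inner_conj_symm, hT.symm]
  exact (Complex.conj_eq_iff_re.1 h).symm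

/-- Pairing with a fixed domain vector is continuous, so the symmetry relation passes to the limit
and maximality applies. -/
theorem IsMaxSymmetric.closed (hT : IsMaxSymmetric T) {ψ : ℕ → T.domain} {φ χ : H}
    (h1 : Tendsto (fun n => (ψ n : H)) atTop (𝓝 φ)) (h2 : Tendsto (fun n => T (ψ n)) atTop (𝓝 χ)) :
    ∃ h : φ ∈ T.domain, T ⟨φ, h⟩ = χ := by
  refine hT.maximal φ χ fun ξ => ?_
  have a : Tendsto (fun n => ⟪T ξ, (ψ n : H)⟫) atTop (𝓝 ⟪T ξ, φ⟫) :=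
    Tendsto.inner tendsto_const_nhds h1
  have b : Tendsto (fun n => ⟪(ξ : H), T (ψ n)⟫) atTop (𝓝 ⟪(ξ : H), χ⟫) :=
    Tendsto.inner tendsto_const_nhds h2
  simp only [hT.symm] at a
  exact tendsto_nhds_unique a b

/-- The lower bound makes `T - z` injective and, as `T` is closed, its range closed. By maximality a
vector orthogonal to the range lies in the kernel of `T - conj z`, which is trivial by assumption;
the inverse is bounded by `c⁻¹`. -/
theorem IsMaxSymmetric.isResolventPoint [CompleteSpace H] (hT : IsMaxSymmetric T) {z : ℂ} {c : ℝ}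
    (hc : 0 < c) (hz : ∀ ψ : T.domain, c * ‖(ψ : H)‖ ≤ ‖T ψ - z • (ψ : H)‖)
    (hz' : ∀ ψ : T.domain, T ψ = conj z • (ψ : H) → ψ = 0) : IsResolventPoint T z := by
  let S : T.domain →ₗ[ℂ] H := T.toFun - z • T.domain.subtype
  have hS : ∀ ψ, S ψ = T ψ - z • (ψ : H) := fun ψ => rfl
  have hinj : Function.Injective S := by
    rw [← LinearMap.ker_eq_bot, LinearMap.ker_eq_bot']
    intro ψ hψ
    have := hz ψ
    rw [← hS, hψ, norm_zero] at this
    have h0 : ‖(ψ : H)‖ = 0 := le_antisymm (by nlinarith [norm_nonneg (ψ : H)]) (norm_nonneg _)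
    exact Subtype.ext (norm_eq_zero.1 h0)
  have hclosed : IsClosed (LinearMap.range S : Set H) := by
    refine IsSeqClosed.isClosed fun y₀ y hy₀ hy => ?_
    choose ψ hψ using hy₀
    have hcau : CauchySeq (fun n => (ψ n : H)) := by
      rw [Metric.cauchySeq_iff]
      intro ε hε
      obtain ⟨N, hN⟩ := Metric.cauchySeq_iff.1 hy.cauchySeq (c * ε) (by positivity)
      refine ⟨N, fun m hm n hn => ?_⟩
      have h1 := hN m hm n hn
      have h2 := hz (ψ m - ψ n)
      rw [← hS, map_sub, hψ, hψ, ← dist_eq_norm] at h2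
      rw [dist_eq_norm]
      rw [Submodule.coe_sub] at h2
      exact lt_of_mul_lt_mul_left (h2.trans_lt h1) hc.le
    obtain ⟨φ, hφ⟩ := cauchySeq_tendsto_of_complete hcau
    have hTψ : Tendsto (fun n => T (ψ n)) atTop (𝓝 (y + z • φ)) := by
      have : (fun n => T (ψ n)) = fun n => y₀ n + z • (ψ n : H) := by
        ext n; rw [← hψ, hS]; abel
      rw [this]
      exact hy.add (hφ.const_smul z)
    obtain ⟨h, hφ'⟩ := hT.closed hφ hTψ
    exact ⟨⟨φ, h⟩, by rw [hS, hφ']; simp⟩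
  have hsurj : LinearMap.range S = ⊤ := by
    have : CompleteSpace (LinearMap.range S) := hclosed.completeSpace_coe
    rw [← Submodule.orthogonal_eq_bot_iff, Submodule.eq_bot_iff]
    intro φ hφ
    rw [Submodule.mem_orthogonal] at hφ
    obtain ⟨h, hφ'⟩ := hT.maximal φ (conj z • φ) fun ψ => by
      have := hφ (S ψ) ⟨ψ, rfl⟩
      rw [hS, inner_sub_left, sub_eq_zero, inner_smul_left] at this
      rw [this, inner_smul_right]
    exact congrArg Subtype.val (hz' ⟨φ, h⟩ hφ')
  let e := LinearEquiv.ofBijective S ⟨hinj, LinearMap.range_eq_top.1 hsurj⟩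
  have he : ∀ f, T (e.symm f) - z • (e.symm f : H) = f := fun f => e.apply_symm_apply f
  let R : H →L[ℂ] H := (T.domain.subtype ∘ₗ e.symm.toLinearMap).mkContinuous c⁻¹ fun f => by
    have := hz (e.symm f)
    rw [he f] at this
    rw [inv_mul_eq_div, le_div_iff₀ hc, mul_comm]
    exact this
  refine ⟨R, fun f => ⟨(e.symm f).2, he f⟩, fun ψ => ?_⟩
  exact congrArg Subtype.val (e.symm_apply_apply ψ)

/-- Easy half of Weyl's criterion: a bounded inverse `R` would force `‖ψ‖ ≤ ‖R‖ ‖(T - z) ψ‖`. -/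
theorem mem_spec_of_approx {z : ℂ}
    (h : ∀ δ > 0, ∃ ψ : T.domain, ‖T ψ - z • (ψ : H)‖ ≤ δ * ‖(ψ : H)‖ ∧ (ψ : H) ≠ 0) :
    z ∈ spec T := by
  rintro ⟨R, -, hR⟩
  -- With this tolerance `‖R‖ δ < 1`; the added one covers `R = 0`.
  obtain ⟨ψ, h1, h2⟩ := h (1 / (‖R‖ + 1)) (by positivity)
  have h3 : ‖(ψ : H)‖ ≤ ‖R‖ * ‖T ψ - z • (ψ : H)‖ := by
    conv_lhs => rw [← hR ψ]
    exact R.le_opNorm _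
  have h4 : 0 < ‖(ψ : H)‖ := norm_pos_iff.2 h2
  have h5 : ‖R‖ * ‖T ψ - z • (ψ : H)‖ ≤ ‖R‖ * (1 / (‖R‖ + 1) * ‖(ψ : H)‖) := by gcongr
  have h6 : ‖R‖ * (1 / (‖R‖ + 1) * ‖(ψ : H)‖) < ‖(ψ : H)‖ := by
    have : ‖R‖ * (1 / (‖R‖ + 1) * ‖(ψ : H)‖) = ‖R‖ / (‖R‖ + 1) * ‖(ψ : H)‖ := by ring
    rw [this]
    have : ‖R‖ / (‖R‖ + 1) < 1 := by rw [div_lt_one (by positivity)]; linarith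
    nlinarith
  linarith

/-- The quadratic form of a symmetric operator is real, so the imaginary part of `⟪(T - z) ψ, ψ⟫`
comes from `z` alone. -/
theorem IsMaxSymmetric.abs_im_mul_norm_le (hT : IsMaxSymmetric T) (z : ℂ) (ψ : T.domain) :
    |z.im| * ‖(ψ : H)‖ ≤ ‖T ψ - z • (ψ : H)‖ := by
  rcases eq_or_ne (ψ : H) 0 with h0 | h0
  · rw [h0]; simp
  have h1 : ⟪T ψ - z • (ψ : H), (ψ : H)⟫.im = z.im * ‖(ψ : H)‖ ^ 2 := by
    rw [inner_sub_left, hT.inner_eq_form, inner_smul_left, inner_self_eq_norm_sq_to_K]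
    simp [← Complex.ofReal_pow]
  have h2 : |z.im * ‖(ψ : H)‖ ^ 2| ≤ ‖T ψ - z • (ψ : H)‖ * ‖(ψ : H)‖ := by
    rw [← h1]
    exact (Complex.abs_im_le_norm _).trans (norm_inner_le_norm _ _)
  rw [abs_mul, abs_of_nonneg (sq_nonneg ‖(ψ : H)‖), sq, ← mul_assoc] at h2
  exact le_of_mul_le_mul_right h2 (norm_pos_iff.2 h0)

theorem IsMaxSymmetric.im_eq_zero_of_mem_spec [CompleteSpace H] (hT : IsMaxSymmetric T) {z : ℂ}
    (hz : z ∈ spec T) : z.im = 0 := by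
  by_contra h
  refine hz (hT.isResolventPoint (abs_pos.2 h) (hT.abs_im_mul_norm_le z) fun ψ hψ => ?_)
  have h2 := hT.abs_im_mul_norm_le (conj z) ψ
  rw [hψ, sub_self, norm_zero, Complex.conj_im, abs_neg] at h2
  have : ‖(ψ : H)‖ = 0 := le_antisymm (by
    have := abs_pos.2 h
    nlinarith [norm_nonneg (ψ : H)]) (norm_nonneg _)
  exact Subtype.ext (norm_eq_zero.1 this)

theorem exists_norm_eq_one_of_lt {z : ℂ} {δ : ℝ} {ψ : T.domain}
    (h : ‖T ψ - z • (ψ : H)‖ < δ * ‖(ψ : H)‖) :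
    ∃ φ : T.domain, ‖(φ : H)‖ = 1 ∧ ‖T φ - z • (φ : H)‖ < δ := by
  have h0 : 0 < ‖(ψ : H)‖ := by
    refine (norm_nonneg _).lt_of_ne fun h0 => ?_
    rw [← h0, mul_zero] at h
    exact absurd h (norm_nonneg _).not_gt
  refine ⟨((‖(ψ : H)‖⁻¹ : ℝ) : ℂ) • ψ, ?_, ?_⟩
  · rw [Submodule.coe_smul, norm_smul]
    simp [h0.ne']
  · have : T (((‖(ψ : H)‖⁻¹ : ℝ) : ℂ) • ψ) - z • ((((‖(ψ : H)‖⁻¹ : ℝ) : ℂ) • ψ : T.domain) : H) =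
        ((‖(ψ : H)‖⁻¹ : ℝ) : ℂ) • (T ψ - z • (ψ : H)) := by
      rw [T.map_smul, Submodule.coe_smul, smul_sub, smul_comm z]
    rw [this, norm_smul, Complex.norm_real, norm_inv, norm_norm, inv_mul_lt_iff₀ h0, mul_comm]
    exact h

/-- Converse half of Weyl's criterion at real points. Without approximate eigenvectors `T - l` is
bounded below, and since `conj l = l` the same bound excludes a kernel of the adjoint. -/
theorem IsMaxSymmetric.exists_approx [CompleteSpace H] (hT : IsMaxSymmetric T) {l : ℝ}
    (hl : (l : ℂ) ∈ spec T) {δ : ℝ} (hδ : 0 < δ) :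
    ∃ ψ : T.domain, ‖(ψ : H)‖ = 1 ∧ ‖T ψ - (l : ℂ) • (ψ : H)‖ < δ := by
  by_contra hcon
  have key : ∀ ψ : T.domain, δ * ‖(ψ : H)‖ ≤ ‖T ψ - (l : ℂ) • (ψ : H)‖ := fun ψ => by
    by_contra! h
    exact hcon (exists_norm_eq_one_of_lt h)
  refine hl (hT.isResolventPoint hδ key fun ψ hψ => ?_)
  rw [Complex.conj_ofReal] at hψ
  have := key ψ
  rw [hψ, sub_self, norm_zero] at this
  exact Subtype.ext (norm_eq_zero.1 (le_antisymm (by nlinarith [norm_nonneg (ψ : H)])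
    (norm_nonneg _)))

theorem form_sub_smul (l : ℝ) (ψ : T.domain) :
    (⟪T ψ - (l : ℂ) • (ψ : H), (ψ : H)⟫).re = form T ψ - l * ‖(ψ : H)‖ ^ 2 := by
  rw [inner_sub_left, inner_smul_left, inner_self_eq_norm_sq_to_K, Complex.sub_re, form]
  simp [← Complex.ofReal_pow]

theorem form_sub_le_norm_mul (l : ℝ) (ψ : T.domain) :
    form T ψ - l * ‖(ψ : H)‖ ^ 2 ≤ ‖T ψ - (l : ℂ) • (ψ : H)‖ * ‖(ψ : H)‖ := by
  rw [← form_sub_smul]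
  exact (Complex.re_le_norm _).trans (norm_inner_le_norm _ _)

theorem IsMaxSymmetric.le_of_mem_spec [CompleteSpace H] (hT : IsMaxSymmetric T) {m l : ℝ}
    (hm : ∀ ψ : T.domain, m * ‖(ψ : H)‖ ^ 2 ≤ form T ψ) (hl : (l : ℂ) ∈ spec T) : m ≤ l := by
  refine le_of_forall_pos_lt_add fun δ hδ => ?_
  obtain ⟨ψ, h1, h2⟩ := hT.exists_approx hl hδ
  have h3 := form_sub_le_norm_mul l ψ
  have h4 := hm ψ
  rw [h1] at h3 h4
  linarith

/-- The Cauchy–Schwarz inequality for the form of `T - m`. -/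
theorem IsMaxSymmetric.norm_inner_sq_le (hT : IsMaxSymmetric T) {m : ℝ}
    (hm : ∀ ψ : T.domain, m * ‖(ψ : H)‖ ^ 2 ≤ form T ψ) (ψ φ : T.domain) :
    ‖⟪T ψ - (m : ℂ) • (ψ : H), (φ : H)⟫‖ ^ 2 ≤
      (form T ψ - m * ‖(ψ : H)‖ ^ 2) * (form T φ - m * ‖(φ : H)‖ ^ 2) := by
  -- `T - m` induces a positive semidefinite sesquilinear form on the domain; definiteness is not
  -- needed for Cauchy–Schwarz.
  let core : PreInnerProductSpace.Core ℂ T.domain :=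
    { inner := fun x y => ⟪T x - (m : ℂ) • (x : H), (y : H)⟫
      conj_inner_symm := fun x y => by
        rw [inner_conj_symm, inner_sub_right, inner_sub_left, hT.symm, inner_smul_left,
          inner_smul_right, Complex.conj_ofReal]
      re_inner_nonneg := fun x => by
        have := form_sub_smul m x
        simp only [RCLike.re_to_complex]
        rw [this]
        linarith [hm x]
      add_left := fun x y z => by
        rw [T.map_add, Submodule.coe_add, ← inner_add_left]
        congr 1
        module
      smul_left := fun x y r => by
        rw [T.map_smul, Submodule.coe_smul, ← inner_smul_left, smul_sub, smul_comm r] }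
  have h := @InnerProductSpace.Core.inner_mul_inner_self_le ℂ T.domain _ _ _ core ψ φ
  have e1 : ‖⟪T ψ - (m : ℂ) • (ψ : H), (φ : H)⟫‖ = ‖⟪T φ - (m : ℂ) • (φ : H), (ψ : H)⟫‖ := by
    have := core.conj_inner_symm ψ φ
    change conj ⟪T φ - (m : ℂ) • (φ : H), (ψ : H)⟫ = ⟪T ψ - (m : ℂ) • (ψ : H), (φ : H)⟫ at this
    rw [← this, RCLike.norm_conj]
  change ‖⟪T ψ - (m : ℂ) • (ψ : H), (φ : H)⟫‖ * ‖⟪T φ - (m : ℂ) • (φ : H), (ψ : H)⟫‖ ≤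
    (⟪T ψ - (m : ℂ) • (ψ : H), (ψ : H)⟫).re * (⟪T φ - (m : ℂ) • (φ : H), (φ : H)⟫).re at h
  rw [form_sub_smul, form_sub_smul, ← e1] at h
  rw [sq]
  exact h

/-- Let `q` be the form of `T - m`. If `R` inverted `T - m`, Cauchy–Schwarz for `q` with `R ψ` and
`ψ` would give `1 = ‖ψ‖⁴ ≤ q(R ψ) q(ψ) ≤ ‖R‖ q(ψ)`, which fails once `q(ψ)` is small. -/
theorem IsMaxSymmetric.mem_spec_of_inf (hT : IsMaxSymmetric T) {m : ℝ}
    (hm : ∀ ψ : T.domain, m * ‖(ψ : H)‖ ^ 2 ≤ form T ψ)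
    (hm' : ∀ δ > 0, ∃ ψ : T.domain, ‖(ψ : H)‖ = 1 ∧ form T ψ < m + δ) : (m : ℂ) ∈ spec T := by
  rintro ⟨R, hR1, hR2⟩
  obtain ⟨ψ, h1, h2⟩ := hm' (1 / (‖R‖ + 1)) (by positivity)
  obtain ⟨h3, h4⟩ := hR1 (ψ : H)
  have h5 := hT.norm_inner_sq_le hm ⟨R ψ, h3⟩ ψ
  have h6 : form T ⟨R ψ, h3⟩ - m * ‖R ψ‖ ^ 2 ≤ ‖R‖ := by
    have := form_sub_le_norm_mul m (⟨R ψ, h3⟩ : T.domain)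
    rw [h4, h1, one_mul] at this
    refine this.trans ?_
    simpa [h1] using R.le_opNorm (ψ : H)
  rw [h4, inner_self_eq_norm_sq_to_K, h1] at h5
  have h7 : 0 ≤ form T ψ - m * ‖(ψ : H)‖ ^ 2 := by linarith [hm ψ]
  have h8 : (form T ⟨R ψ, h3⟩ - m * ‖R ψ‖ ^ 2) * (form T ψ - m * ‖(ψ : H)‖ ^ 2) ≤
      ‖R‖ * (1 / (‖R‖ + 1)) := by
    rw [h1] at h7 ⊢
    exact mul_le_mul h6 (by linarith) h7 (norm_nonneg _)
  have h9 : ‖R‖ * (1 / (‖R‖ + 1)) < 1 := by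
    rw [mul_one_div, div_lt_one (by positivity)]; linarith
  rw [h1] at h8
  simp at h5
  simp at h8 h9
  linarith

/-- If approximate eigenvectors at the levels below `E` are relatively compact, then the spectrum
below `E` is discrete. -/
theorem IsMaxSymmetric.mem_discSpec_of_compact [CompleteSpace H] (hT : IsMaxSymmetric T) {E : ℝ}
    (hK : ∀ (l : ℕ → ℝ) (l₀ : ℝ) (ψ : ℕ → T.domain), l₀ < E → Tendsto l atTop (𝓝 l₀) →
      (∀ n, ‖(ψ n : H)‖ ≤ 1) →
      Tendsto (fun n => ‖T (ψ n) - (l n : ℂ) • (ψ n : H)‖) atTop (𝓝 0) →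
      ∃ (φ : H) (k : ℕ → ℕ), StrictMono k ∧ Tendsto (fun n => (ψ (k n) : H)) atTop (𝓝 φ))
    {l₀ : ℝ} (hl₀ : l₀ < E) (hspec : (l₀ : ℂ) ∈ spec T) : (l₀ : ℂ) ∈ discSpec T := by
  -- Compactness turns approximate eigenvectors into true ones: the limit of a subsequence is a unit
  -- eigenvector because `T` is closed.
  have eigen : ∀ l : ℝ, l < E → (l : ℂ) ∈ spec T →
      ∃ ψ : T.domain, ‖(ψ : H)‖ = 1 ∧ T ψ = (l : ℂ) • (ψ : H) := by
    intro l hl hs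
    choose ψ h1 h2 using fun n : ℕ => hT.exists_approx hs (δ := 1 / ((n : ℝ) + 1)) (by positivity)
    have h3 : Tendsto (fun n => ‖T (ψ n) - (l : ℂ) • (ψ n : H)‖) atTop (𝓝 0) :=
      squeeze_zero (fun _ => norm_nonneg _) (fun n => (h2 n).le) tendsto_one_div_add_atTop_nhds_zero_nat
    obtain ⟨φ, k, hk, hφ⟩ := hK (fun _ => l) l ψ hl tendsto_const_nhds (fun n => (h1 n).le) h3
    have h4 : Tendsto (fun n => T (ψ (k n))) atTop (𝓝 ((l : ℂ) • φ)) := by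
      have a := (tendsto_zero_iff_norm_tendsto_zero.2 h3).comp hk.tendsto_atTop
      have b := a.add (hφ.const_smul (l : ℂ))
      simpa using b
    obtain ⟨h, hφ'⟩ := hT.closed hφ h4
    refine ⟨⟨φ, h⟩, ?_, hφ'⟩
    have := hφ.norm
    simp only [h1] at this
    exact tendsto_nhds_unique this tendsto_const_nhds
  refine ⟨hspec, ?_, ?_, ?_⟩
  · by_contra! hcon
    -- If `l₀` is not isolated, other spectral points accumulate at it. The bound `E - l₀` in the
    -- minimum keeps them below `E`, so that all are eigenvalues.
    have hex : ∀ n : ℕ, ∃ l : ℝ, (l : ℂ) ∈ spec T ∧ |l - l₀| < min (1 / ((n : ℝ) + 1)) (E - l₀) ∧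
        l ≠ l₀ := by
      intro n
      have := hcon (min (1 / ((n : ℝ) + 1)) (E - l₀)) (lt_min (by positivity) (by linarith))
      obtain ⟨z, ⟨hz, hz'⟩, hne⟩ := Set.not_subset.1 this
      have him := hT.im_eq_zero_of_mem_spec hz
      have hzr : ((z.re : ℝ) : ℂ) = z := Complex.ext rfl (by simp [him])
      refine ⟨z.re, by rwa [hzr], ?_, fun h => hne (by rw [← hzr, h]; rfl)⟩
      rwa [Metric.mem_ball, ← hzr, Complex.dist_eq, ← Complex.ofReal_sub, Complex.norm_real] at hz'
    choose l hl1 hl2 hl3 using hex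
    have hlt : Tendsto l atTop (𝓝 l₀) := by
      rw [tendsto_iff_dist_tendsto_zero]
      exact squeeze_zero (fun _ => dist_nonneg) (fun n => (lt_min_iff.1 (hl2 n)).1.le)
        tendsto_one_div_add_atTop_nhds_zero_nat
    have hlE : ∀ n, l n < E := fun n => by
      have := (abs_lt.1 (lt_min_iff.1 (hl2 n)).2).2
      linarith
    choose ψ h1 h2 using fun n => eigen (l n) (hlE n) (hl1 n)
    obtain ⟨φ, k, hk, hφ⟩ := hK l l₀ ψ hl₀ hlt (fun n => (h1 n).le) (by simp [h2])
    have horth : ∀ m n, l m ≠ l n → ⟪(ψ m : H), (ψ n : H)⟫ = 0 := by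
      intro m n hmn
      have := hT.symm (ψ m) (ψ n)
      rw [h2, h2, inner_smul_left, inner_smul_right, Complex.conj_ofReal] at this
      have h3 : ((l m : ℂ) - l n) * ⟪(ψ m : H), (ψ n : H)⟫ = 0 := by rw [sub_mul, this, sub_self]
      refine (mul_eq_zero.1 h3).resolve_left ?_
      rw [← Complex.ofReal_sub]
      exact_mod_cast sub_ne_zero.2 hmn
    have hφ1 : ‖φ‖ = 1 := by
      have := hφ.norm
      simp only [h1] at this
      exact tendsto_nhds_unique this tendsto_const_nhds
    -- For fixed `m` the values `l (k n)` tend to `l₀ ≠ l m`, hence eventually differ from `l m`.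
    -- The limit `φ` is thus orthogonal to every `ψ m`, and finally to itself, against `‖φ‖ = 1`.
    have hψφ : ∀ m, ⟪(ψ m : H), φ⟫ = 0 := by
      intro m
      have a : Tendsto (fun n => ⟪(ψ m : H), (ψ (k n) : H)⟫) atTop (𝓝 ⟪(ψ m : H), φ⟫) :=
        Tendsto.inner tendsto_const_nhds hφ
      have b : ∀ᶠ n in atTop, ⟪(ψ m : H), (ψ (k n) : H)⟫ = 0 := by
        have := (hlt.comp hk.tendsto_atTop).eventually_ne (hl3 m).symm
        filter_upwards [this] with n hn
        exact horth m (k n) (Ne.symm hn)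
      exact tendsto_nhds_unique (a.congr' b) tendsto_const_nhds
    have : Tendsto (fun n => ⟪(ψ (k n) : H), φ⟫) atTop (𝓝 ⟪φ, φ⟫) :=
      Tendsto.inner hφ tendsto_const_nhds
    simp only [hψφ] at this
    have h0 := tendsto_nhds_unique this tendsto_const_nhds
    rw [inner_self_eq_zero] at h0
    rw [h0, norm_zero] at hφ1
    exact zero_ne_one hφ1
  · obtain ⟨ψ, h1, h2⟩ := eigen l₀ hl₀ hspec
    intro hbot
    have : ψ ∈ eigenspace T l₀ := by
      rw [eigenspace, LinearMap.mem_ker]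
      change T ψ - (l₀ : ℂ) • (ψ : H) = 0
      rw [h2, sub_self]
    rw [hbot, Submodule.mem_bot] at this
    rw [this] at h1
    simp at h1
  · have hmem : ∀ ψ : eigenspace T l₀, T ψ.1 = (l₀ : ℂ) • ((ψ : T.domain) : H) := fun ψ =>
      sub_eq_zero.1 (LinearMap.mem_ker.1 ψ.2)
    -- Riesz: a normed space with compact unit ball is finite dimensional.
    refine FiniteDimensional.of_isCompact_closedBall₀ ℂ zero_lt_one (V := eigenspace T l₀)
      (IsSeqCompact.isCompact fun ψ hψ => ?_)
    have hb : ∀ n, ‖((ψ n : T.domain) : H)‖ ≤ 1 := fun n => by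
      simpa using hψ n
    obtain ⟨φ, k, hk, hφ⟩ := hK (fun _ => l₀) l₀ (fun n => ψ n) hl₀ tendsto_const_nhds hb
      (by simp [hmem])
    have h4 : Tendsto (fun n => T (ψ (k n) : T.domain)) atTop (𝓝 ((l₀ : ℂ) • φ)) := by
      simp only [hmem]
      exact hφ.const_smul _
    obtain ⟨h, hφ'⟩ := hT.closed hφ h4
    have hφm : (⟨φ, h⟩ : T.domain) ∈ eigenspace T l₀ := by
      rw [eigenspace, LinearMap.mem_ker]
      change T ⟨φ, h⟩ - (l₀ : ℂ) • φ = 0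
      rw [hφ', sub_self]
    refine ⟨⟨⟨φ, h⟩, hφm⟩, ?_, k, hk, ?_⟩
    · rw [mem_closedBall_zero_iff]
      exact le_of_tendsto hφ.norm (Eventually.of_forall fun n => hb (k n))
    · rw [tendsto_subtype_rng, tendsto_subtype_rng]
      exact hφ

end MaximalSymmetric

/-! ### The Laplacian in `L²` -/

section Laplacian

open FourierTransform TemperedDistribution Real

variable {d : ℕ}

theorem laplacianL2_toTemperedDistribution (ψ : (laplacianL2 d).domain) :
    Δ ((ψ : L2 d) : 𝓢'(E d, ℂ)) = (laplacianL2 d ψ : 𝓢'(E d, ℂ)) :=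
  (exists_laplacian ψ.2).choose_spec

/-- The Bessel potential of order two is `1 - (2π)⁻² Δ`. -/
theorem laplacian_eq_sub_besselPotential (f : 𝓢'(E d, ℂ)) :
    Δ f = (((2 * π) ^ 2 : ℝ) : ℂ) • (f - besselPotential (E d) ℂ 2 f) := by
  have h : besselPotential (E d) ℂ 2 f =
      f + fourierMultiplierCLM ℂ (fun x : E d => Complex.ofReal (‖x‖ ^ 2)) f := by
    rw [besselPotential, fourierMultiplierCLM_apply, fourierMultiplierCLM_apply]
    have : (fun x : E d => Complex.ofReal ((1 + ‖x‖ ^ 2) ^ ((2 : ℝ) / 2))) =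
        (fun _ => 1) + fun x => Complex.ofReal (‖x‖ ^ 2) := by
      ext x; simp
    rw [this, smulLeftCLM_add (by fun_prop) (by fun_prop)]
    simp [FourierTransform.fourierInv_add]
  rw [h, laplacian_eq_fourierMultiplierCLM, ← Complex.coe_smul]
  simp only [sub_add_cancel_left, smul_neg]
  push_cast
  rw [neg_smul]

/-- If `ψ` and its distributional Laplacian are square integrable, so is the order-two Bessel
potential `ψ - (2π)⁻² Δψ`, and this is membership in `H²`. -/
theorem exists_mem_sobolevTwo {ψ χ : L2 d} (h : Δ (ψ : 𝓢'(E d, ℂ)) = (χ : 𝓢'(E d, ℂ))) :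
    ∃ h : ψ ∈ (laplacianL2 d).domain, laplacianL2 d ⟨ψ, h⟩ = χ := by
  have h2 : besselPotential (E d) ℂ 2 (ψ : 𝓢'(E d, ℂ)) =
      ((ψ - (((2 * π) ^ 2 : ℝ) : ℂ)⁻¹ • χ : L2 d) : 𝓢'(E d, ℂ)) := by
    rw [laplacian_eq_sub_besselPotential] at h
    rw [← Lp.toTemperedDistributionCLM_apply (_ - _), map_sub, map_smul]
    simp only [Lp.toTemperedDistributionCLM_apply]
    rw [← h, inv_smul_smul₀ (by norm_cast; positivity), sub_sub_cancel]
  have hm : ψ ∈ (laplacianL2 d).domain := ⟨_, h2⟩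
  refine ⟨hm, toTemperedDistribution_injective ?_⟩
  rw [← laplacianL2_toTemperedDistribution, h]

/-! ### The bounded inverse of `1 - (2π)⁻² Δ` and the symmetry of the Laplacian -/

variable (d) in
/-- The symbol `(1 + |x|²)⁻¹` of the Bessel potential of order `-2`. -/
def besselSymbol (x : E d) : ℂ := ((1 + ‖x‖ ^ 2) ^ ((-2 : ℝ) / 2) : ℝ)

theorem besselSymbol_eq (x : E d) : besselSymbol d x = (((1 + ‖x‖ ^ 2)⁻¹ : ℝ) : ℂ) := by
  rw [besselSymbol]
  norm_num [Real.rpow_neg_one]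

theorem hasTemperateGrowth_besselSymbol : (besselSymbol d).HasTemperateGrowth := by
  unfold besselSymbol; fun_prop

theorem norm_besselSymbol_le_one (x : E d) : ‖besselSymbol d x‖ ≤ 1 := by
  rw [besselSymbol_eq, Complex.norm_real, Real.norm_eq_abs, abs_of_nonneg (by positivity)]
  exact inv_le_one_of_one_le₀ (by nlinarith [sq_nonneg ‖x‖])

theorem memLp_besselSymbol : MemLp (besselSymbol d) ⊤ (volume : Measure (E d)) :=
  memLp_top_of_bound hasTemperateGrowth_besselSymbol.1.continuous.aestronglyMeasurable 1
    (Eventually.of_forall norm_besselSymbol_le_one)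

/-- The resolvent `(1 - (2π)⁻² Δ)⁻¹` on `L²`. -/
def bessel (g : L2 d) : L2 d :=
  𝓕⁻ ((memLp_besselSymbol (d := d)).toLp (besselSymbol d) • 𝓕 g : L2 d)

theorem coeFn_fourier_bessel (g : L2 d) :
    (𝓕 (bessel g) : L2 d) =ᵐ[volume] fun x => besselSymbol d x * (𝓕 g : L2 d) x := by
  rw [bessel, fourier_fourierInv_eq]
  filter_upwards [Lp.coeFn_lpSMul (r := 2)
      ((memLp_besselSymbol (d := d)).toLp (besselSymbol d)) (𝓕 g : L2 d),
    (memLp_besselSymbol (d := d)).coeFn_toLp] with x h1 h2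
  rw [h1, Pi.smul_apply', h2, smul_eq_mul]

theorem bessel_toTemperedDistribution (g : L2 d) :
    (bessel g : 𝓢'(E d, ℂ)) = besselPotential (E d) ℂ (-2) (g : 𝓢'(E d, ℂ)) := by
  rw [bessel, ← Lp.fourierInv_toTemperedDistribution_eq,
    Lp.toTemperedDistribution_smul_eq hasTemperateGrowth_besselSymbol,
    ← Lp.fourier_toTemperedDistribution_eq]
  rfl

theorem exists_laplacian_bessel (g : L2 d) :
    ∃ h : bessel g ∈ (laplacianL2 d).domain,
      laplacianL2 d ⟨bessel g, h⟩ = (((2 * π) ^ 2 : ℝ) : ℂ) • (bessel g - g) := by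
  refine exists_mem_sobolevTwo ?_
  rw [laplacian_eq_sub_besselPotential, ← Lp.toTemperedDistributionCLM_apply (_ • _), map_smul,
    map_sub]
  simp only [Lp.toTemperedDistributionCLM_apply]
  congr 2
  rw [bessel_toTemperedDistribution, besselPotential_besselPotential_apply]
  simp

/-- `H²` is the range of `bessel`. Questions about the Laplacian thereby become questions about a
bounded Fourier multiplier. -/
theorem eq_bessel (ψ : (laplacianL2 d).domain) :
    (ψ : L2 d) = bessel ((ψ : L2 d) - (((2 * π) ^ 2 : ℝ) : ℂ)⁻¹ • laplacianL2 d ψ) := by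
  apply toTemperedDistribution_injective
  rw [bessel_toTemperedDistribution, ← Lp.toTemperedDistributionCLM_apply (_ - _), map_sub,
    map_smul]
  simp only [Lp.toTemperedDistributionCLM_apply]
  rw [← laplacianL2_toTemperedDistribution, laplacian_eq_sub_besselPotential,
    inv_smul_smul₀ (by norm_cast; positivity), sub_sub_cancel,
    besselPotential_besselPotential_apply]
  simp

theorem inner_bessel_left (a b : L2 d) : ⟪bessel a, b⟫ = ⟪a, bessel b⟫ := by
  rw [← Lp.inner_fourier_eq, ← Lp.inner_fourier_eq a, L2.inner_def, L2.inner_def]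
  apply integral_congr_ae
  filter_upwards [coeFn_fourier_bessel a, coeFn_fourier_bessel b] with x h1 h2
  rw [h1, h2, ← smul_eq_mul, ← smul_eq_mul, inner_smul_left, inner_smul_right, besselSymbol_eq,
    Complex.conj_ofReal]

/-- The inverse of a symmetric operator is symmetric: the real symbol makes `bessel` symmetric, and
the Laplacian is an affine function of its inverse. -/
theorem inner_laplacianL2_left (ψ φ : (laplacianL2 d).domain) :
    ⟪laplacianL2 d ψ, (φ : L2 d)⟫ = ⟪(ψ : L2 d), laplacianL2 d φ⟫ := by
  have key : ∀ ψ : (laplacianL2 d).domain, laplacianL2 d ψ = (((2 * π) ^ 2 : ℝ) : ℂ) •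
      ((ψ : L2 d) - ((ψ : L2 d) - (((2 * π) ^ 2 : ℝ) : ℂ)⁻¹ • laplacianL2 d ψ)) := fun ψ => by
    rw [sub_sub_cancel, smul_inv_smul₀ (by norm_cast; positivity)]
  have h := inner_bessel_left ((ψ : L2 d) - (((2 * π) ^ 2 : ℝ) : ℂ)⁻¹ • laplacianL2 d ψ)
    ((φ : L2 d) - (((2 * π) ^ 2 : ℝ) : ℂ)⁻¹ • laplacianL2 d φ)
  rw [← eq_bessel, ← eq_bessel] at h
  rw [key ψ, key φ, inner_smul_left, inner_smul_right, inner_sub_left, inner_sub_right, h,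
    Complex.conj_ofReal]

theorem exists_laplacian_toLp (f : 𝓢(E d, ℂ)) :
    ∃ h : (f.toLp 2 volume : L2 d) ∈ (laplacianL2 d).domain,
      laplacianL2 d ⟨(f.toLp 2 volume : L2 d), h⟩ = ((Δ f : 𝓢(E d, ℂ)).toLp 2 volume : L2 d) := by
  refine exists_mem_sobolevTwo ?_
  rw [Lp.toTemperedDistribution_toLp_eq, Lp.toTemperedDistribution_toLp_eq,
    laplacian_toTemperedDistributionCLM_eq]

/-- Pointwise complex conjugation of a Schwartz function. -/
def conjSchwartz (f : 𝓢(E d, ℂ)) : 𝓢(E d, ℂ) :=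
  SchwartzMap.postcompCLM (𝕜 := ℝ) (Complex.conjCLE : ℂ →L[ℝ] ℂ) f

theorem conjSchwartz_apply (f : 𝓢(E d, ℂ)) (x : E d) : conjSchwartz f x = conj (f x) := rfl

theorem laplacian_conjSchwartz (f : 𝓢(E d, ℂ)) : Δ (conjSchwartz f) = conjSchwartz (Δ f) := by
  ext x
  rw [SchwartzMap.laplacian_apply, conjSchwartz_apply, SchwartzMap.laplacian_apply]
  exact ((f.smooth 2).contDiffAt).laplacian_CLM_comp_left (l := (Complex.conjCLE : ℂ →L[ℝ] ℂ))

/-- The inner product is conjugate linear in its first argument and the distributional pairing is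
bilinear; conjugation reconciles them. -/
theorem inner_toLp_conjSchwartz (u : 𝓢(E d, ℂ)) (φ : L2 d) :
    ⟪(conjSchwartz u).toLp 2, φ⟫ = (φ : 𝓢'(E d, ℂ)) u := by
  rw [L2.inner_def, Lp.toTemperedDistribution_apply]
  apply integral_congr_ae
  filter_upwards [(conjSchwartz u).coeFn_toLp 2] with x hx
  rw [hx, conjSchwartz_apply, RCLike.inner_apply, Complex.conj_conj, smul_eq_mul, mul_comm]

/-- Schwartz functions already suffice as test vectors: on them the hypothesis says that `χ` is the
distributional Laplacian of `φ`. -/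
theorem exists_mem_sobolevTwo_of_inner {φ χ : L2 d}
    (h : ∀ ψ : (laplacianL2 d).domain, ⟪laplacianL2 d ψ, φ⟫ = ⟪(ψ : L2 d), χ⟫) :
    ∃ h : φ ∈ (laplacianL2 d).domain, laplacianL2 d ⟨φ, h⟩ = χ := by
  refine exists_mem_sobolevTwo ?_
  ext u
  rw [laplacian_apply_apply, ← inner_toLp_conjSchwartz, ← inner_toLp_conjSchwartz,
    ← laplacian_conjSchwartz]
  obtain ⟨h1, h2⟩ := exists_laplacian_toLp (conjSchwartz u)
  have := h ⟨_, h1⟩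
  rwa [h2] at this

/-! ### Bounded potentials -/

variable {W : E d → ℝ}

theorem memLp_mul_of_memLp_top (hW : MemLp W ⊤ volume) (ψ : L2 d) :
    MemLp (fun x => (W x : ℂ) * ψ x) 2 volume := by
  have := (Lp.memLp ψ).mul (hW.ofReal (K := ℂ)) (r := 2)
  exact this

theorem mem_mulDomain (hW : MemLp W ⊤ volume) (ψ : L2 d) : ψ ∈ mulDomain W :=
  memLp_mul_of_memLp_top hW ψ

/-- Multiplication by a bounded function, as an everywhere defined map. -/
def mulFun (hW : MemLp W ⊤ volume) (ψ : L2 d) : L2 d := (memLp_mul_of_memLp_top hW ψ).toLp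

theorem coeFn_mulFun (hW : MemLp W ⊤ volume) (ψ : L2 d) :
    mulFun hW ψ =ᵐ[volume] fun x => (W x : ℂ) * ψ x := MemLp.coeFn_toLp _

theorem inner_mulFun_left (hW : MemLp W ⊤ volume) (ψ φ : L2 d) :
    ⟪mulFun hW ψ, φ⟫ = ⟪ψ, mulFun hW φ⟫ := by
  rw [L2.inner_def, L2.inner_def]
  apply integral_congr_ae
  filter_upwards [coeFn_mulFun hW ψ, coeFn_mulFun hW φ] with x h1 h2
  rw [h1, h2, ← smul_eq_mul, ← smul_eq_mul, inner_smul_left, inner_smul_right, Complex.conj_ofReal]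

theorem norm_mulFun_le (hW : MemLp W ⊤ volume) {C : ℝ} (hC : ∀ᵐ x, |W x| ≤ C)
    (ψ : L2 d) : ‖mulFun hW ψ‖ ≤ C * ‖ψ‖ := by
  refine Lp.norm_le_mul_norm_of_ae_le_mul ?_
  filter_upwards [coeFn_mulFun hW ψ, hC] with x h1 h2
  rw [h1, norm_mul, Complex.norm_real]
  exact mul_le_mul_of_nonneg_right h2 (norm_nonneg _)

theorem mulFun_sub (hW : MemLp W ⊤ volume) (ψ φ : L2 d) :
    mulFun hW (ψ - φ) = mulFun hW ψ - mulFun hW φ := by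
  apply Lp.ext
  filter_upwards [coeFn_mulFun hW ψ, coeFn_mulFun hW φ, coeFn_mulFun hW (ψ - φ),
    Lp.coeFn_sub ψ φ, Lp.coeFn_sub (mulFun hW ψ) (mulFun hW φ)] with x h1 h2 h3 h4 h5
  rw [h3, h5, Pi.sub_apply, h1, h2, h4, Pi.sub_apply, mul_sub]

theorem exists_bound_of_memLp_top (hW : MemLp W ⊤ volume) :
    ∃ C : ℝ, 0 ≤ C ∧ ∀ᵐ x, |W x| ≤ C := by
  refine ⟨(eLpNorm W ⊤ volume).toReal, ENNReal.toReal_nonneg, ?_⟩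
  have := ae_le_eLpNormEssSup (f := W) (μ := volume)
  filter_upwards [this] with x hx
  rw [← eLpNorm_exponent_top] at hx
  have := ENNReal.toReal_mono hW.2.ne hx
  simpa using this

/-! ### Schrödinger operators with bounded potentials -/

theorem mem_schrodinger_domain (hW : MemLp W ⊤ volume) {ψ : L2 d} :
    ψ ∈ (schrodinger W).domain ↔ ψ ∈ (laplacianL2 d).domain := by
  change ψ ∈ (laplacianL2 d).domain ⊓ mulDomain W ↔ _
  simp [mem_mulDomain hW]

/-- An element of the domain of a Schrödinger operator, as an element of `H²`. -/
def toSobolev (hW : MemLp W ⊤ volume) (ψ : (schrodinger W).domain) : (laplacianL2 d).domain :=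
  ⟨(ψ : L2 d), (mem_schrodinger_domain hW).1 ψ.2⟩

/-- An element of `H²`, as an element of the domain of a Schrödinger operator. -/
def ofSobolev (hW : MemLp W ⊤ volume) (ψ : (laplacianL2 d).domain) : (schrodinger W).domain :=
  ⟨(ψ : L2 d), (mem_schrodinger_domain hW).2 ψ.2⟩

@[simp] theorem coe_toSobolev (hW : MemLp W ⊤ volume) (ψ : (schrodinger W).domain) :
    (toSobolev hW ψ : L2 d) = ψ := rfl

@[simp] theorem coe_ofSobolev (hW : MemLp W ⊤ volume) (ψ : (laplacianL2 d).domain) :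
    (ofSobolev hW ψ : L2 d) = ψ := rfl

@[simp] theorem toSobolev_ofSobolev (hW : MemLp W ⊤ volume) (ψ : (laplacianL2 d).domain) :
    toSobolev hW (ofSobolev hW ψ) = ψ := rfl

theorem schrodinger_apply (hW : MemLp W ⊤ volume) (ψ : (schrodinger W).domain) :
    schrodinger W ψ = -laplacianL2 d (toSobolev hW ψ) - mulFun hW ψ :=
  rfl

/-- A bounded real potential can be moved across the inner product, so both properties reduce to
those of the Laplacian. -/
theorem isMaxSymmetric_schrodinger (hW : MemLp W ⊤ volume) : IsMaxSymmetric (schrodinger W) where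
  symm x y := by
    have h := inner_laplacianL2_left (toSobolev hW x) (toSobolev hW y)
    simp only [coe_toSobolev] at h
    rw [schrodinger_apply hW, schrodinger_apply hW, inner_sub_left, inner_sub_right,
      inner_mulFun_left, inner_neg_left, inner_neg_right, h]
  maximal φ χ h := by
    have h2 : ∀ ψ : (laplacianL2 d).domain,
        ⟪laplacianL2 d ψ, φ⟫ = ⟪(ψ : L2 d), -χ - mulFun hW φ⟫ := fun ψ => by
      have := h (ofSobolev hW ψ)
      rw [schrodinger_apply hW, inner_sub_left, inner_neg_left, toSobolev_ofSobolev,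
        coe_ofSobolev] at this
      rw [inner_sub_right, inner_neg_right, ← inner_mulFun_left, ← this]
      ring
    obtain ⟨h3, h4⟩ := exists_mem_sobolevTwo_of_inner h2
    refine ⟨(mem_schrodinger_domain hW).2 h3, ?_⟩
    have h5 : schrodinger W (ofSobolev hW ⟨φ, h3⟩) = χ := by
      rw [schrodinger_apply hW, toSobolev_ofSobolev, h4, coe_ofSobolev]
      abel
    exact h5

end Laplacian

/-! ### Local compactness -/

section LocalCompactness

open FourierTransform TemperedDistribution Real

variable {d : ℕ}

/-- The square `(1 + |x|²)⁻²` is integrable exactly below dimension four. This makes evaluation of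
`bessel g` at a point a bounded functional of `g`. -/
theorem memLp_two_besselSymbol (hd : d < 4) :
    MemLp (besselSymbol d) 2 (volume : Measure (E d)) := by
  have hc : Continuous (besselSymbol d) := hasTemperateGrowth_besselSymbol.1.continuous
  rw [memLp_two_iff_integrable_sq_norm hc.aestronglyMeasurable]
  have h := integrable_rpow_neg_one_add_norm_sq (E := E d) (μ := volume) (r := 4)
    (by simpa using (by exact_mod_cast hd : (d : ℝ) < 4))
  refine h.congr (Eventually.of_forall fun x => ?_)
  simp only [besselSymbol_eq, Complex.norm_real, Real.norm_eq_abs, sq_abs]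
  rw [show (-4 / 2 : ℝ) = ((-2 : ℤ) : ℝ) by norm_num, Real.rpow_intCast, zpow_neg, inv_pow]
  rfl

/-- The plane wave `e^{-2πi⟨ξ, x⟩}` times the symbol of the Bessel potential. -/
def besselWave (x ξ : E d) : ℂ := (𝐞 (-inner ℝ ξ x) : ℂ) * besselSymbol d ξ

theorem memLp_besselWave (hd : d < 4) (x : E d) :
    MemLp (besselWave x) 2 (volume : Measure (E d)) := by
  refine (memLp_two_besselSymbol hd).of_le ?_ (Eventually.of_forall fun ξ => ?_)
  · have hc : Continuous (besselSymbol d) := hasTemperateGrowth_besselSymbol.1.continuous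
    unfold besselWave
    exact Continuous.aestronglyMeasurable (by fun_prop)
  · simp [besselWave, Circle.norm_coe]

theorem norm_toLp_besselWave (hd : d < 4) (x : E d) :
    ‖(memLp_besselWave hd x).toLp‖ = ‖(memLp_two_besselSymbol hd).toLp‖ := by
  rw [Lp.norm_toLp, Lp.norm_toLp]
  congr 1
  exact eLpNorm_congr_norm_ae (Eventually.of_forall fun ξ => by simp [besselWave, Circle.norm_coe])

theorem integrable_besselSymbol_mul (hd : d < 4) (g : L2 d) :
    Integrable (fun ξ => besselSymbol d ξ * g ξ) volume :=
  (memLp_two_besselSymbol hd).integrable_mul (Lp.memLp g)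

theorem inner_besselWave (hd : d < 4) (g : L2 d) (x : E d) :
    ⟪(memLp_besselWave hd x).toLp, g⟫ = 𝓕⁻ (fun ξ => besselSymbol d ξ * g ξ) x := by
  rw [L2.inner_def, Real.fourierInv_eq]
  apply integral_congr_ae
  filter_upwards [(memLp_besselWave hd x).coeFn_toLp] with ξ hξ
  rw [hξ, RCLike.inner_apply, besselWave, map_mul, besselSymbol_eq, Complex.conj_ofReal,
    Circle.smul_def, smul_eq_mul, ← Circle.coe_inv_eq_conj, ← AddChar.map_neg_eq_inv, neg_neg]
  ring

/-- The right side is the absolutely convergent inverse Fourier integral of an integrable function,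
hence continuous in `x`. Both sides agree after integration against smooth compactly supported
functions, by moving the inverse Fourier transform onto the test function. -/
theorem bessel_ae_eq (hd : d < 4) (g : L2 d) :
    bessel g =ᵐ[volume] fun x => ⟪(memLp_besselWave hd x).toLp, (𝓕 g : L2 d)⟫ := by
  simp only [inner_besselWave hd]
  set h : E d → ℂ := fun ξ => besselSymbol d ξ * (𝓕 g : L2 d) ξ with hh
  have hint : Integrable h volume := integrable_besselSymbol_mul hd _
  have hcont : Continuous (𝓕⁻ h) := by
    refine VectorFourier.fourierIntegral_continuous Real.continuous_fourierChar ?_ hint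
    exact continuous_inner.neg
  refine ae_eq_of_integral_contDiff_smul_eq
    ((Lp.memLp (bessel g)).locallyIntegrable (by norm_num)) hcont.locallyIntegrable
    fun u hu1 hu2 => ?_
  have hu1' : ContDiff ℝ (↑(⊤ : ℕ∞)) (Complex.ofRealCLM ∘ u) := by fun_prop
  have hu2' : HasCompactSupport (Complex.ofRealCLM ∘ u) := hu2.comp_left rfl
  let v : 𝓢(E d, ℂ) := hu2'.toSchwartzMap hu1'
  have hv : ∀ x, v x = (u x : ℂ) := fun x => rfl
  have e1 : ∫ x, u x • bessel g x = (bessel g : 𝓢'(E d, ℂ)) v := by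
    rw [Lp.toTemperedDistribution_apply]
    exact integral_congr_ae (Eventually.of_forall fun x => by simp [hv])
  have e2 : (bessel g : 𝓢'(E d, ℂ)) v = ∫ ξ, (𝓕⁻ v) ξ * h ξ := by
    have : (bessel g : 𝓢'(E d, ℂ)) = 𝓕⁻ ((𝓕 (bessel g) : L2 d) : 𝓢'(E d, ℂ)) := by
      rw [Lp.fourierInv_toTemperedDistribution_eq, fourierInv_fourier_eq]
    rw [this, TemperedDistribution.fourierInv_apply, Lp.toTemperedDistribution_apply]
    apply integral_congr_ae
    filter_upwards [coeFn_fourier_bessel g] with ξ hξ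
    rw [hξ, smul_eq_mul]
  have e3 : ∫ ξ, (𝓕⁻ (v : E d → ℂ)) ξ • h ξ = ∫ x, v x • (𝓕⁻ h) x := by
    have := VectorFourier.integral_fourierIntegral_smul_eq_flip (L := -innerₗ (E d))
      (μ := volume) (ν := volume) Real.continuous_fourierChar
      (continuous_inner (𝕜 := ℝ) (E := E d)).neg v.integrable hint
    have hf : (-innerₗ (E d)).flip = -innerₗ (E d) := by
      ext x y; simp [real_inner_comm]
    rw [hf] at this
    exact this
  rw [e1, e2, SchwartzMap.fourierInv_coe]
  simp only [smul_eq_mul] at e3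
  rw [e3]
  exact integral_congr_ae (Eventually.of_forall fun x => by simp [hv])

/-- Rellich's theorem: the Bessel potential maps weakly null sequences to sequences which vanish
locally in the limit. -/
theorem tendsto_setIntegral_bessel (hd : d < 4) {g : ℕ → L2 d} {C : ℝ} (hC : ∀ n, ‖g n‖ ≤ C)
    (hg : ∀ h : L2 d, Tendsto (fun n => ⟪h, g n⟫) atTop (𝓝 0)) {B : Set (E d)}
    (hB : volume B ≠ ⊤) :
    Tendsto (fun n => ∫ x in B, ‖bessel (g n) x‖ ^ 2) atTop (𝓝 0) := by
  have e : ∀ n, ∫ x in B, ‖bessel (g n) x‖ ^ 2 =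
      ∫ x in B, ‖⟪(memLp_besselWave hd x).toLp, (𝓕 (g n) : L2 d)⟫‖ ^ 2 := fun n => by
    apply integral_congr_ae
    filter_upwards [ae_restrict_of_ae (bessel_ae_eq hd (g n))] with x hx
    rw [hx]
  have h0 : (0 : ℝ) = ∫ x in B, (0 : ℝ) := by simp
  simp only [e]
  rw [h0]
  -- For each fixed `x` the value is an inner product of `g n` with a fixed vector, so weak
  -- convergence gives pointwise convergence; the norm of that vector does not depend on `x`, which
  -- provides a constant majorant.
  refine tendsto_integral_of_dominated_convergence
    (fun _ => (‖(memLp_two_besselSymbol hd).toLp‖ * C) ^ 2) (fun n => ?_)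
    (integrableOn_const hB) (fun n => Eventually.of_forall fun x => ?_)
    (Eventually.of_forall fun x => ?_)
  · have := ((Lp.aestronglyMeasurable (bessel (g n))).congr (bessel_ae_eq hd (g n))).norm.pow 2
    exact this.restrict
  · rw [Real.norm_eq_abs, abs_of_nonneg (by positivity)]
    gcongr
    refine (norm_inner_le_norm _ _).trans ?_
    rw [norm_toLp_besselWave hd]
    gcongr
    simpa using hC n
  · have h1 : ∀ n, ⟪(memLp_besselWave hd x).toLp, (𝓕 (g n) : L2 d)⟫ =
        ⟪(𝓕⁻ ((memLp_besselWave hd x).toLp : L2 d) : L2 d), g n⟫ := fun n => by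
      conv_rhs => rw [← Lp.inner_fourier_eq, fourier_fourierInv_eq]
    simp only [h1]
    have := (hg (𝓕⁻ ((memLp_besselWave hd x).toLp : L2 d) : L2 d)).norm.pow 2
    simpa using this

/-- Sequential Banach–Alaoglu in the dual of a separable space, transported by the Riesz
isomorphism; the conjugation at the end exchanges the arguments of the inner product. -/
theorem exists_weak_limit {H : Type*} [NormedAddCommGroup H] [InnerProductSpace ℂ H]
    [CompleteSpace H] [TopologicalSpace.SeparableSpace H] {ψ : ℕ → H} {C : ℝ}
    (hC : ∀ n, ‖ψ n‖ ≤ C) :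
    ∃ (φ : H) (k : ℕ → ℕ), StrictMono k ∧
      ∀ h : H, Tendsto (fun n => ⟪h, ψ (k n)⟫) atTop (𝓝 ⟪h, φ⟫) := by
  have hseq := WeakDual.isSeqCompact_closedBall ℂ H (0 : StrongDual ℂ H) C
  let x : ℕ → WeakDual ℂ H := fun n => StrongDual.toWeakDual (InnerProductSpace.toDual ℂ H (ψ n))
  obtain ⟨a, -, k, hk, hka⟩ := hseq (x := x) fun n => by
    change InnerProductSpace.toDual ℂ H (ψ n) ∈ Metric.closedBall (0 : StrongDual ℂ H) C
    simpa using hC n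
  refine ⟨(InnerProductSpace.toDual ℂ H).symm (WeakDual.toStrongDual a), k, hk, fun h => ?_⟩
  rw [tendsto_iff_forall_eval_tendsto_topDualPairing] at hka
  have h1 := hka h
  have h2 : Tendsto (fun n => ⟪ψ (k n), h⟫) atTop (𝓝 (a h)) := h1
  have h3 : ⟪(InnerProductSpace.toDual ℂ H).symm (WeakDual.toStrongDual a), h⟫ = a h := by
    rw [InnerProductSpace.toDual_symm_apply]; rfl
  rw [← h3] at h2
  have h4 := (Complex.continuous_conj.tendsto _).comp h2
  simp only [Function.comp_def, inner_conj_symm] at h4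
  exact h4

theorem inner_bessel_right (a b : L2 d) : ⟪a, bessel b⟫ = ⟪bessel a, b⟫ :=
  (inner_bessel_left a b).symm

theorem bessel_sub (a b : L2 d) : bessel (a - b) = bessel a - bessel b := by
  refine ext_inner_left ℂ fun v => ?_
  rw [inner_sub_right, inner_bessel_right, inner_bessel_right, inner_bessel_right, inner_sub_right]

/-- If the quadratic form is bounded below by `E`, up to errors localized in balls, then the
spectrum below `E` is discrete. -/
theorem mem_discSpec_of_form_ge (hd : d < 4) {W : E d → ℝ} (hW : MemLp W ⊤ volume) {e : ℝ}
    (hP : ∀ δ > 0, ∃ ρ C : ℝ, ∀ ψ : (schrodinger W).domain, (e - δ) * ‖(ψ : L2 d)‖ ^ 2 -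
      C * ∫ x in Metric.ball 0 ρ, ‖(ψ : L2 d) x‖ ^ 2 ≤ form (schrodinger W) ψ)
    {l₀ : ℝ} (hl₀ : l₀ < e) (hspec : (l₀ : ℂ) ∈ spec (schrodinger W)) :
    (l₀ : ℂ) ∈ discSpec (schrodinger W) := by
  have hT := isMaxSymmetric_schrodinger hW
  refine hT.mem_discSpec_of_compact (E := e) ?_ hl₀ hspec
  clear! l₀
  intro l l₀ ψ hl₀ hl hψ hr
  set c : ℂ := (((2 * π) ^ 2 : ℝ) : ℂ)⁻¹ with hc
  let g : ℕ → L2 d := fun n => (ψ n : L2 d) - c • laplacianL2 d (toSobolev hW (ψ n))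
  have hψg : ∀ n, (ψ n : L2 d) = bessel (g n) := fun n => eq_bessel (toSobolev hW (ψ n))
  obtain ⟨K, hK0, hK⟩ := exists_bound_of_memLp_top hW
  obtain ⟨L, hL⟩ := (hl.norm.bddAbove_range)
  obtain ⟨R, hR⟩ := hr.bddAbove_range
  -- The `H²` norms are bounded because `Δψ` equals `-(T - l)ψ - lψ - Wψ`, and each term is bounded.
  have hgb : ∀ n, ‖g n‖ ≤ 1 + ‖c‖ * (R + L + K) := fun n => by
    refine (norm_sub_le _ _).trans (add_le_add (hψ n) ?_)
    rw [norm_smul]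
    gcongr
    have h1 : laplacianL2 d (toSobolev hW (ψ n)) =
        -(schrodinger W (ψ n) - (l n : ℂ) • (ψ n : L2 d)) - (l n : ℂ) • (ψ n : L2 d)
          - mulFun hW (ψ n) := by
      rw [schrodinger_apply hW]; abel
    rw [h1]
    refine (norm_sub_le _ _).trans (add_le_add ((norm_sub_le _ _).trans (add_le_add ?_ ?_)) ?_)
    · rw [norm_neg]; exact hR ⟨n, rfl⟩
    · rw [norm_smul]
      have : ‖(l n : ℂ)‖ ≤ L := by
        rw [Complex.norm_real]; exact hL ⟨n, rfl⟩
      nlinarith [hψ n, norm_nonneg (ψ n : L2 d), norm_nonneg (l n : ℂ)]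
    · refine (norm_mulFun_le hW hK _).trans ?_
      nlinarith [hψ n]
  have : Fact ((2 : ENNReal) ≠ ⊤) := ⟨by norm_num⟩
  obtain ⟨γ, k, hk, hγ⟩ := exists_weak_limit hgb
  have hψw : ∀ h : L2 d, Tendsto (fun n => ⟪h, (ψ (k n) : L2 d)⟫) atTop (𝓝 ⟪h, bessel γ⟫) :=
    fun h => by
      simp only [hψg, inner_bessel_right]
      exact hγ _
  have hr0 : Tendsto (fun n => schrodinger W (ψ (k n)) - (l₀ : ℂ) • (ψ (k n) : L2 d)) atTop
      (𝓝 0) := by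
    have h1 := (tendsto_zero_iff_norm_tendsto_zero.2 hr).comp hk.tendsto_atTop
    have h2 : Tendsto (fun n => ((l (k n) : ℂ) - l₀) • (ψ (k n) : L2 d)) atTop (𝓝 0) := by
      rw [tendsto_zero_iff_norm_tendsto_zero]
      refine squeeze_zero (fun _ => norm_nonneg _) (g := fun n => |l (k n) - l₀|) (fun n => ?_) ?_
      · rw [norm_smul, ← Complex.ofReal_sub, Complex.norm_real, Real.norm_eq_abs]
        nlinarith [hψ (k n), abs_nonneg (l (k n) - l₀)]
      · have := ((hl.comp hk.tendsto_atTop).sub_const l₀).abs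
        simpa using this
    have h3 := h1.add h2
    simp only [add_zero] at h3
    refine h3.congr fun n => ?_
    simp only [Function.comp_apply]
    module
  obtain ⟨hmem, hφ⟩ : ∃ h : bessel γ ∈ (schrodinger W).domain,
      schrodinger W ⟨bessel γ, h⟩ = (l₀ : ℂ) • bessel γ := by
    -- Weak convergence suffices to identify the limit as a solution of `Tφ = l₀φ`: the operator is
    -- put on the fixed vector `ξ`.
    refine hT.maximal _ _ fun ξ => ?_
    have a := hψw (schrodinger W ξ - (l₀ : ℂ) • (ξ : L2 d))
    have b : Tendsto (fun n => ⟪(ξ : L2 d), schrodinger W (ψ (k n)) - (l₀ : ℂ) • (ψ (k n) : L2 d)⟫)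
        atTop (𝓝 ⟪(ξ : L2 d), 0⟫) := Tendsto.inner tendsto_const_nhds hr0
    have h := tendsto_nhds_unique a (b.congr fun n => by
      rw [inner_sub_left, inner_sub_right, hT.symm, inner_smul_left, inner_smul_right,
        Complex.conj_ofReal])
    rw [inner_zero_right, inner_sub_left, sub_eq_zero, inner_smul_left, Complex.conj_ofReal] at h
    rw [h, inner_smul_right]
  refine ⟨bessel γ, k, hk, ?_⟩
  let u : ℕ → (schrodinger W).domain := fun n => ψ (k n) - ⟨bessel γ, hmem⟩
  have hu : ∀ n, (u n : L2 d) = bessel (g (k n) - γ) := fun n => by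
    rw [bessel_sub, ← hψg]; rfl
  have hTu : ∀ n, schrodinger W (u n) - (l₀ : ℂ) • (u n : L2 d) =
      schrodinger W (ψ (k n)) - (l₀ : ℂ) • (ψ (k n) : L2 d) := fun n => by
    simp only [u, LinearPMap.map_sub, hφ, Submodule.coe_sub, smul_sub]
    abel
  -- Spending half of the gap leaves `(e - l₀)/2 · ‖u‖² ≤ ‖(T - l₀)u‖ ‖u‖ + C ∫_B |u|²`. The first
  -- term on the right vanishes in the limit by approximation and the second by Rellich, so `u`
  -- tends to zero in norm.
  obtain ⟨ρ, C, hPC⟩ := hP ((e - l₀) / 2) (by linarith)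
  have hloc : Tendsto (fun n => ∫ x in Metric.ball 0 ρ, ‖(u n : L2 d) x‖ ^ 2) atTop (𝓝 0) := by
    simp only [hu]
    refine tendsto_setIntegral_bessel hd (C := 1 + ‖c‖ * (R + L + K) + ‖γ‖) (fun n => ?_)
      (fun h => ?_) measure_ball_lt_top.ne
    · exact (norm_sub_le _ _).trans (by gcongr; exact hgb _)
    · simp only [inner_sub_right]
      have := (hγ h).sub_const ⟪h, γ⟫
      rwa [sub_self] at this
  have hub : ∀ n, ‖(u n : L2 d)‖ ≤ 1 + ‖bessel γ‖ := fun n =>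
    (norm_sub_le _ _).trans (by gcongr; exact hψ _)
  have hsq : Tendsto (fun n => ‖(u n : L2 d)‖ ^ 2) atTop (𝓝 0) := by
    have hlim : Tendsto (fun n => 2 / (e - l₀) * (‖schrodinger W (u n) - (l₀ : ℂ) • (u n : L2 d)‖ *
        (1 + ‖bessel γ‖) + C * ∫ x in Metric.ball 0 ρ, ‖(u n : L2 d) x‖ ^ 2)) atTop (𝓝 0) := by
      have h1 : Tendsto (fun n => ‖schrodinger W (u n) - (l₀ : ℂ) • (u n : L2 d)‖) atTop (𝓝 0) := by
        simp only [hTu]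
        exact tendsto_zero_iff_norm_tendsto_zero.1 hr0
      have := ((h1.mul_const (1 + ‖bessel γ‖)).add (hloc.const_mul C)).const_mul (2 / (e - l₀))
      simpa using this
    refine squeeze_zero (fun _ => by positivity) (fun n => ?_) hlim
    have h1 := hPC (u n)
    have h2 := form_sub_le_norm_mul l₀ (u n)
    have h3 : ‖schrodinger W (u n) - (l₀ : ℂ) • (u n : L2 d)‖ * ‖(u n : L2 d)‖ ≤
        ‖schrodinger W (u n) - (l₀ : ℂ) • (u n : L2 d)‖ * (1 + ‖bessel γ‖) := by
      gcongr; exact hub n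
    rw [div_mul_eq_mul_div, le_div_iff₀ (by linarith)]
    nlinarith
  have h4 : Tendsto (fun n => ‖(u n : L2 d)‖) atTop (𝓝 0) := by
    have := hsq.sqrt
    simpa [Real.sqrt_sq] using this
  have h5 := (tendsto_zero_iff_norm_tendsto_zero.2 h4).add_const (bessel γ)
  rw [zero_add] at h5
  refine h5.congr fun n => ?_
  simp [u]

end LocalCompactness

/-! ### Test functions form a core of the Laplacian -/

section Core

open FourierTransform TemperedDistribution Real

variable {d : ℕ} {F : Type*} [NormedAddCommGroup F] [NormedSpace ℝ F]

/-- Smooth functions of compact support. -/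
structure IsTest (f : E d → F) : Prop where
  smooth : ContDiff ℝ ∞ f
  compact : HasCompactSupport f

/-- A test function, as a Schwartz function. -/
def IsTest.toSchwartz {f : E d → F} (hf : IsTest f) : 𝓢(E d, F) := hf.compact.toSchwartzMap hf.smooth

@[simp] theorem IsTest.toSchwartz_apply {f : E d → F} (hf : IsTest f) (x : E d) :
    hf.toSchwartz x = f x := rfl

theorem IsTest.coe_toSchwartz {f : E d → F} (hf : IsTest f) : ⇑hf.toSchwartz = f := rfl

theorem norm_bessel_le (g : L2 d) : ‖bessel g‖ ≤ ‖g‖ := by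
  rw [← Lp.norm_fourier_eq (bessel g), ← Lp.norm_fourier_eq g]
  refine Lp.norm_le_norm_of_ae_le ?_
  filter_upwards [coeFn_fourier_bessel g] with x hx
  rw [hx, norm_mul]
  exact mul_le_of_le_one_left (norm_nonneg _) (norm_besselSymbol_le_one x)

theorem bessel_toLp (f : 𝓢(E d, ℂ)) :
    bessel (f.toLp 2 volume) = (SchwartzMap.fourierMultiplierCLM ℂ (besselSymbol d) f).toLp 2 := by
  apply toTemperedDistribution_injective
  rw [bessel_toTemperedDistribution, Lp.toTemperedDistribution_toLp_eq,
    Lp.toTemperedDistribution_toLp_eq,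
    ← fourierMultiplierCLM_toTemperedDistributionCLM_eq hasTemperateGrowth_besselSymbol]
  rfl

/-- With `ψ = bessel g`, approximate `g` in `L²` by a Schwartz function and apply `bessel`, which
preserves Schwartz functions. Both `bessel` and `Δ ∘ bessel = (2π)² (bessel - 1)` are bounded on
`L²`. -/
theorem exists_schwartz_near (ψ : (laplacianL2 d).domain) {ε : ℝ} (hε : 0 < ε) :
    ∃ f : 𝓢(E d, ℂ), ‖(ψ : L2 d) - f.toLp 2 volume‖ < ε ∧
      ‖laplacianL2 d ψ - (Δ f : 𝓢(E d, ℂ)).toLp 2 volume‖ < ε := by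
  set c : ℂ := (((2 * π) ^ 2 : ℝ) : ℂ) with hc
  have hc0 : c ≠ 0 := by rw [hc]; norm_cast; positivity
  set g : L2 d := (ψ : L2 d) - c⁻¹ • laplacianL2 d ψ with hg
  have hd := SchwartzMap.denseRange_toLpCLM (E := E d) (F := ℂ) (p := 2) (μ := volume)
    ENNReal.ofNat_ne_top
  -- The Laplacian costs the factor `2‖c‖`, from `c • (bessel - 1)` with `bessel` a contraction.
  obtain ⟨h, hh⟩ := hd.exists_dist_lt g (ε := ε / (2 * ‖c‖ + 1)) (by positivity)
  rw [SchwartzMap.toLpCLM_apply, dist_eq_norm] at hh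
  refine ⟨SchwartzMap.fourierMultiplierCLM ℂ (besselSymbol d) h, ?_⟩
  have e0 : (ψ : L2 d) = bessel g := eq_bessel ψ
  have e1 : (ψ : L2 d) - (SchwartzMap.fourierMultiplierCLM ℂ (besselSymbol d) h).toLp 2 volume =
      bessel (g - h.toLp 2 volume) := by
    rw [bessel_sub, ← e0, bessel_toLp]
  have n1 : ‖bessel (g - h.toLp 2 volume)‖ < ε / (2 * ‖c‖ + 1) :=
    (norm_bessel_le _).trans_lt hh
  have hcn : 0 < ‖c‖ := norm_pos_iff.2 hc0
  have hle : ε / (2 * ‖c‖ + 1) ≤ ε := div_le_self hε.le (by linarith)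
  refine ⟨by rw [e1]; exact n1.trans_le hle, ?_⟩
  have e2 : laplacianL2 d ψ = c • (bessel g - g) := by
    rw [← e0, hg, sub_sub_cancel, smul_inv_smul₀ hc0]
  have e3 : ((Δ (SchwartzMap.fourierMultiplierCLM ℂ (besselSymbol d) h) : 𝓢(E d, ℂ)).toLp 2 volume :
      L2 d) = c • (bessel (h.toLp 2 volume) - h.toLp 2 volume) := by
    obtain ⟨h1, h2⟩ := exists_laplacian_toLp (SchwartzMap.fourierMultiplierCLM ℂ (besselSymbol d) h)
    obtain ⟨h3, h4⟩ := exists_laplacian_bessel (h.toLp 2 volume)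
    rw [← h2, ← h4]
    congr 1
    exact Subtype.ext (bessel_toLp h).symm
  have e4 : laplacianL2 d ψ -
      (Δ (SchwartzMap.fourierMultiplierCLM ℂ (besselSymbol d) h) : 𝓢(E d, ℂ)).toLp 2 volume =
      c • (bessel (g - h.toLp 2 volume) - (g - h.toLp 2 volume)) := by
    rw [e2, e3, bessel_sub g, ← smul_sub, sub_sub_sub_comm]
  rw [e4, norm_smul]
  have n2 : ‖bessel (g - h.toLp 2 volume) - (g - h.toLp 2 volume)‖ <
      2 * (ε / (2 * ‖c‖ + 1)) := by
    refine (norm_sub_le _ _).trans_lt ?_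
    linarith
  calc ‖c‖ * ‖bessel (g - h.toLp 2 volume) - (g - h.toLp 2 volume)‖
      < ‖c‖ * (2 * (ε / (2 * ‖c‖ + 1))) := by gcongr
    _ = (2 * ‖c‖) / (2 * ‖c‖ + 1) * ε := by ring
    _ ≤ 1 * ε := by
        gcongr
        rw [div_le_one (by positivity)]; linarith
    _ = ε := one_mul _

theorem norm_sq_eq_integral (ψ : L2 d) : ‖ψ‖ ^ 2 = ∫ x, ‖ψ x‖ ^ 2 := by
  have h : ((‖ψ‖ ^ 2 : ℝ) : ℂ) = ((∫ x, ‖ψ x‖ ^ 2 : ℝ) : ℂ) := by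
    rw [← integral_complex_ofReal]
    push_cast
    have := inner_self_eq_norm_sq_to_K (𝕜 := ℂ) ψ
    rw [L2.inner_def] at this
    simp only [inner_self_eq_norm_sq_to_K] at this
    exact this.symm
  exact_mod_cast h

theorem norm_toLp_sub_sq (a b : 𝓢(E d, ℂ)) :
    ‖a.toLp 2 volume - b.toLp 2 volume‖ ^ 2 = ∫ x, ‖a x - b x‖ ^ 2 := by
  rw [norm_sq_eq_integral]
  apply integral_congr_ae
  filter_upwards [Lp.coeFn_sub (a.toLp 2 volume) (b.toLp 2 volume), a.coeFn_toLp 2 volume,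
    b.coeFn_toLp 2 volume] with x h1 h2 h3
  rw [h1, Pi.sub_apply, h2, h3]

theorem tendsto_toLp_of_dominated {a : ℕ → 𝓢(E d, ℂ)} {b : 𝓢(E d, ℂ)} {G : E d → ℝ}
    (hG : Integrable (fun x => G x ^ 2) volume) (ha : ∀ n x, ‖a n x - b x‖ ≤ G x)
    (hab : ∀ x, ∀ᶠ n in atTop, a n x = b x) :
    Tendsto (fun n => ‖b.toLp 2 volume - (a n).toLp 2 volume‖) atTop (𝓝 0) := by
  have h : Tendsto (fun n => ∫ x, ‖a n x - b x‖ ^ 2) atTop (𝓝 (∫ _ : E d, (0 : ℝ))) := by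
    refine tendsto_integral_of_dominated_convergence (fun x => G x ^ 2) (fun n => ?_) hG
      (fun n => Eventually.of_forall fun x => ?_) (Eventually.of_forall fun x => ?_)
    · exact (((a n).continuous.sub b.continuous).norm.pow 2).aestronglyMeasurable
    · rw [Real.norm_eq_abs, abs_of_nonneg (by positivity)]
      gcongr
      exact ha n x
    · refine tendsto_const_nhds.congr' ?_
      filter_upwards [hab x] with n hn
      simp [hn]
  rw [integral_zero] at h
  have h2 := h.sqrt
  rw [Real.sqrt_zero] at h2
  refine h2.congr fun n => ?_
  rw [← norm_toLp_sub_sq, Real.sqrt_sq (norm_nonneg _), norm_sub_rev]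

theorem integrable_norm_iteratedFDeriv_sq (f : 𝓢(E d, ℂ)) (k : ℕ) :
    Integrable (fun x => ‖iteratedFDeriv ℝ k f x‖ ^ 2) volume := by
  have h := f.integrable_pow_mul_iteratedFDeriv volume 0 k
  simp only [pow_zero, one_mul] at h
  have hc : Continuous (fun x => ‖iteratedFDeriv ℝ k f x‖) :=
    ((f.smooth k).continuous_iteratedFDeriv le_rfl).norm
  refine (h.mul_const (SchwartzMap.seminorm ℝ 0 k f)).mono (hc.pow 2).aestronglyMeasurable
    (Eventually.of_forall fun x => ?_)
  have h2 := f.norm_iteratedFDeriv_le_seminorm ℝ k x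
  rw [Real.norm_eq_abs, Real.norm_eq_abs, abs_of_nonneg (by positivity), abs_of_nonneg (by positivity),
    sq]
  gcongr

theorem norm_laplacian_le (f : E d → ℂ) (x : E d) :
    ‖Δ f x‖ ≤ d * ‖iteratedFDeriv ℝ 2 f x‖ := by
  rw [InnerProductSpace.laplacian_eq_iteratedFDeriv_orthonormalBasis f
    (EuclideanSpace.basisFun (Fin d) ℝ)]
  refine (norm_sum_le _ _).trans ?_
  calc _ ≤ ∑ _i : Fin d, ‖iteratedFDeriv ℝ 2 f x‖ := by
        refine Finset.sum_le_sum fun i _ => ?_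
        refine ((iteratedFDeriv ℝ 2 f x).le_opNorm _).trans ?_
        simp [Fin.prod_univ_two]
    _ = _ := by simp

/-- A smooth cutoff function which is `1` on the ball of radius `R` and `0` off the ball of radius
`2R`. -/
def bump (d : ℕ) (R : ℝ) (x : E d) : ℝ :=
  (⟨1, 2, one_pos, one_lt_two⟩ : ContDiffBump (0 : E d)) (R⁻¹ • x)

theorem bump_eq_one {R : ℝ} (hR : 0 < R) {x : E d} (hx : ‖x‖ ≤ R) : bump d R x = 1 := by
  refine ContDiffBump.one_of_mem_closedBall _ ?_
  rw [mem_closedBall_zero_iff, norm_smul, norm_inv, Real.norm_eq_abs, abs_of_pos hR,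
    inv_mul_le_iff₀ hR]
  simpa using hx

theorem bump_eq_zero {R : ℝ} (hR : 0 < R) {x : E d} (hx : 2 * R ≤ ‖x‖) : bump d R x = 0 := by
  refine ContDiffBump.zero_of_le_dist _ ?_
  rw [dist_zero_right, norm_smul, norm_inv, Real.norm_eq_abs, abs_of_pos hR, le_inv_mul_iff₀ hR]
  linarith

theorem bump_neg (R : ℝ) (x : E d) : bump d R (-x) = bump d R x := by
  rw [bump, bump, smul_neg, ContDiffBump.neg]

theorem bump_nonneg (R : ℝ) (x : E d) : 0 ≤ bump d R x := ContDiffBump.nonneg _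

theorem bump_le_one (R : ℝ) (x : E d) : bump d R x ≤ 1 := ContDiffBump.le_one _

theorem isTest_bump {R : ℝ} (hR : 0 < R) : IsTest (bump d R) where
  smooth := (ContDiffBump.contDiff _).comp (contDiff_id.const_smul _)
  compact := by
    refine HasCompactSupport.intro (isCompact_closedBall (0 : E d) (2 * R)) fun x hx => ?_
    rw [mem_closedBall_zero_iff, not_le] at hx
    exact bump_eq_zero hR hx.le

/-- Scaling multiplies the `k`-th derivative by `R⁻ᵏ`, which is at most one for `R ≥ 1`. -/
theorem exists_norm_iteratedFDeriv_bump_le (k : ℕ) :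
    ∃ C : ℝ, 0 ≤ C ∧ ∀ R : ℝ, 1 ≤ R → ∀ x, ‖iteratedFDeriv ℝ k (bump d R) x‖ ≤ C := by
  let χ : ContDiffBump (0 : E d) := ⟨1, 2, one_pos, one_lt_two⟩
  have hχ : IsTest (⇑χ : E d → ℝ) := ⟨χ.contDiff, χ.hasCompactSupport⟩
  refine ⟨SchwartzMap.seminorm ℝ 0 k hχ.toSchwartz, apply_nonneg _ _, fun R hR x => ?_⟩
  have h : bump d R = fun x => χ (R⁻¹ • x) := rfl
  rw [h, iteratedFDeriv_comp_const_smul _ (χ.contDiff (n := k))]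
  simp only [norm_smul, norm_pow, norm_inv, Real.norm_eq_abs]
  refine (mul_le_of_le_one_left (norm_nonneg _) ?_).trans
    (hχ.toSchwartz.norm_iteratedFDeriv_le_seminorm ℝ k _)
  refine pow_le_one₀ (by positivity) (inv_le_one_of_one_le₀ ?_)
  exact hR.trans (le_abs_self R)

theorem IsTest.smul_left {χ : E d → ℝ} (hχ : IsTest χ) {f : E d → F} (hf : ContDiff ℝ ∞ f) :
    IsTest (fun x => χ x • f x) :=
  ⟨hχ.smooth.smul hf, hχ.compact.smul_right⟩

/-- Cut off a nearby Schwartz function at growing radii. At each point the product eventually equals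
the function together with its derivatives, and the Leibniz rule gives a square integrable majorant
independent of the radius. -/
theorem exists_test_near (ψ : (laplacianL2 d).domain) {ε : ℝ} (hε : 0 < ε) :
    ∃ (f : E d → ℂ) (hf : IsTest f), ‖(ψ : L2 d) - hf.toSchwartz.toLp 2 volume‖ < ε ∧
      ‖laplacianL2 d ψ - (Δ hf.toSchwartz : 𝓢(E d, ℂ)).toLp 2 volume‖ < ε := by
  obtain ⟨f, h1, h2⟩ := exists_schwartz_near ψ (half_pos hε)
  have hR : ∀ n : ℕ, (0 : ℝ) < n + 1 := fun n => by positivity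
  have ht : ∀ n : ℕ, IsTest (fun x => bump d (n + 1) x • f x) := fun n =>
    (isTest_bump (hR n)).smul_left (f.smooth ⊤)
  have hev : ∀ x : E d, ∀ᶠ n : ℕ in atTop, ‖x‖ < (n : ℝ) + 1 := fun x => by
    filter_upwards [(tendsto_natCast_atTop_atTop (R := ℝ)).eventually_gt_atTop ‖x‖] with n hn
    linarith
  have hloc : ∀ (n : ℕ) (x : E d), ‖x‖ < (n : ℝ) + 1 →
      (fun x => bump d (n + 1) x • f x) =ᶠ[𝓝 x] f := fun n x hx => by
    filter_upwards [Metric.isOpen_ball.mem_nhds (mem_ball_zero_iff.2 hx)] with y hy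
    rw [bump_eq_one (hR n) (mem_ball_zero_iff.1 hy).le, one_smul]
  have t1 : Tendsto (fun n => ‖f.toLp 2 volume - (ht n).toSchwartz.toLp 2 volume‖) atTop (𝓝 0) := by
    refine tendsto_toLp_of_dominated (G := fun x => 2 * ‖iteratedFDeriv ℝ 0 f x‖) ?_ ?_ ?_
    · simp only [mul_pow]
      exact (integrable_norm_iteratedFDeriv_sq f 0).const_mul _
    · intro n x
      rw [norm_iteratedFDeriv_zero, IsTest.toSchwartz_apply, two_mul]
      refine (norm_sub_le _ _).trans (add_le_add ?_ le_rfl)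
      rw [norm_smul, Real.norm_eq_abs, abs_of_nonneg (bump_nonneg _ _)]
      exact mul_le_of_le_one_left (norm_nonneg _) (bump_le_one _ _)
    · intro x
      filter_upwards [hev x] with n hn
      exact (hloc n x hn).eq_of_nhds
  have t2 : Tendsto (fun n => ‖(Δ f : 𝓢(E d, ℂ)).toLp 2 volume -
      (Δ (ht n).toSchwartz : 𝓢(E d, ℂ)).toLp 2 volume‖) atTop (𝓝 0) := by
    choose C hC0 hC using fun k => exists_norm_iteratedFDeriv_bump_le (d := d) k
    -- The summand `C i * choose 2 i` bounds the Leibniz terms of the truncated function; the extra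
    -- one pays for `Δ f` itself.
    refine tendsto_toLp_of_dominated (G := fun x => ∑ i ∈ Finset.range 3,
      d * (C i * Nat.choose 2 i + 1) * ‖iteratedFDeriv ℝ (2 - i) f x‖) ?_ ?_ ?_
    · have hm : MemLp (fun x => ∑ i ∈ Finset.range 3,
          d * (C i * Nat.choose 2 i + 1) * ‖iteratedFDeriv ℝ (2 - i) f x‖) 2
          (volume : Measure (E d)) := by
        refine memLp_finsetSum _ fun i _ => MemLp.const_mul ?_ _
        have hc : Continuous (fun x => ‖iteratedFDeriv ℝ (2 - i) f x‖) :=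
          ((f.smooth _).continuous_iteratedFDeriv le_rfl).norm
        rw [memLp_two_iff_integrable_sq hc.aestronglyMeasurable]
        exact integrable_norm_iteratedFDeriv_sq f (2 - i)
      exact hm.integrable_sq
    · intro n x
      rw [SchwartzMap.laplacian_apply, SchwartzMap.laplacian_apply, IsTest.coe_toSchwartz]
      refine (norm_sub_le _ _).trans ?_
      have b1 := norm_laplacian_le (fun x => bump d (n + 1) x • f x) x
      have b2 := norm_laplacian_le f x
      have b3 := norm_iteratedFDeriv_smul_le (isTest_bump (d := d) (hR n)).smooth (f.smooth ⊤) x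
        (n := 2) (WithTop.coe_le_coe.2 le_top : ((2 : ℕ∞) : ℕ∞ω) ≤ ∞)
      have b4 : ∑ i ∈ Finset.range (2 + 1), (Nat.choose 2 i : ℝ) *
          ‖iteratedFDeriv ℝ i (bump d (n + 1)) x‖ * ‖iteratedFDeriv ℝ (2 - i) f x‖ ≤
          ∑ i ∈ Finset.range 3, C i * Nat.choose 2 i * ‖iteratedFDeriv ℝ (2 - i) f x‖ := by
        refine Finset.sum_le_sum fun i _ => ?_
        rw [mul_comm (C i)]
        gcongr
        exact hC i _ (by linarith [Nat.cast_nonneg (α := ℝ) n]) x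
      have b5 : ‖iteratedFDeriv ℝ 2 f x‖ ≤
          ∑ i ∈ Finset.range 3, ‖iteratedFDeriv ℝ (2 - i) f x‖ :=
        Finset.single_le_sum (f := fun i => ‖iteratedFDeriv ℝ (2 - i) f x‖)
          (fun i _ => norm_nonneg _) (Finset.mem_range.2 (by norm_num : 0 < 3))
      calc _ ≤ d * (∑ i ∈ Finset.range 3, C i * Nat.choose 2 i * ‖iteratedFDeriv ℝ (2 - i) f x‖) +
            d * ∑ i ∈ Finset.range 3, ‖iteratedFDeriv ℝ (2 - i) f x‖ := by
            refine add_le_add (b1.trans ?_) (b2.trans ?_)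
            · exact mul_le_mul_of_nonneg_left (b3.trans b4) (Nat.cast_nonneg d)
            · exact mul_le_mul_of_nonneg_left b5 (Nat.cast_nonneg d)
        _ = _ := by
            rw [Finset.mul_sum, Finset.mul_sum, ← Finset.sum_add_distrib]
            exact Finset.sum_congr rfl fun i _ => by ring
    · intro x
      filter_upwards [hev x] with n hn
      rw [SchwartzMap.laplacian_apply, SchwartzMap.laplacian_apply, IsTest.coe_toSchwartz]
      exact (InnerProductSpace.laplacian_congr_nhds (hloc n x hn)).eq_of_nhds
  obtain ⟨n, n1, n2⟩ := ((t1.eventually_lt_const (half_pos hε)).and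
    (t2.eventually_lt_const (half_pos hε))).exists
  refine ⟨_, ht n, ?_, ?_⟩
  · exact (norm_sub_le_norm_sub_add_norm_sub _ _ _).trans_lt (by linarith)
  · exact (norm_sub_le_norm_sub_add_norm_sub _ _ _).trans_lt (by linarith)

end Core

/-! ### Quadratic forms on real test functions -/

section Energy

open LineDeriv

variable {d : ℕ}

theorem norm_sq_eq_sum_apply (L : E d →L[ℝ] ℝ) :
    ‖L‖ ^ 2 = ∑ i, L (EuclideanSpace.basisFun (Fin d) ℝ i) ^ 2 := by
  obtain ⟨v, rfl⟩ := (InnerProductSpace.toDual ℝ (E d)).surjective L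
  rw [LinearIsometryEquiv.norm_map,
    ← (EuclideanSpace.basisFun (Fin d) ℝ).sum_sq_norm_inner_left v]
  simp

theorem IsTest.integrable {F : Type*} [NormedAddCommGroup F] [NormedSpace ℝ F] {f : E d → F}
    (hf : IsTest f) : Integrable f volume :=
  hf.smooth.continuous.integrable_of_hasCompactSupport hf.compact

theorem IsTest.continuous {F : Type*} [NormedAddCommGroup F] [NormedSpace ℝ F] {f : E d → F}
    (hf : IsTest f) : Continuous f := hf.smooth.continuous

theorem IsTest.differentiable {F : Type*} [NormedAddCommGroup F] [NormedSpace ℝ F] {f : E d → F}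
    (hf : IsTest f) : Differentiable ℝ f := hf.smooth.differentiable (by simp)

theorem IsTest.continuous_fderiv {F : Type*} [NormedAddCommGroup F] [NormedSpace ℝ F] {f : E d → F}
    (hf : IsTest f) : Continuous (fderiv ℝ f) := hf.smooth.continuous_fderiv (by simp)

variable {f g : E d → ℝ}

theorem IsTest.integrable_sq (hf : IsTest f) : Integrable (fun x => f x ^ 2) volume := by
  have h : HasCompactSupport (fun x => f x ^ 2) :=
    hf.compact.comp_left (g := fun y : ℝ => y ^ 2) (by simp)
  exact (hf.continuous.pow 2).integrable_of_hasCompactSupport h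

theorem IsTest.integrable_fderiv_sq (hf : IsTest f) :
    Integrable (fun x => ‖fderiv ℝ f x‖ ^ 2) volume := by
  have h : HasCompactSupport (fun x => ‖fderiv ℝ f x‖ ^ 2) :=
    (hf.compact.fderiv ℝ).comp_left (g := fun L : E d →L[ℝ] ℝ => ‖L‖ ^ 2) (by simp)
  exact (hf.continuous_fderiv.norm.pow 2).integrable_of_hasCompactSupport h

theorem IsTest.integral_mul_laplacian (hf : IsTest f) :
    ∫ x, f x * Δ f x = -∫ x, ‖fderiv ℝ f x‖ ^ 2 := by
  set S := hf.toSchwartz with hS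
  set b := EuclideanSpace.basisFun (Fin d) ℝ with hb
  have h1 : ∀ x, Δ f x = ∑ i, (∂_{b i} (∂_{b i} S)) x := fun x => by
    rw [← hf.coe_toSchwartz, ← SchwartzMap.laplacian_apply, SchwartzMap.laplacian_eq_sum b,
      _root_.sum_apply]
  have h2 : ∀ x, ‖fderiv ℝ f x‖ ^ 2 = ∑ i, (∂_{b i} S) x * (∂_{b i} S) x := fun x => by
    rw [norm_sq_eq_sum_apply]
    refine Finset.sum_congr rfl fun i _ => ?_
    rw [SchwartzMap.lineDerivOp_apply_eq_fderiv, sq, hS, hf.coe_toSchwartz]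
  have hint : ∀ u v : 𝓢(E d, ℝ), Integrable (fun x => u x * v x) volume := fun u v =>
    (u.memLp 2).integrable_mul (v.memLp 2)
  have h3 : ∀ x, f x = S x := fun x => rfl
  simp only [h1, h2, h3, Finset.mul_sum]
  rw [integral_finsetSum _ fun i _ => hint S _, integral_finsetSum _ fun i _ => hint _ _,
    ← Finset.sum_neg_distrib]
  exact Finset.sum_congr rfl fun i _ => SchwartzMap.integral_mul_lineDerivOp_right_eq_neg_left _ _ _

/-- The quadratic form of `-Δ - W` on real-valued functions. -/
def energy (W f : E d → ℝ) : ℝ := (∫ x, ‖fderiv ℝ f x‖ ^ 2) - ∫ x, W x * f x ^ 2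

variable {W : E d → ℝ}

theorem integrable_mul_of_memLp_top (hW : MemLp W ⊤ volume) {u : E d → ℝ}
    (hu : Integrable u volume) : Integrable (fun x => W x * u x) volume :=
  hW.integrable_mul (memLp_one_iff_integrable.2 hu)

variable {u : E d → ℂ}

theorem IsTest.re (hu : IsTest u) : IsTest (fun x => (u x).re) :=
  ⟨Complex.reCLM.contDiff.comp hu.smooth, hu.compact.comp_left (g := Complex.re) rfl⟩

theorem IsTest.im (hu : IsTest u) : IsTest (fun x => (u x).im) :=
  ⟨Complex.imCLM.contDiff.comp hu.smooth, hu.compact.comp_left (g := Complex.im) rfl⟩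

theorem IsTest.ofReal (hf : IsTest f) : IsTest (fun x => (f x : ℂ)) :=
  ⟨Complex.ofRealCLM.contDiff.comp hf.smooth, hf.compact.comp_left (g := Complex.ofReal) rfl⟩

/-- A test function as an element of `H²`. -/
def IsTest.toDomain (hu : IsTest u) : (laplacianL2 d).domain :=
  ⟨hu.toSchwartz.toLp 2 volume, (exists_laplacian_toLp _).1⟩

theorem IsTest.coeFn_toDomain (hu : IsTest u) : (hu.toDomain : L2 d) =ᵐ[volume] u :=
  hu.toSchwartz.coeFn_toLp 2 volume

theorem IsTest.laplacian_toDomain (hu : IsTest u) :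
    laplacianL2 d hu.toDomain = (Δ hu.toSchwartz : 𝓢(E d, ℂ)).toLp 2 volume :=
  (exists_laplacian_toLp hu.toSchwartz).2

theorem IsTest.coeFn_laplacian (hu : IsTest u) : laplacianL2 d hu.toDomain =ᵐ[volume] Δ u := by
  rw [hu.laplacian_toDomain]
  filter_upwards [(Δ hu.toSchwartz : 𝓢(E d, ℂ)).coeFn_toLp 2 volume] with x hx
  rw [hx, SchwartzMap.laplacian_apply, hu.coe_toSchwartz]

theorem norm_sq_eq_re_add_im (z : ℂ) : ‖z‖ ^ 2 = z.re ^ 2 + z.im ^ 2 := by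
  rw [← Complex.normSq_eq_norm_sq, Complex.normSq_apply]; ring

theorem IsTest.norm_toDomain_sq (hu : IsTest u) :
    ‖(hu.toDomain : L2 d)‖ ^ 2 = (∫ x, (u x).re ^ 2) + ∫ x, (u x).im ^ 2 := by
  rw [norm_sq_eq_integral, ← integral_add hu.re.integrable_sq hu.im.integrable_sq]
  apply integral_congr_ae
  filter_upwards [hu.coeFn_toDomain] with x hx
  rw [hx, norm_sq_eq_re_add_im]

/-- The operator has real coefficients, so the cross terms between real and imaginary part are
purely imaginary. Lower bounds can therefore be proved for real functions only. -/
theorem IsTest.form_eq (hW : MemLp W ⊤ volume) (hu : IsTest u) :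
    form (schrodinger W) (ofSobolev hW hu.toDomain) =
      energy W (fun x => (u x).re) + energy W (fun x => (u x).im) := by
  have hre : ∀ x, (Δ u x).re = Δ (fun x => (u x).re) x := fun x =>
    ((hu.smooth.of_le (WithTop.coe_le_coe.2 le_top : ((2 : ℕ∞) : ℕ∞ω) ≤
      ∞)).contDiffAt.laplacian_CLM_comp_left (l := Complex.reCLM)).symm
  have him : ∀ x, (Δ u x).im = Δ (fun x => (u x).im) x := fun x =>
    ((hu.smooth.of_le (WithTop.coe_le_coe.2 le_top : ((2 : ℕ∞) : ℕ∞ω) ≤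
      ∞)).contDiffAt.laplacian_CLM_comp_left (l := Complex.imCLM)).symm
  have hlap : ∀ {f : E d → ℝ}, IsTest f → Integrable (fun x => f x * Δ f x) volume := by
    intro f hf
    have : (fun x => f x * Δ f x) = fun x => hf.toSchwartz x * (Δ hf.toSchwartz : 𝓢(E d, ℝ)) x := by
      ext x
      rw [SchwartzMap.laplacian_apply, hf.coe_toSchwartz]
    rw [this]
    exact (hf.toSchwartz.memLp 2 volume).integrable_mul ((Δ hf.toSchwartz : 𝓢(E d, ℝ)).memLp 2 volume)
  have e1 : form (schrodinger W) (ofSobolev hW hu.toDomain) =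
      ∫ x, (-((u x).re * Δ (fun x => (u x).re) x) - (u x).im * Δ (fun x => (u x).im) x
        - W x * (u x).re ^ 2 - W x * (u x).im ^ 2) := by
    rw [form, L2.inner_def]
    have := L2.integrable_inner (𝕜 := ℂ) (schrodinger W (ofSobolev hW hu.toDomain))
      (ofSobolev hW hu.toDomain : L2 d)
    have h2 := integral_re this
    simp only [RCLike.re_to_complex] at h2
    rw [← h2]
    apply integral_congr_ae
    have hs := schrodinger_apply hW (ofSobolev hW hu.toDomain)
    rw [toSobolev_ofSobolev, coe_ofSobolev] at hs
    rw [hs, coe_ofSobolev]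
    filter_upwards [hu.coeFn_toDomain, hu.coeFn_laplacian, coeFn_mulFun hW (hu.toDomain : L2 d),
      Lp.coeFn_sub (-laplacianL2 d hu.toDomain) (mulFun hW (hu.toDomain : L2 d)),
      Lp.coeFn_neg (laplacianL2 d hu.toDomain)] with x h1 h2 h3 h4 h5
    rw [h4, Pi.sub_apply, h5, Pi.neg_apply, h2, h3, h1, RCLike.inner_apply, ← hre, ← him]
    simp only [Complex.mul_re, Complex.conj_re, Complex.conj_im, Complex.sub_re, Complex.sub_im,
      Complex.neg_re, Complex.neg_im, Complex.mul_im, Complex.ofReal_re, Complex.ofReal_im]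
    ring
  have i1 := integrable_mul_of_memLp_top hW hu.re.integrable_sq
  have i2 := integrable_mul_of_memLp_top hW hu.im.integrable_sq
  have j1 : Integrable (fun x => -((u x).re * Δ (fun x => (u x).re) x)) volume := (hlap hu.re).neg
  have j2 : Integrable (fun x => -((u x).re * Δ (fun x => (u x).re) x) -
      (u x).im * Δ (fun x => (u x).im) x) volume := j1.sub (hlap hu.im)
  have j3 : Integrable (fun x => -((u x).re * Δ (fun x => (u x).re) x) -
      (u x).im * Δ (fun x => (u x).im) x - W x * (u x).re ^ 2) volume := j2.sub i1
  rw [e1, integral_sub j3 i2, integral_sub j2 i1, integral_sub j1 (hlap hu.im), integral_neg,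
    hu.re.integral_mul_laplacian,
    hu.im.integral_mul_laplacian, energy, energy]
  ring

theorem form_schrodinger_eq (hW : MemLp W ⊤ volume) (ψ : (schrodinger W).domain) :
    form (schrodinger W) ψ = -(⟪laplacianL2 d (toSobolev hW ψ), (ψ : L2 d)⟫).re -
      (⟪mulFun hW ψ, (ψ : L2 d)⟫).re := by
  rw [form, schrodinger_apply hW, inner_sub_left, inner_neg_left, Complex.sub_re, Complex.neg_re]

theorem continuous_mulFun (hW : MemLp W ⊤ volume) : Continuous (mulFun hW) := by
  obtain ⟨C, hC0, hC⟩ := exists_bound_of_memLp_top hW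
  refine (LipschitzWith.of_dist_le_mul (K := ⟨C, hC0⟩) fun a b => ?_).continuous
  rw [dist_eq_norm, dist_eq_norm, ← mulFun_sub]
  exact norm_mulFun_le hW hC _

/-- Lower bounds of the quadratic form can be checked on real test functions. -/
theorem form_ge_of_energy_ge (hW : MemLp W ⊤ volume) {e : ℝ}
    (h : ∀ f : E d → ℝ, IsTest f → e * ∫ x, f x ^ 2 ≤ energy W f)
    (ψ : (schrodinger W).domain) : e * ‖(ψ : L2 d)‖ ^ 2 ≤ form (schrodinger W) ψ := by
  choose u hu h1 h2 using fun n : ℕ =>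
    exists_test_near (toSobolev hW ψ) (ε := 1 / ((n : ℝ) + 1)) (by positivity)
  have t1 : Tendsto (fun n => ((hu n).toDomain : L2 d)) atTop (𝓝 (ψ : L2 d)) := by
    rw [tendsto_iff_norm_sub_tendsto_zero]
    refine squeeze_zero (fun _ => norm_nonneg _) (fun n => ?_) tendsto_one_div_add_atTop_nhds_zero_nat
    rw [norm_sub_rev]
    exact (h1 n).le
  have t2 : Tendsto (fun n => laplacianL2 d (hu n).toDomain) atTop
      (𝓝 (laplacianL2 d (toSobolev hW ψ))) := by
    rw [tendsto_iff_norm_sub_tendsto_zero]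
    refine squeeze_zero (fun _ => norm_nonneg _) (fun n => ?_) tendsto_one_div_add_atTop_nhds_zero_nat
    rw [norm_sub_rev, (hu n).laplacian_toDomain]
    exact (h2 n).le
  have t3 : Tendsto (fun n => form (schrodinger W) (ofSobolev hW (hu n).toDomain)) atTop
      (𝓝 (form (schrodinger W) ψ)) := by
    rw [form_schrodinger_eq hW ψ]
    simp only [form_schrodinger_eq hW, toSobolev_ofSobolev, coe_ofSobolev]
    have a := (Complex.continuous_re.tendsto _).comp (Filter.Tendsto.inner (𝕜 := ℂ) t2 t1)
    have b := (Complex.continuous_re.tendsto _).comp (Filter.Tendsto.inner (𝕜 := ℂ)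
      (((continuous_mulFun hW).tendsto _).comp t1) t1)
    exact a.neg.sub b
  refine le_of_tendsto_of_tendsto ((t1.norm.pow 2).const_mul e) t3 (Eventually.of_forall fun n => ?_)
  simp only
  rw [(hu n).form_eq hW, (hu n).norm_toDomain_sq, mul_add]
  exact add_le_add (h _ (hu n).re) (h _ (hu n).im)

/-- Lower bounds of the quadratic form with local error terms can be checked on real test
functions. -/
theorem form_ge_of_energy_ge_sub (hW : MemLp W ⊤ volume) {e C : ℝ} {B : Set (E d)}
    (hB : MeasurableSet B)
    (h : ∀ f : E d → ℝ, IsTest f → e * (∫ x, f x ^ 2) - C * ∫ x in B, f x ^ 2 ≤ energy W f)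
    (ψ : (schrodinger W).domain) :
    e * ‖(ψ : L2 d)‖ ^ 2 - C * ∫ x in B, ‖(ψ : L2 d) x‖ ^ 2 ≤ form (schrodinger W) ψ := by
  -- The local error is absorbed into the potential: the claim for `W` is the bound without error
  -- term for `W - D`.
  let D : E d → ℝ := B.indicator fun _ => C
  have hD : MemLp D ⊤ volume := by
    refine memLp_top_of_bound (aestronglyMeasurable_const.indicator hB) |C|
      (Eventually.of_forall fun x => ?_)
    simp only [D, Set.indicator]
    split_ifs <;> simp
  have hDi : ∀ (u : E d → ℝ), ∫ x, D x * u x = C * ∫ x in B, u x := fun u => by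
    rw [← integral_const_mul, ← integral_indicator hB]
    congr 1
    ext x
    simp only [D, Set.indicator]
    split_ifs <;> simp
  have hWD : MemLp (fun x => W x - D x) ⊤ volume := hW.sub hD
  have key := form_ge_of_energy_ge hWD (e := e) (fun f hf => by
    have h1 := h f hf
    have i1 := integrable_mul_of_memLp_top hW hf.integrable_sq
    have i2 := integrable_mul_of_memLp_top hD hf.integrable_sq
    rw [energy] at h1 ⊢
    simp only [sub_mul]
    rw [integral_sub i1 i2, hDi]
    linarith) (ofSobolev hWD (toSobolev hW ψ))
  rw [form_schrodinger_eq hWD, toSobolev_ofSobolev, coe_ofSobolev, coe_toSobolev] at key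
  have e1 : mulFun hWD (ψ : L2 d) = mulFun hW ψ - mulFun hD ψ := by
    apply Lp.ext
    filter_upwards [coeFn_mulFun hW (ψ : L2 d), coeFn_mulFun hD (ψ : L2 d),
      coeFn_mulFun hWD (ψ : L2 d), Lp.coeFn_sub (mulFun hW (ψ : L2 d)) (mulFun hD (ψ : L2 d))]
      with x h1 h2 h3 h4
    rw [h3, h4, Pi.sub_apply, h1, h2]
    push_cast; ring
  have e2 : (⟪mulFun hD (ψ : L2 d), (ψ : L2 d)⟫).re = C * ∫ x in B, ‖(ψ : L2 d) x‖ ^ 2 := by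
    rw [← hDi, L2.inner_def]
    have h2 := integral_re (L2.integrable_inner (𝕜 := ℂ) (mulFun hD (ψ : L2 d)) (ψ : L2 d))
    simp only [RCLike.re_to_complex] at h2
    rw [← h2]
    apply integral_congr_ae
    filter_upwards [coeFn_mulFun hD (ψ : L2 d)] with x hx
    rw [hx, ← smul_eq_mul, inner_smul_left, inner_self_eq_norm_sq_to_K, Complex.conj_ofReal]
    simp [← Complex.ofReal_pow]
  rw [e1, inner_sub_left, Complex.sub_re, e2] at key
  rw [form_schrodinger_eq hW]
  linarith

end Energy

/-! ### The ground state in two dimensions -/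

section GroundState

variable {d : ℕ}

theorem IsTest.add {F : Type*} [NormedAddCommGroup F] [NormedSpace ℝ F] {f g : E d → F}
    (hf : IsTest f) (hg : IsTest g) : IsTest (fun x => f x + g x) :=
  ⟨hf.smooth.add hg.smooth, hf.compact.add hg.compact⟩

theorem IsTest.sum {F ι : Type*} [NormedAddCommGroup F] [NormedSpace ℝ F] {f : ι → E d → F}
    (s : Finset ι) (hf : ∀ i ∈ s, IsTest (f i)) : IsTest (fun x => ∑ i ∈ s, f i x) := by
  classical
  induction s using Finset.induction_on with
  | empty => exact ⟨by simpa using contDiff_const, HasCompactSupport.zero⟩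
  | insert a s ha ih =>
    simp only [Finset.sum_insert ha]
    exact (hf a (Finset.mem_insert_self _ _)).add (ih fun i hi => hf i (Finset.mem_insert_of_mem hi))

theorem IsTest.const_smul {F : Type*} [NormedAddCommGroup F] [NormedSpace ℝ F] {f : E d → F}
    (hf : IsTest f) (c : ℝ) : IsTest (fun x => c • f x) :=
  ⟨hf.smooth.const_smul c, hf.compact.smul_left (f := fun _ => c)⟩

/-- At these points, the boundary spheres included, the cutoff attains its maximum one or its
minimum zero. -/
theorem fderiv_bump_eq_zero {R : ℝ} (hR : 0 < R) {x : E d} (hx : ‖x‖ ≤ R ∨ 2 * R ≤ ‖x‖) :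
    fderiv ℝ (bump d R) x = 0 := by
  rcases hx with hx | hx
  · exact IsLocalMax.fderiv_eq_zero (Eventually.of_forall fun y => by
      rw [bump_eq_one hR hx]; exact bump_le_one _ _)
  · exact IsLocalMin.fderiv_eq_zero (Eventually.of_forall fun y => by
      rw [bump_eq_zero hR hx]; exact bump_nonneg _ _)

theorem fderiv_bump {R : ℝ} (x : E d) :
    fderiv ℝ (bump d R) x = R⁻¹ • fderiv ℝ (bump d 1) (R⁻¹ • x) := by
  have h : bump d R = fun x => bump d 1 (R⁻¹ • x) := by ext x; simp [bump]
  rw [h]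
  exact fderiv_comp_smul R⁻¹

/-- The Dirichlet integral is scale invariant in the plane. -/
theorem integral_fderiv_bump_sq {R : ℝ} (hR : 0 < R) :
    ∫ x, ‖fderiv ℝ (bump 2 R) x‖ ^ 2 = ∫ x, ‖fderiv ℝ (bump 2 1) x‖ ^ 2 := by
  have h : ∀ x : E 2, ‖fderiv ℝ (bump 2 R) x‖ ^ 2 =
      (R⁻¹) ^ 2 * (fun y => ‖fderiv ℝ (bump 2 1) y‖ ^ 2) (R⁻¹ • x) := fun x => by
    rw [fderiv_bump, norm_smul, mul_pow, Real.norm_eq_abs, sq_abs]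
  simp only [h]
  rw [integral_const_mul,
    Measure.integral_comp_inv_smul volume (fun y : E 2 => ‖fderiv ℝ (bump 2 1) y‖ ^ 2) R]
  simp only [finrank_euclideanSpace, Fintype.card_fin, smul_eq_mul]
  rw [abs_of_pos (by positivity)]
  field_simp

/-- The average of cutoff functions at the scales `2ᵏρ`, `k < n`. -/
def logCutoff (d : ℕ) (ρ : ℝ) (n : ℕ) (x : E d) : ℝ :=
  (n : ℝ)⁻¹ • ∑ k ∈ Finset.range n, bump d (2 ^ k * ρ) x

theorem isTest_logCutoff {ρ : ℝ} (hρ : 0 < ρ) (n : ℕ) : IsTest (logCutoff d ρ n) :=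
  (IsTest.sum _ fun _ _ => isTest_bump (by positivity)).const_smul _

theorem logCutoff_eq_one {ρ : ℝ} (hρ : 0 < ρ) {n : ℕ} (hn : n ≠ 0) {x : E d} (hx : ‖x‖ ≤ ρ) :
    logCutoff d ρ n x = 1 := by
  have h : ∀ k ∈ Finset.range n, bump d (2 ^ k * ρ) x = 1 := fun k _ =>
    bump_eq_one (by positivity) (hx.trans (le_mul_of_one_le_left hρ.le (one_le_pow₀ one_le_two)))
  rw [logCutoff, Finset.sum_congr rfl h]
  simp [hn]

/-- The gradients of the dyadic cutoffs live on the disjoint annuli `2ᵏρ < |x| < 2ᵏ⁺¹ρ`. At most one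
is nonzero at a given point, so the square of the sum has no cross terms; this saves a factor `n`.
-/
theorem norm_sq_fderiv_logCutoff_le {ρ : ℝ} (hρ : 0 < ρ) (n : ℕ) (x : E d) :
    ‖fderiv ℝ (logCutoff d ρ n) x‖ ^ 2 ≤
      ((n : ℝ)⁻¹) ^ 2 * ∑ k ∈ Finset.range n, ‖fderiv ℝ (bump d (2 ^ k * ρ)) x‖ ^ 2 := by
  have hdiff : ∀ k ∈ Finset.range n, DifferentiableAt ℝ (bump d (2 ^ k * ρ)) x := fun k _ =>
    (isTest_bump (by positivity)).differentiable x
  have h1 : fderiv ℝ (logCutoff d ρ n) x =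
      (n : ℝ)⁻¹ • ∑ k ∈ Finset.range n, fderiv ℝ (bump d (2 ^ k * ρ)) x := by
    rw [← fderiv_fun_sum hdiff, ← fderiv_const_smul (DifferentiableAt.fun_sum hdiff)]
    rfl
  rw [h1, norm_smul, mul_pow, Real.norm_eq_abs, sq_abs]
  gcongr
  by_cases hall : ∀ k ∈ Finset.range n, fderiv ℝ (bump d (2 ^ k * ρ)) x = 0
  · rw [Finset.sum_eq_zero hall, norm_zero, zero_pow two_ne_zero]
    positivity
  push Not at hall
  obtain ⟨k, hk, hkx⟩ := hall
  have hk' : 2 ^ k * ρ < ‖x‖ ∧ ‖x‖ < 2 * (2 ^ k * ρ) := by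
    constructor <;> by_contra! hcon
    · exact hkx (fderiv_bump_eq_zero (by positivity) (Or.inl hcon))
    · exact hkx (fderiv_bump_eq_zero (by positivity) (Or.inr hcon))
  rw [Finset.sum_eq_single k (fun j _ hjk => ?_) (fun h => absurd hk h)]
  · exact Finset.single_le_sum (f := fun k => ‖fderiv ℝ (bump d (2 ^ k * ρ)) x‖ ^ 2)
      (fun _ _ => by positivity) hk
  · refine fderiv_bump_eq_zero (by positivity) ?_
    rcases lt_or_gt_of_ne hjk with h | h
    · right
      calc 2 * (2 ^ j * ρ) = 2 ^ (j + 1) * ρ := by ring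
        _ ≤ 2 ^ k * ρ := by gcongr; · norm_num
                            · exact h
        _ ≤ ‖x‖ := hk'.1.le
    · left
      calc ‖x‖ ≤ 2 ^ (k + 1) * ρ := hk'.2.le.trans_eq (by ring)
        _ ≤ 2 ^ j * ρ := by gcongr; · norm_num
                            · exact h

/-- Criticality of the plane: all cutoffs `bump 2 R` have the same Dirichlet integral `D`, so the
average of `n` dyadic ones has at most `D / n`. It equals one on `M`, hence its potential energy is
the fixed positive number `∫ V`. -/
theorem exists_energy_neg {V : E 2 → ℝ} {M : Set (E 2)} (hM_bdd : Bornology.IsBounded M)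
    (hV_mem : MemLp V ⊤ volume) (hV_nonneg : 0 ≤ᵐ[volume] V) (hV_ne : ¬ V =ᵐ[volume] 0)
    (hV_supp : ∀ᵐ u, u ∉ M → V u = 0) : ∃ f : E 2 → ℝ, IsTest f ∧ energy V f < 0 := by
  obtain ⟨ρ, hρ, hMρ⟩ := hM_bdd.subset_closedBall_lt 0 0
  set D := ∫ x, ‖fderiv ℝ (bump 2 1) x‖ ^ 2 with hD
  have hVi : Integrable V volume := by
    -- Multiplying by a cutoff that equals one on `M` does not change `V`, which is thus integrable.
    have h := integrable_mul_of_memLp_top hV_mem (isTest_bump (d := 2) hρ).integrable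
    refine h.congr ?_
    filter_upwards [hV_supp] with x hx
    by_cases hxM : x ∈ M
    · rw [bump_eq_one hρ (by simpa using hMρ hxM), mul_one]
    · rw [hx hxM, zero_mul]
  have hVpos : 0 < ∫ x, V x := by
    refine (integral_nonneg_of_ae hV_nonneg).lt_of_ne fun h => hV_ne ?_
    exact (integral_eq_zero_iff_of_nonneg_ae hV_nonneg hVi).1 h.symm
  obtain ⟨n, hn⟩ := exists_nat_gt (D / ∫ x, V x)
  have hD0 : 0 ≤ D := integral_nonneg fun _ => by positivity
  have hn0 : n ≠ 0 := by
    rintro rfl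
    rw [Nat.cast_zero] at hn
    exact absurd hn (not_lt.2 (by positivity))
  have hnpos : (0 : ℝ) < n := by positivity
  refine ⟨logCutoff 2 ρ n, isTest_logCutoff hρ n, ?_⟩
  have h1 : ∫ x, V x * logCutoff 2 ρ n x ^ 2 = ∫ x, V x := by
    apply integral_congr_ae
    filter_upwards [hV_supp] with x hx
    by_cases hxM : x ∈ M
    · rw [logCutoff_eq_one hρ hn0 (by simpa using hMρ hxM), one_pow, mul_one]
    · rw [hx hxM, zero_mul]
  have h2 : ∫ x, ‖fderiv ℝ (logCutoff 2 ρ n) x‖ ^ 2 ≤ D / n := by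
    have hi : ∀ k ∈ Finset.range n,
        Integrable (fun x => ‖fderiv ℝ (bump 2 (2 ^ k * ρ)) x‖ ^ 2) volume := fun k _ =>
      (isTest_bump (by positivity)).integrable_fderiv_sq
    refine (integral_mono (isTest_logCutoff hρ n).integrable_fderiv_sq
      ((integrable_finsetSum _ hi).const_mul _) (norm_sq_fderiv_logCutoff_le hρ n)).trans_eq ?_
    rw [integral_const_mul, integral_finsetSum _ hi,
      Finset.sum_congr rfl fun k _ => integral_fderiv_bump_sq (by positivity : 0 < 2 ^ k * ρ)]
    rw [Finset.sum_const, Finset.card_range, nsmul_eq_mul, ← hD]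
    field_simp
  rw [energy, h1]
  have : D / n < ∫ x, V x := by
    rw [div_lt_iff₀ hVpos] at hn
    rw [div_lt_iff₀ hnpos]
    linarith
  linarith

theorem setIntegral_bound_of_supp {V : E d → ℝ} {C ρ : ℝ} (hV_mem : MemLp V ⊤ volume)
    (hC : ∀ᵐ x, |V x| ≤ C) (hsupp : ∀ᵐ x, x ∉ Metric.ball 0 ρ → V x = 0) {f : E d → ℝ}
    (hf : IsTest f) : ∫ x, V x * f x ^ 2 ≤ C * ∫ x in Metric.ball 0 ρ, f x ^ 2 := by
  have i := integrable_mul_of_memLp_top hV_mem hf.integrable_sq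
  have h : ∫ x, V x * f x ^ 2 = ∫ x in Metric.ball 0 ρ, V x * f x ^ 2 := by
    refine (setIntegral_eq_integral_of_ae_compl_eq_zero ?_).symm
    filter_upwards [hsupp] with x hx hxB
    rw [hx hxB, zero_mul]
  rw [h, ← integral_const_mul]
  refine setIntegral_mono_ae i.integrableOn (hf.integrable_sq.const_mul C).integrableOn ?_
  filter_upwards [hC] with x hx
  gcongr
  exact (le_abs_self _).trans hx

theorem energy_ge_neg {V : E d → ℝ} {C : ℝ} (hV_mem : MemLp V ⊤ volume)
    (hC : ∀ᵐ x, |V x| ≤ C) {f : E d → ℝ} (hf : IsTest f) : -C * ∫ x, f x ^ 2 ≤ energy V f := by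
  have i := integrable_mul_of_memLp_top hV_mem hf.integrable_sq
  have h : ∫ x, V x * f x ^ 2 ≤ ∫ x, C * f x ^ 2 := by
    refine integral_mono_ae i (hf.integrable_sq.const_mul C) ?_
    filter_upwards [hC] with x hx
    gcongr
    exact (le_abs_self _).trans hx
  rw [integral_const_mul] at h
  have h2 : 0 ≤ ∫ x, ‖fderiv ℝ f x‖ ^ 2 := integral_nonneg fun _ => by positivity
  rw [energy]
  linarith

theorem energy_zero (V : E d → ℝ) : energy V (fun _ => 0) = 0 := by
  simp [energy]

theorem form_ofReal {V : E d → ℝ} (hV : MemLp V ⊤ volume) {f : E d → ℝ} (hf : IsTest f) :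
    form (schrodinger V) (ofSobolev hV hf.ofReal.toDomain) = energy V f := by
  rw [hf.ofReal.form_eq hV]
  simp [energy_zero]

/-- The ground state energy of `-Δ - V` in the plane is a negative discrete eigenvalue and the
infimum of the spectrum and of the quadratic form. -/
theorem groundEnergy_spec {V : E 2 → ℝ} {M : Set (E 2)} (hM_bdd : Bornology.IsBounded M)
    (hV_mem : MemLp V ⊤ volume) (hV_nonneg : 0 ≤ᵐ[volume] V) (hV_ne : ¬ V =ᵐ[volume] 0)
    (hV_supp : ∀ᵐ u, u ∉ M → V u = 0) :
    groundEnergy V < 0 ∧ IsLeast {l : ℝ | (l : ℂ) ∈ discSpec (schrodinger V)} (groundEnergy V) ∧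
    IsLeast {l : ℝ | (l : ℂ) ∈ spec (schrodinger V)} (groundEnergy V) ∧
    ∀ ψ : (schrodinger V).domain,
      groundEnergy V * ‖(ψ : L2 2)‖ ^ 2 ≤ form (schrodinger V) ψ := by
  have hT := isMaxSymmetric_schrodinger hV_mem
  obtain ⟨C, hC0, hC⟩ := exists_bound_of_memLp_top hV_mem
  obtain ⟨f, hf, hfneg⟩ := exists_energy_neg hM_bdd hV_mem hV_nonneg hV_ne hV_supp
  -- The Rayleigh quotients; their infimum `m` will be identified with the ground-state energy.
  let S : Set ℝ := {q | ∃ ψ : (schrodinger V).domain, ‖(ψ : L2 2)‖ = 1 ∧ form (schrodinger V) ψ = q}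
  have hlow := form_ge_of_energy_ge hV_mem (fun f hf => energy_ge_neg hV_mem hC hf)
  have hSb : BddBelow S := ⟨-C, by
    rintro q ⟨ψ, h1, rfl⟩
    have := hlow ψ
    rwa [h1, one_pow, mul_one] at this⟩
  have hscale : ∀ ψ : (schrodinger V).domain, (ψ : L2 2) ≠ 0 →
      form (schrodinger V) ψ / ‖(ψ : L2 2)‖ ^ 2 ∈ S := by
    intro ψ hψ
    have hn : 0 < ‖(ψ : L2 2)‖ := norm_pos_iff.2 hψ
    refine ⟨((‖(ψ : L2 2)‖⁻¹ : ℝ) : ℂ) • ψ, ?_, ?_⟩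
    · rw [Submodule.coe_smul, norm_smul, Complex.norm_real, norm_inv, norm_norm,
        inv_mul_cancel₀ hn.ne']
    · rw [form, LinearPMap.map_smul, Submodule.coe_smul, inner_smul_left, inner_smul_right,
        Complex.conj_ofReal, hT.inner_eq_form, ← Complex.ofReal_mul, ← Complex.ofReal_mul,
        Complex.ofReal_re]
      field_simp
  set m := sInf S with hm
  have hformm : ∀ ψ : (schrodinger V).domain, m * ‖(ψ : L2 2)‖ ^ 2 ≤ form (schrodinger V) ψ := by
    intro ψ
    by_cases hψ : (ψ : L2 2) = 0
    · rw [hψ, norm_zero, form, hψ, inner_zero_right]; simp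
    · have hn : 0 < ‖(ψ : L2 2)‖ := norm_pos_iff.2 hψ
      have := csInf_le hSb (hscale ψ hψ)
      rwa [le_div_iff₀ (by positivity)] at this
  have hform_f := form_ofReal hV_mem hf
  have hne : (ofSobolev hV_mem hf.ofReal.toDomain : L2 2) ≠ 0 := by
    intro h0
    rw [form, h0, inner_zero_right] at hform_f
    simp at hform_f
    linarith
  have hSne : S.Nonempty := ⟨_, hscale _ hne⟩
  have hm0 : m < 0 := by
    refine (csInf_le hSb (hscale _ hne)).trans_lt ?_
    rw [hform_f]
    exact div_neg_of_neg_of_pos hfneg (by have := norm_pos_iff.2 hne; positivity)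
  have hmspec : (m : ℂ) ∈ spec (schrodinger V) := by
    refine hT.mem_spec_of_inf hformm fun δ hδ => ?_
    obtain ⟨q, ⟨ψ, h1, rfl⟩, h2⟩ := exists_lt_of_csInf_lt hSne (by linarith : sInf S < m + δ)
    exact ⟨ψ, h1, h2⟩
  have hspec : IsLeast {l : ℝ | (l : ℂ) ∈ spec (schrodinger V)} m :=
    ⟨hmspec, fun l hl => hT.le_of_mem_spec hformm hl⟩
  obtain ⟨ρ, hρ, hMρ⟩ := hM_bdd.subset_ball_lt 0 0
  have hsupp : ∀ᵐ x, x ∉ Metric.ball 0 ρ → V x = 0 := by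
    filter_upwards [hV_supp] with x hx hxB
    exact hx fun hxM => hxB (hMρ hxM)
  have hmdisc : (m : ℂ) ∈ discSpec (schrodinger V) := by
    -- Off the ball the potential vanishes and the form is nonnegative, so the threshold is zero and
    -- the negative number `m` lies below it.
    refine mem_discSpec_of_form_ge (by norm_num) hV_mem (e := 0) (fun δ hδ => ⟨ρ, C, ?_⟩) hm0 hmspec
    refine form_ge_of_energy_ge_sub hV_mem Metric.isOpen_ball.measurableSet fun f hf => ?_
    have h1 := setIntegral_bound_of_supp hV_mem hC hsupp hf
    have h2 : 0 ≤ ∫ x, ‖fderiv ℝ f x‖ ^ 2 := integral_nonneg fun _ => by positivity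
    have h3 : 0 ≤ ∫ x, f x ^ 2 := integral_nonneg fun _ => by positivity
    rw [energy]
    nlinarith
  have hdisc : IsLeast {l : ℝ | (l : ℂ) ∈ discSpec (schrodinger V)} m :=
    ⟨hmdisc, fun l hl => hspec.2 hl.1⟩
  have hg : groundEnergy V = m := hdisc.csInf_eq
  rw [hg]
  exact ⟨hm0, hdisc, hspec, hformm⟩

end GroundState

/-! ### Relatively parallel frames along the curve -/

section Frame

/-- The fundamental theorem of calculus tolerates a countable exceptional set: `f` is the integral
of the continuous function `f'`. Kinks at the joining points of the triads are thereby excluded. -/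
theorem hasDerivAt_of_hasDerivAt_off_countable {F : Type*} [NormedAddCommGroup F]
    [NormedSpace ℝ F] [CompleteSpace F] {f f' : ℝ → F} {Z : Set ℝ} (hZ : Z.Countable)
    (hf : Continuous f) (hf' : Continuous f') (h : ∀ s, s ∉ Z → HasDerivAt f (f' s) s) (s : ℝ) :
    HasDerivAt f (f' s) s := by
  have e : f = fun x => f 0 + ∫ y in (0 : ℝ)..x, f' y := by
    ext x
    rw [integral_eq_of_hasDerivAt_off_countable f f' hZ hf.continuousOn (fun y hy => h y hy.2)
      (hf'.intervalIntegrable _ _)]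
    abel
  rw [e]
  exact (intervalIntegral.integral_hasDerivAt_right (hf'.intervalIntegrable _ _)
    (hf'.stronglyMeasurableAtFilter _ _) hf'.continuousAt).const_add (f 0)

/-- An adapted orthonormal frame along a curve whose normal fields are relatively parallel, with
coefficients `k₁`, `k₂` which vanish at infinity. -/
structure IsParallelFrame (Γ t N B : ℝ → E 3) (k₁ k₂ : ℝ → ℝ) : Prop where
  orthonormal : ∀ s, Orthonormal ℝ ![t s, N s, B s]
  deriv_curve : ∀ s, HasDerivAt Γ (t s) s
  deriv_t : ∀ s, HasDerivAt t (k₁ s • N s + k₂ s • B s) s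
  deriv_N : ∀ s, HasDerivAt N (-k₁ s • t s) s
  deriv_B : ∀ s, HasDerivAt B (-k₂ s • t s) s
  tendsto₁ : Tendsto k₁ (cocompact ℝ) (𝓝 0)
  tendsto₂ : Tendsto k₂ (cocompact ℝ) (𝓝 0)

theorem orthonormal_rotated {t n b : E 3} (h : Orthonormal ℝ ![t, n, b]) (a : ℝ) :
    Orthonormal ℝ ![t, Real.cos a • n - Real.sin a • b, Real.sin a • n + Real.cos a • b] := by
  have h1 : inner ℝ n n = 1 := by rw [real_inner_self_eq_norm_sq, show ‖n‖ = 1 from h.1 1, one_pow]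
  have h2 : inner ℝ b b = 1 := by rw [real_inner_self_eq_norm_sq, show ‖b‖ = 1 from h.1 2, one_pow]
  have h0 : ‖t‖ = 1 := h.1 0
  have h01 : inner ℝ t n = 0 := h.2 (i := 0) (j := 1) (by decide)
  have h02 : inner ℝ t b = 0 := h.2 (i := 0) (j := 2) (by decide)
  have h12 : inner ℝ n b = 0 := h.2 (i := 1) (j := 2) (by decide)
  have h10 : inner ℝ n t = 0 := h.2 (i := 1) (j := 0) (by decide)
  have h20 : inner ℝ b t = 0 := h.2 (i := 2) (j := 0) (by decide)
  have h21 : inner ℝ b n = 0 := h.2 (i := 2) (j := 1) (by decide)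
  rw [orthonormal_iff_ite]
  have := Real.sin_sq_add_cos_sq a
  intro i j
  fin_cases i <;> fin_cases j <;>
    simp [-inner_self_eq_norm_sq_to_K, inner_add_left, inner_add_right, inner_sub_left,
      inner_sub_right, inner_smul_left, inner_smul_right, real_inner_self_eq_norm_sq t,
      h0, h1, h2, h01, h02, h10, h20, h12, h21] <;> nlinarith

theorem abs_inner_le_of_norm_eq_one {v w : E 3} (hw : ‖w‖ = 1) : |inner ℝ v w| ≤ ‖v‖ := by
  have := abs_real_inner_le_norm v w
  rwa [hw, mul_one] at this

/-- Off `Z` the terms with `τ` cancel against `α'`, leaving `N' = -γ cos α t` and `B' = -γ sin α t`.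
The coefficients are taken to be the components of `Γ''` along `N` and `B`; these are continuous on
the whole line although `γ` and `α` need not be, so the equations extend across `Z`. -/
theorem exists_isParallelFrame {Γ n b : ℝ → E 3} {γ τ α : ℝ → ℝ} {Z : Set ℝ}
    (hZc : Z.Countable) (hframe : IsFrenetFrame Γ n b γ τ Z)
    (hglue₁ : Continuous (rotatedNormal n b α)) (hglue₂ : Continuous (rotatedBinormal n b α))
    (ha : ContDiff ℝ 2 Γ) (hb : AsymptoticallyStraight Γ γ τ Z)
    (he : ∀ s, s ∉ Z → HasDerivAt α (τ s) s) :
    ∃ k₁ k₂ : ℝ → ℝ, IsParallelFrame Γ (deriv Γ) (rotatedNormal n b α) (rotatedBinormal n b α)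
      k₁ k₂ := by
  set t := deriv Γ with ht
  set N := rotatedNormal n b α with hN
  set B := rotatedBinormal n b α with hB
  have hcd : ContDiff ℝ 1 t := by
    have : ContDiff ℝ (1 + 1) Γ := by norm_num; exact ha
    exact (contDiff_succ_iff_deriv.1 this).2.2
  have htc : Continuous t := hcd.continuous
  have ht'c : Continuous (deriv t) := hcd.continuous_deriv le_rfl
  have hortho : ∀ s, Orthonormal ℝ ![t s, N s, B s] := fun s =>
    orthonormal_rotated (hframe.orthonormal s) (α s)
  have hnorm : ∀ s, ‖n s‖ = 1 := fun s => (hframe.orthonormal s).1 1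
  have hdt : ∀ s, s ∉ Z → deriv t s = γ s • n s := fun s hs => (hframe.deriv_t s hs).deriv
  have hinner : ∀ s, inner ℝ (n s) (n s) = 1 ∧ inner ℝ (n s) (b s) = 0 := fun s => by
    have h := orthonormal_iff_ite.1 (hframe.orthonormal s)
    exact ⟨by simpa using h 1 1, by simpa using h 1 2⟩
  have hk1 : ∀ s, s ∉ Z → inner ℝ (deriv t s) (N s) = γ s * Real.cos (α s) := fun s hs => by
    rw [hdt s hs, hN, rotatedNormal, inner_smul_left, inner_sub_right, inner_smul_right,
      inner_smul_right, (hinner s).1, (hinner s).2]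
    simp
  have hk2 : ∀ s, s ∉ Z → inner ℝ (deriv t s) (B s) = γ s * Real.sin (α s) := fun s hs => by
    rw [hdt s hs, hB, rotatedBinormal, inner_smul_left, inner_add_right, inner_smul_right,
      inner_smul_right, (hinner s).1, (hinner s).2]
    simp
  have hdense : Dense Zᶜ := hZc.dense_compl ℝ
  have hγ : Tendsto γ (cocompact ℝ ⊓ 𝓟 Zᶜ) (𝓝 0) := by
    rcases hb with ⟨s₀, -, h⟩ | h
    · refine tendsto_const_nhds.congr' ?_
      rw [EventuallyEq, eventually_inf_principal]
      filter_upwards [(isCompact_closedBall (0 : ℝ) s₀).compl_mem_cocompact] with s hs hsZ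
      rw [Set.mem_compl_iff, mem_closedBall_zero_iff, not_le, Real.norm_eq_abs] at hs
      exact (h s hsZ hs).1.symm
    · exact h.2.2.2.1
  -- The decay of `γ` is known only off `Z`. If `|Γ''| ≥ ε` at some point, then `|Γ''| > ε / 2` on
  -- an open set, which meets the dense complement of `Z`, where `|Γ''| = |γ|`.
  have ht'0 : Tendsto (deriv t) (cocompact ℝ) (𝓝 0) := by
    rw [Metric.tendsto_nhds]
    intro ε hε
    have h1 := (Metric.tendsto_nhds.1 hγ) (ε / 2) (half_pos hε)
    rw [eventually_inf_principal] at h1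
    obtain ⟨K, hK, hKs⟩ := mem_cocompact.1 h1
    refine mem_cocompact.2 ⟨K, hK, fun s hs => ?_⟩
    change dist (deriv t s) 0 < ε
    by_contra! hcon
    have hopen : IsOpen (Kᶜ ∩ {s | ε / 2 < dist (deriv t s) 0}) :=
      hK.isClosed.isOpen_compl.inter (isOpen_lt continuous_const (ht'c.dist continuous_const))
    obtain ⟨r, ⟨hr1, hr2⟩, hr3⟩ := hdense.inter_open_nonempty _ hopen ⟨s, hs, by
      change ε / 2 < _; linarith⟩
    have h2 : dist (γ r) 0 < ε / 2 := hKs hr1 hr3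
    change ε / 2 < dist (deriv t r) 0 at hr2
    rw [hdt r hr3, dist_zero_right, norm_smul, hnorm, mul_one] at hr2
    rw [dist_zero_right] at h2
    linarith
  have hk1c : Continuous fun s => inner ℝ (deriv t s) (N s) := ht'c.inner hglue₁
  have hk2c : Continuous fun s => inner ℝ (deriv t s) (B s) := ht'c.inner hglue₂
  have hlim : ∀ {w : ℝ → E 3}, (∀ s, ‖w s‖ = 1) →
      Tendsto (fun s => inner ℝ (deriv t s) (w s)) (cocompact ℝ) (𝓝 0) := by
    intro w hw
    refine squeeze_zero_norm (fun s => ?_) (tendsto_zero_iff_norm_tendsto_zero.1 ht'0)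
    exact abs_inner_le_of_norm_eq_one (hw s)
  refine ⟨fun s => inner ℝ (deriv t s) (N s), fun s => inner ℝ (deriv t s) (B s), hortho,
    fun s => ?_, fun s => ?_, fun s => ?_, fun s => ?_, hlim fun s => (hortho s).1 1,
    hlim fun s => (hortho s).1 2⟩
  · exact ((ha.differentiable (by norm_num)) s).hasDerivAt
  · have h1 := ((hcd.differentiable one_ne_zero) s).hasDerivAt
    -- Both sides are continuous and agree on the dense set `Zᶜ`.
    have h2 : deriv t = fun s => inner ℝ (deriv t s) (N s) • N s + inner ℝ (deriv t s) (B s) • B s := by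
      refine Continuous.ext_on hdense ht'c ((hk1c.smul hglue₁).add (hk2c.smul hglue₂)) fun s hs => ?_
      rw [hk1 s hs, hk2 s hs, hdt s hs, hN, hB, rotatedNormal, rotatedBinormal]
      have := Real.sin_sq_add_cos_sq (α s)
      have e : γ s = γ s * (Real.sin (α s) ^ 2 + Real.cos (α s) ^ 2) := by rw [this, mul_one]
      conv_lhs => rw [e]
      module
    rwa [congrFun h2 s] at h1
  · refine hasDerivAt_of_hasDerivAt_off_countable hZc hglue₁ (f' := fun s =>
      -inner ℝ (deriv t s) (N s) • t s) (hk1c.neg.smul htc) (fun s hs => ?_) s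
    rw [hk1 s hs]
    have h1 := ((he s hs).cos.smul (hframe.deriv_n s hs)).sub
      ((he s hs).sin.smul (hframe.deriv_b s hs))
    rw [← ht] at h1
    refine HasDerivAt.congr_deriv h1 ?_
    module
  · refine hasDerivAt_of_hasDerivAt_off_countable hZc hglue₂ (f' := fun s =>
      -inner ℝ (deriv t s) (B s) • t s) (hk2c.neg.smul htc) (fun s hs => ?_) s
    rw [hk2 s hs]
    have h1 := ((he s hs).sin.smul (hframe.deriv_n s hs)).add
      ((he s hs).cos.smul (hframe.deriv_b s hs))
    rw [← ht] at h1
    refine HasDerivAt.congr_deriv h1 ?_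
    module

/-! ### The tube is almost straight far away -/

variable {Γ t N B : ℝ → E 3} {k₁ k₂ : ℝ → ℝ}

theorem orthonormal_neg_neg {t n b : E 3} (h : Orthonormal ℝ ![t, n, b]) :
    Orthonormal ℝ ![t, -n, -b] := by
  have h' := orthonormal_rotated h Real.pi
  simpa using h'

/-- The isometry which maps the standard basis to `(t, -N, -B)` at the point `s`. -/
def IsParallelFrame.rot (h : IsParallelFrame Γ t N B k₁ k₂) (s : ℝ) : E 3 ≃ₗᵢ[ℝ] E 3 :=
  ((basisOfOrthonormalOfCardEqFinrank (orthonormal_neg_neg (h.orthonormal s))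
    (by simp)).toOrthonormalBasis (by
      rw [coe_basisOfOrthonormalOfCardEqFinrank]
      exact orthonormal_neg_neg (h.orthonormal s))).repr.symm

theorem IsParallelFrame.rot_apply (h : IsParallelFrame Γ t N B k₁ k₂) (s : ℝ) (z : E 3) :
    h.rot s z = z 0 • t s - (z 1 • N s + z 2 • B s) := by
  rw [IsParallelFrame.rot, ← OrthonormalBasis.sum_repr_symm]
  simp [Fin.sum_univ_three]
  module

/-- The projection of `ℝ³` to the cross section. -/
def proj (z : E 3) : E 2 := !₂[z 1, z 2]

/-- The tube map in the coordinates `z = (s, u)` of `ℝ³`. -/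
def tube (Γ N B : ℝ → E 3) (z : E 3) : E 3 := Γ (z 0) - (z 1 • N (z 0) + z 2 • B (z 0))

/-- The vector `(s, 0, 0)`. -/
def axial (s : ℝ) : E 3 := EuclideanSpace.single 0 s

theorem norm_sub_le_of_bound {f f' : ℝ → E 3} (hf : ∀ s, HasDerivAt f (f' s) s) {a b C x y : ℝ}
    (hC : ∀ s ∈ Set.Icc a b, ‖f' s‖ ≤ C) (hx : x ∈ Set.Icc a b) (hy : y ∈ Set.Icc a b) :
    ‖f x - f y‖ ≤ C * |x - y| :=
  Convex.norm_image_sub_le_of_norm_hasDerivWithin_le (fun s _ => (hf s).hasDerivWithinAt) hC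
    (convex_Icc a b) hy hx

theorem IsParallelFrame.norm_eq_one (h : IsParallelFrame Γ t N B k₁ k₂) (s : ℝ) :
    ‖t s‖ = 1 ∧ ‖N s‖ = 1 ∧ ‖B s‖ = 1 :=
  ⟨(h.orthonormal s).1 0, (h.orthonormal s).1 1, (h.orthonormal s).1 2⟩

theorem norm_smul_sub_smul_le {f : ℝ → E 3} {ε L D x y σ σ' : ℝ} (hx0 : ‖f σ‖ ≤ ε * L)
    (hf : ‖f σ - f σ'‖ ≤ ε * |σ - σ'|) (hy : |y| ≤ D) :
    ‖x • f σ - y • f σ'‖ ≤ ε * L * |x - y| + D * ε * |σ - σ'| := by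
  have : x • f σ - y • f σ' = (x - y) • f σ + y • (f σ - f σ') := by module
  rw [this]
  refine (norm_add_le _ _).trans (add_le_add ?_ ?_)
  · rw [norm_smul, Real.norm_eq_abs, mul_comm]
    gcongr
  · rw [norm_smul, Real.norm_eq_abs, mul_assoc]
    exact mul_le_mul hy hf (norm_nonneg _) ((abs_nonneg y).trans hy)

theorem exists_forall_abs_le_of_tendsto {k : ℝ → ℝ} (hk : Tendsto k (cocompact ℝ) (𝓝 0)) {ε : ℝ}
    (hε : 0 < ε) : ∃ S, ∀ s, S < |s| → |k s| ≤ ε := by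
  have h := (Metric.tendsto_nhds.1 hk) ε hε
  obtain ⟨K, hK, hKs⟩ := mem_cocompact.1 h
  obtain ⟨S, hS⟩ := hK.isBounded.subset_closedBall 0
  refine ⟨S, fun s hs => ?_⟩
  have : s ∈ Kᶜ := fun hs' => by
    have := hS hs'
    rw [mem_closedBall_zero_iff, Real.norm_eq_abs] at this
    linarith
  have h2 : dist (k s) 0 < ε := hKs this
  rw [dist_zero_right, Real.norm_eq_abs] at h2
  exact h2.le

theorem abs_apply_le_norm {d : ℕ} (z : E d) (i : Fin d) : |z i| ≤ ‖z‖ := by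
  have := PiLp.norm_apply_le z i
  rwa [Real.norm_eq_abs] at this

/-- After subtracting the rigid motion, the increments of `Γ`, `N` and `B` on an interval of
half-length `R` have Lipschitz constants proportional to the bound on `k₁`, `k₂` there. A Lipschitz
estimate of the difference, rather than a uniform one, is what later gives injectivity and volume
control. -/
theorem IsParallelFrame.exists_almost_straight (h : IsParallelFrame Γ t N B k₁ k₂) {R η : ℝ}
    (hR : 0 < R) (hη : 0 < η) : ∃ S, ∀ s, S < |s| → ∀ z ∈ Metric.closedBall (0 : E 3) R,
      ∀ w ∈ Metric.closedBall (0 : E 3) R,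
      ‖tube Γ N B (z + axial s) - tube Γ N B (w + axial s) - h.rot s (z - w)‖ ≤ η * ‖z - w‖ := by
  -- The axis and each of the two normals contribute at most `2εR ‖z - w‖`.
  set ε := η / (6 * R) with hε
  have hε0 : 0 < ε := by positivity
  obtain ⟨S₁, hS₁⟩ := exists_forall_abs_le_of_tendsto h.tendsto₁ hε0
  obtain ⟨S₂, hS₂⟩ := exists_forall_abs_le_of_tendsto h.tendsto₂ hε0
  -- The summand `R` puts all of `[s - R, s + R]` into the region of small curvature.
  refine ⟨max S₁ S₂ + R, fun s hs z hz w hw => ?_⟩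
  rw [mem_closedBall_zero_iff] at hz hw
  have hI : ∀ r ∈ Set.Icc (s - R) (s + R), |k₁ r| ≤ ε ∧ |k₂ r| ≤ ε := fun r hr => by
    have h1 : |s| - R ≤ |r| := by
      have h2 : |s - r| ≤ R := by rw [abs_le]; constructor <;> linarith [hr.1, hr.2]
      have := abs_sub_abs_le_abs_sub s r
      linarith
    exact ⟨hS₁ r (by linarith [le_max_left S₁ S₂]), hS₂ r (by linarith [le_max_right S₁ S₂])⟩
  have hmem : ∀ σ, |σ| ≤ R → s + σ ∈ Set.Icc (s - R) (s + R) := fun σ hσ => by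
    rw [abs_le] at hσ; constructor <;> linarith
  have hs0 : s ∈ Set.Icc (s - R) (s + R) := ⟨by linarith, by linarith⟩
  have bN : ∀ x ∈ Set.Icc (s - R) (s + R), ∀ y ∈ Set.Icc (s - R) (s + R),
      ‖N x - N y‖ ≤ ε * |x - y| := fun x hx y hy => by
    refine norm_sub_le_of_bound h.deriv_N (fun r hr => ?_) hx hy
    rw [norm_smul, (h.norm_eq_one r).1, mul_one, norm_neg]
    exact (hI r hr).1
  have bB : ∀ x ∈ Set.Icc (s - R) (s + R), ∀ y ∈ Set.Icc (s - R) (s + R),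
      ‖B x - B y‖ ≤ ε * |x - y| := fun x hx y hy => by
    refine norm_sub_le_of_bound h.deriv_B (fun r hr => ?_) hx hy
    rw [norm_smul, (h.norm_eq_one r).1, mul_one, norm_neg]
    exact (hI r hr).2
  have bt : ∀ x ∈ Set.Icc (s - R) (s + R), ‖t x - t s‖ ≤ 2 * ε * R := fun x hx => by
    have h1 : ‖t x - t s‖ ≤ 2 * ε * |x - s| := by
      refine norm_sub_le_of_bound h.deriv_t (fun r hr => ?_) hx hs0
      refine (norm_add_le _ _).trans ?_
      rw [norm_smul, norm_smul, (h.norm_eq_one r).2.1, (h.norm_eq_one r).2.2]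
      have := hI r hr
      rw [Real.norm_eq_abs, Real.norm_eq_abs]
      linarith
    refine h1.trans ?_
    gcongr
    rw [abs_le]; constructor <;> linarith [hx.1, hx.2]
  have hz0 := (abs_apply_le_norm z 0).trans hz
  have hw0 := (abs_apply_le_norm w 0).trans hw
  have hw1 := (abs_apply_le_norm w 1).trans hw
  have hw2 := (abs_apply_le_norm w 2).trans hw
  have d0 : |z 0 - w 0| ≤ ‖z - w‖ := abs_apply_le_norm (z - w) 0
  have d1 : |z 1 - w 1| ≤ ‖z - w‖ := abs_apply_le_norm (z - w) 1
  have d2 : |z 2 - w 2| ≤ ‖z - w‖ := abs_apply_le_norm (z - w) 2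
  have c1 : ‖(Γ (s + z 0) - z 0 • t s) - (Γ (s + w 0) - w 0 • t s)‖ ≤ 2 * ε * R * |z 0 - w 0| := by
    have hd : ∀ r, HasDerivAt (fun r => Γ r - (r - s) • t s) (t r - t s) r := fun r => by
      have := (h.deriv_curve r).sub (((hasDerivAt_id r).sub_const s).smul_const (t s))
      rw [one_smul] at this
      exact this
    have := norm_sub_le_of_bound hd bt (hmem _ hz0) (hmem _ hw0)
    simpa using this
  have c2 := norm_smul_sub_smul_le (f := fun σ => N (s + σ) - N s) (x := z 1) (y := w 1) (σ := z 0)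
    (σ' := w 0) (ε := ε) (L := R) (D := R)
    ((bN _ (hmem _ hz0) s hs0).trans (by gcongr; simpa using hz0))
    (by simpa using bN _ (hmem _ hz0) _ (hmem _ hw0)) hw1
  have c3 := norm_smul_sub_smul_le (f := fun σ => B (s + σ) - B s) (x := z 2) (y := w 2) (σ := z 0)
    (σ' := w 0) (ε := ε) (L := R) (D := R)
    ((bB _ (hmem _ hz0) s hs0).trans (by gcongr; simpa using hz0))
    (by simpa using bB _ (hmem _ hz0) _ (hmem _ hw0)) hw2
  have e : tube Γ N B (z + axial s) - tube Γ N B (w + axial s) - h.rot s (z - w) =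
      ((Γ (s + z 0) - z 0 • t s) - (Γ (s + w 0) - w 0 • t s))
      - (z 1 • (N (s + z 0) - N s) - w 1 • (N (s + w 0) - N s))
      - (z 2 • (B (s + z 0) - B s) - w 2 • (B (s + w 0) - B s)) := by
    rw [h.rot_apply]
    simp only [tube, axial, PiLp.add_apply, PiLp.sub_apply, PiLp.single_apply, if_true]
    simp only [show (1 : Fin 3) ≠ 0 by decide, show (2 : Fin 3) ≠ 0 by decide, if_false, add_zero,
      add_comm _ s]
    module
  rw [e]
  refine (norm_sub_le _ _).trans ((add_le_add (norm_sub_le _ _) le_rfl).trans ?_)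
  have hεR : 0 ≤ ε * R := by positivity
  have hsum : η * ‖z - w‖ = 6 * (ε * R * ‖z - w‖) := by rw [hε]; field_simp
  rw [mul_comm R ε] at c2 c3
  have e0 := mul_le_mul_of_nonneg_left d0 hεR
  have e1 := mul_le_mul_of_nonneg_left d1 hεR
  have e2 := mul_le_mul_of_nonneg_left d2 hεR
  rw [hsum]
  have c1' : 2 * ε * R * |z 0 - w 0| = 2 * (ε * R * |z 0 - w 0|) := by ring
  rw [c1'] at c1
  linarith

end Frame

/-! ### Compositions with near-identity maps -/

section NearIdentity

/-- A change of variables inequality without Jacobian or injectivity: a volume bound for images of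
subsets bounds integrals over `F '' A` by integrals over `A`. -/
theorem restrict_image_le_map {d : ℕ} {F : E d → E d} (hF : Measurable F) {A : Set (E d)}
    {c : ENNReal} (h : ∀ s ⊆ A, volume (F '' s) ≤ c * volume s) :
    (volume : Measure (E d)).restrict (F '' A) ≤ c • ((volume : Measure (E d)).restrict A).map F := by
  refine Measure.le_intro fun s hs _ => ?_
  rw [Measure.restrict_apply hs, Measure.smul_apply, Measure.map_apply hF hs,
    Measure.restrict_apply (hF hs), Set.inter_comm s, ← Set.image_inter_preimage, Set.inter_comm,
    smul_eq_mul]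
  exact h _ Set.inter_subset_right

/-- If `F` is close to the identity in the Lipschitz sense and `k ∘ F = g`, then `k` is close to
`g` in `L²`. -/
theorem exists_eLpNorm_sub_le_of_near_id {d : ℕ} {g : E d → ℝ} (hg : MemLp g 2 volume) {R : ℝ}
    {ξ : ENNReal} (hξ : ξ ≠ 0) (hR : 0 < R) :
    ∃ δ > 0, ∀ F : E d → E d, Continuous F → F 0 = 0 →
      (∀ z ∈ Metric.closedBall 0 R, ∀ w ∈ Metric.closedBall 0 R,
        ‖F z - F w - (z - w)‖ ≤ δ * ‖z - w‖) →
      ∀ A ⊆ Metric.closedBall 0 R, MeasurableSet A → ∀ k : E d → ℝ, Measurable k →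
      (∀ p ∈ A, k (F p) = g p) → eLpNorm (k - g) 2 (volume.restrict (F '' A)) ≤ ξ := by
  -- The budget is `4ε` for `k - g'` and `ε` for `g' - g`, with `g'` a continuous approximation of
  -- `g`.
  obtain ⟨ε, hε0, hε⟩ : ∃ ε : ℝ, 0 < ε ∧ ENNReal.ofReal (5 * ε) ≤ ξ := by
    rcases eq_or_ne ξ ⊤ with rfl | h
    · exact ⟨1, one_pos, le_top⟩
    · refine ⟨ξ.toReal / 5, by have := ENNReal.toReal_pos hξ h; positivity, ?_⟩
      rw [mul_div_cancel₀ _ (by norm_num), ENNReal.ofReal_toReal h]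
  obtain ⟨g', hg'c, hg'ε, hg'cont, hg'mem⟩ := hg.exists_hasCompactSupport_eLpNorm_sub_le
    (by norm_num) (ENNReal.ofReal_pos.2 hε0).ne'
  -- The square root of the volume of the ball, which converts a uniform bound into an `L²` bound.
  set v : ℝ := (volume (Metric.closedBall (0 : E d) R)).toReal ^ (2 : ℝ)⁻¹ with hv
  have hv0 : 0 ≤ v := by positivity
  obtain ⟨r, hr0, hr⟩ := Metric.uniformContinuous_iff.1
    (hg'cont.uniformContinuous_of_tendsto_cocompact (x := 0)
      (hg'c.is_zero_at_infty)) (ε / (v + 1)) (by positivity)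
  -- The identity has determinant `1 < 2`, so maps Lipschitz-close to it at most double volumes.
  have hdet := addHaar_image_le_mul_of_det_lt (volume : Measure (E d))
    (ContinuousLinearMap.id ℝ (E d)) (m := 2) (by
      have : (ContinuousLinearMap.id ℝ (E d)).det = 1 := by
        simp [ContinuousLinearMap.det]
      rw [this]; norm_num)
  obtain ⟨δ₁, hδ₁, hδ₁0⟩ := (hdet.and self_mem_nhdsWithin).exists
  change 0 < δ₁ at hδ₁0
  -- As `F 0 = 0`, the second bound gives `‖F p - p‖ ≤ r / 2` on the ball, within the modulus of
  -- uniform continuity of `g'`.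
  refine ⟨min δ₁ (r / (2 * R)), lt_min (by exact_mod_cast hδ₁0) (by positivity),
    fun F hF hF0 hlin A hA hAm k hk hkg => ?_⟩
  have happ : ApproximatesLinearOn F (ContinuousLinearMap.id ℝ (E d)) A δ₁ := fun z hz w hw => by
    refine (hlin z (hA hz) w (hA hw)).trans ?_
    gcongr
    exact min_le_left _ _
  have hmeas : (volume : Measure (E d)).restrict (F '' A) ≤
      (2 : ENNReal) • ((volume : Measure (E d)).restrict A).map F :=
    restrict_image_le_map hF.measurable fun s hs => by
      have := hδ₁ s F (happ.mono_set hs)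
      exact_mod_cast this
  have hg'm := hg'cont.measurable
  have hdist : ∀ p ∈ A, |g' p - g' (F p)| ≤ ε / (v + 1) := fun p hp => by
    have h0 : (0 : E d) ∈ Metric.closedBall (0 : E d) R := by simp [hR.le]
    have h1 := hlin p (hA hp) 0 h0
    rw [hF0, sub_zero, sub_zero] at h1
    have h2 : ‖p‖ ≤ R := by simpa using hA hp
    have h3 : ‖F p - p‖ < r := by
      refine h1.trans_lt ?_
      calc min (δ₁ : ℝ) (r / (2 * R)) * ‖p‖ ≤ r / (2 * R) * R := by
            gcongr
            exact min_le_right _ _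
        _ = r / 2 := by field_simp
        _ < r := by linarith
    have := hr (a := p) (b := F p) (by rwa [dist_comm, dist_eq_norm])
    exact this.le
  have h1 : eLpNorm (k - g') 2 (volume.restrict (F '' A)) ≤ ENNReal.ofReal (4 * ε) := by
    have hkm : AEStronglyMeasurable (k - g') (((volume : Measure (E d)).restrict A).map F) :=
      (hk.sub hg'm).aestronglyMeasurable
    calc eLpNorm (k - g') 2 (volume.restrict (F '' A))
        ≤ eLpNorm (k - g') 2 ((2 : ENNReal) • ((volume : Measure (E d)).restrict A).map F) :=
          eLpNorm_mono_measure _ hmeas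
      _ = (2 : ENNReal) ^ (1 / (2 : ENNReal)).toReal *
          eLpNorm (k - g') 2 (((volume : Measure (E d)).restrict A).map F) := by
          rw [eLpNorm_smul_measure_of_ne_top (by norm_num), smul_eq_mul]
      _ ≤ 2 * eLpNorm (k - g') 2 (((volume : Measure (E d)).restrict A).map F) := by
          gcongr
          calc (2 : ENNReal) ^ (1 / (2 : ENNReal)).toReal ≤ 2 ^ (1 : ℝ) :=
                ENNReal.rpow_le_rpow_of_exponent_le (by norm_num) (by simp; norm_num)
            _ = 2 := ENNReal.rpow_one 2
      _ = 2 * eLpNorm ((k - g') ∘ F) 2 ((volume : Measure (E d)).restrict A) := by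
          rw [eLpNorm_map_measure hkm hF.aemeasurable]
      _ = 2 * eLpNorm ((g - g') + fun p => g' p - g' (F p)) 2
          ((volume : Measure (E d)).restrict A) := by
          congr 1
          refine eLpNorm_congr_ae ?_
          filter_upwards [ae_restrict_mem hAm] with p hp
          simp [hkg p hp]
      _ ≤ 2 * (eLpNorm (g - g') 2 volume + eLpNorm (fun p => g' p - g' (F p)) 2
          ((volume : Measure (E d)).restrict A)) := by
          gcongr
          refine (eLpNorm_add_le (hg.aestronglyMeasurable.sub hg'm.aestronglyMeasurable).restrict
            (hg'm.sub (hg'm.comp hF.measurable)).aestronglyMeasurable (by norm_num)).trans ?_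
          exact add_le_add (eLpNorm_mono_measure _ Measure.restrict_le_self) le_rfl
      _ ≤ 2 * (ENNReal.ofReal ε + ENNReal.ofReal ε) := by
          gcongr
          refine (eLpNorm_le_of_ae_bound (C := ε / (v + 1)) ?_).trans ?_
          · filter_upwards [ae_restrict_mem hAm] with p hp
            exact hdist p hp
          · calc ((volume : Measure (E d)).restrict A) Set.univ ^ (2 : ENNReal).toReal⁻¹ *
                ENNReal.ofReal (ε / (v + 1))
                ≤ volume (Metric.closedBall (0 : E d) R) ^ (2 : ENNReal).toReal⁻¹ *
                ENNReal.ofReal (ε / (v + 1)) := by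
                  rw [Measure.restrict_apply_univ]
                  gcongr
              _ = ENNReal.ofReal v * ENNReal.ofReal (ε / (v + 1)) := by
                  rw [hv, ← ENNReal.ofReal_rpow_of_nonneg ENNReal.toReal_nonneg (by norm_num),
                    ENNReal.ofReal_toReal measure_closedBall_lt_top.ne]
                  simp
              _ ≤ ENNReal.ofReal ε := by
                  rw [← ENNReal.ofReal_mul hv0]
                  gcongr
                  rw [mul_div_assoc', div_le_iff₀ (by positivity)]
                  nlinarith
      _ = ENNReal.ofReal (4 * ε) := by
          rw [← ENNReal.ofReal_add hε0.le hε0.le, show (2 : ENNReal) = ENNReal.ofReal 2 by simp,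
            ← ENNReal.ofReal_mul (by norm_num)]
          ring_nf
  have h2 : eLpNorm (g' - g) 2 (volume.restrict (F '' A)) ≤ ENNReal.ofReal ε := by
    rw [eLpNorm_sub_comm]
    exact (eLpNorm_mono_measure _ Measure.restrict_le_self).trans hg'ε
  have e : k - g = (k - g') + (g' - g) := by ring
  rw [e]
  refine (eLpNorm_add_le (hk.sub hg'm).aestronglyMeasurable
    (hg'm.aestronglyMeasurable.sub hg.aestronglyMeasurable.restrict) (by norm_num)).trans ?_
  refine (add_le_add h1 h2).trans (le_trans (le_of_eq ?_) hε)
  rw [← ENNReal.ofReal_add (by positivity) hε0.le]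
  ring_nf

end NearIdentity

/-! ### Splitting off the first coordinate -/

/-- The identification of `ℝ³` with `ℝ × ℝ²`. -/
def splitEquiv : E 3 ≃ᵐ ℝ × E 2 :=
  (MeasurableEquiv.toLp 2 (Fin 3 → ℝ)).symm.trans
    ((MeasurableEquiv.piFinSuccAbove (fun _ : Fin 3 => ℝ) 0).trans
      ((MeasurableEquiv.refl ℝ).prodCongr (MeasurableEquiv.toLp 2 (Fin 2 → ℝ))))

theorem splitEquiv_apply (z : E 3) : splitEquiv z = (z 0, proj z) := by
  refine Prod.ext rfl ?_
  ext i
  fin_cases i <;> rfl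

theorem measurePreserving_splitEquiv : MeasurePreserving splitEquiv := by
  refine ((EuclideanSpace.volume_preserving_symm_measurableEquiv_toLp (Fin 3)).trans
    ((volume_preserving_piFinSuccAbove (fun _ : Fin 3 => ℝ) 0).trans ?_))
  exact (MeasurePreserving.id volume).prod (PiLp.volume_preserving_toLp (Fin 2))

theorem splitEquiv_symm_apply (s : ℝ) (u : E 2) : splitEquiv.symm (s, u) = !₂[s, u 0, u 1] := by
  rw [MeasurableEquiv.symm_apply_eq, splitEquiv_apply]
  refine Prod.ext rfl ?_
  ext i
  fin_cases i <;> rfl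

theorem continuous_proj : Continuous proj := by
  unfold proj
  fun_prop

theorem norm_sq_eq_add_proj (z : E 3) : ‖z‖ ^ 2 = z 0 ^ 2 + ‖proj z‖ ^ 2 := by
  rw [EuclideanSpace.norm_sq_eq, EuclideanSpace.norm_sq_eq]
  simp [Fin.sum_univ_three, proj]
  ring

theorem quasiMeasurePreserving_proj : Measure.QuasiMeasurePreserving proj volume volume := by
  have h : proj = Prod.snd ∘ splitEquiv := by
    ext1 z
    rw [Function.comp_apply, splitEquiv_apply]
  rw [h]
  exact Measure.quasiMeasurePreserving_snd.comp measurePreserving_splitEquiv.quasiMeasurePreserving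

/-! ### Convergence of the translated potentials -/

/-- `W` is the potential with the profile `V` (extended by zero from `M`) on the tube. -/
structure IsTubePotential (Γ N B : ℝ → E 3) (M : Set (E 2)) (V : E 2 → ℝ) (W : E 3 → ℝ)
    (C : ℝ) : Prop where
  measurable_V : Measurable V
  measurable_W : Measurable W
  on_tube : ∀ z, proj z ∈ M → W (tube Γ N B z) = V (proj z)
  off_tube : ∀ x, (∀ z, proj z ∈ M → tube Γ N B z ≠ x) → W x = 0
  eq_zero : ∀ u, u ∉ M → V u = 0
  V_mem : ∀ u, V u ∈ Set.Icc 0 C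
  W_mem : ∀ x, W x ∈ Set.Icc 0 C

section Convergence

variable {Γ t N B : ℝ → E 3} {k₁ k₂ : ℝ → ℝ} {M : Set (E 2)} {V : E 2 → ℝ} {W : E 3 → ℝ} {C : ℝ}

theorem IsParallelFrame.differentiable_tube (h : IsParallelFrame Γ t N B k₁ k₂) :
    Differentiable ℝ (tube Γ N B) := by
  have hΓ : Differentiable ℝ Γ := fun s => (h.deriv_curve s).differentiableAt
  have hN : Differentiable ℝ N := fun s => (h.deriv_N s).differentiableAt
  have hB : Differentiable ℝ B := fun s => (h.deriv_B s).differentiableAt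
  unfold tube
  fun_prop

theorem tube_axial (s : ℝ) : tube Γ N B (axial s) = Γ s := by
  simp [tube, axial]

/-- The map `F`, the tube map followed by the inverse rigid motion at `s`, is close to the identity,
and `W` pulled back along it is the cylinder potential exactly. Thus `W` in rigid coordinates is
close to `V ∘ proj` in `L²`, provided no remote piece of the tube enters the window; (c) ensures
this. -/
theorem IsTubePotential.exists_eLpNorm_le (hW : IsTubePotential Γ N B M V W C)
    (h : IsParallelFrame Γ t N B k₁ k₂) (hM : Bornology.IsBounded M)
    (hc : ∀ R : ℝ, ∃ T, ∀ s s', T ≤ |s - s'| → R ≤ ‖Γ s - Γ s'‖) {R : ℝ} (hR : 0 < R)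
    {ξ : ENNReal} (hξ : ξ ≠ 0) : ∃ S, ∀ s, S < |s| →
      eLpNorm (fun z => W (Γ s + h.rot s z) - V (proj z)) 2
        (volume.restrict (Metric.closedBall (0 : E 3) R)) ≤ ξ := by
  obtain ⟨D, hD0, hD⟩ := hM.exists_pos_norm_le
  obtain ⟨T, hT⟩ := hc (R + D + 1)
  -- `2 * R` makes the image of the larger ball cover the window; `max T 0 + D` bounds all tube
  -- parameters, relative to `s`, whose image can lie in the window.
  set R₁ := max T 0 + D + 2 * R with hR₁
  have hT0 : 0 ≤ max T 0 := le_max_right _ _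
  have hR₁0 : 0 < R₁ := by linarith
  set g : E 3 → ℝ := (Metric.closedBall (0 : E 3) R₁).indicator fun z => V (proj z) with hg
  have hgm : MemLp g 2 volume := by
    rw [hg, memLp_indicator_iff_restrict measurableSet_closedBall]
    have : IsFiniteMeasure ((volume : Measure (E 3)).restrict (Metric.closedBall 0 R₁)) :=
      ⟨by rw [Measure.restrict_apply_univ]; exact measure_closedBall_lt_top⟩
    refine MemLp.of_bound (hW.measurable_V.comp continuous_proj.measurable).aestronglyMeasurable C
      (ae_of_all _ fun z => ?_)
    rw [Real.norm_eq_abs, abs_of_nonneg (hW.V_mem _).1]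
    exact (hW.V_mem _).2
  obtain ⟨δ, hδ0, hδ⟩ := exists_eLpNorm_sub_le_of_near_id hgm hξ hR₁0
  -- The bound `1 / 2` makes `F` injective on the ball of radius `R₁`, with image containing the
  -- ball of radius `R₁ / 2`.
  have hη : 0 < min δ (1 / 2) := lt_min hδ0 (by norm_num)
  obtain ⟨S, hS⟩ := h.exists_almost_straight hR₁0 hη
  refine ⟨S, fun s hs => ?_⟩
  set F : E 3 → E 3 := fun z => (h.rot s).symm (tube Γ N B (z + axial s) - Γ s) with hF
  have hFc : Continuous F := by
    have := h.differentiable_tube.continuous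
    fun_prop
  have hF0 : F 0 = 0 := by simp [hF, tube_axial]
  have hrot : ∀ z, Γ s + h.rot s (F z) = tube Γ N B (z + axial s) := fun z => by
    simp [hF]
  have hlin : ∀ z ∈ Metric.closedBall 0 R₁, ∀ w ∈ Metric.closedBall 0 R₁,
      ‖F z - F w - (z - w)‖ ≤ min δ (1 / 2) * ‖z - w‖ := fun z hz w hw => by
    have e : F z - F w - (z - w) = (h.rot s).symm
        (tube Γ N B (z + axial s) - tube Γ N B (w + axial s) - h.rot s (z - w)) := by
      simp only [hF, map_sub, LinearIsometryEquiv.symm_apply_apply]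
      abel
    rw [e, LinearIsometryEquiv.norm_map]
    exact hS s hs z hz w hw
  have hinj : Set.InjOn F (Metric.closedBall 0 R₁) := fun z hz w hw hzw => by
    have h1 := hlin z hz w hw
    rw [hzw, sub_self, zero_sub, norm_neg] at h1
    have h2 : ‖z - w‖ ≤ 1 / 2 * ‖z - w‖ :=
      h1.trans (mul_le_mul_of_nonneg_right (min_le_right _ _) (norm_nonneg _))
    have h3 : ‖z - w‖ = 0 := le_antisymm (by linarith) (norm_nonneg _)
    exact sub_eq_zero.1 (norm_eq_zero.1 h3)
  have hsurj : Metric.closedBall 0 R ⊆ F '' Metric.closedBall 0 R₁ := by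
    have happ : ApproximatesLinearOn F (ContinuousLinearMap.id ℝ (E 3)) (Metric.closedBall 0 R₁)
        (1 / 2) := fun z hz w hw => (hlin z hz w hw).trans (by
          push_cast
          gcongr
          exact min_le_right _ _)
    have := happ.surjOn_closedBall_of_nonlinearRightInverse
      ⟨id, 1, fun y => by simp, fun y => rfl⟩ hR₁0.le subset_rfl
    rw [hF0] at this
    refine (Metric.closedBall_subset_closedBall ?_).trans this
    push_cast
    linarith
  set A := F ⁻¹' Metric.closedBall 0 R ∩ Metric.closedBall 0 R₁ with hA
  have hFA : F '' A = Metric.closedBall 0 R := by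
    rw [hA, Set.inter_comm, Set.image_inter_preimage, Set.inter_eq_right]
    exact hsurj
  have hproj : ∀ z : E 3, proj (z + axial s) = proj z := fun z => by
    ext i; fin_cases i <;> simp [proj, axial]
  have hk : ∀ p ∈ A, W (Γ s + h.rot s (F p)) = g p := fun p hp => by
    rw [hg, Set.indicator_of_mem hp.2]
    by_cases hpM : proj p ∈ M
    · rw [hrot, hW.on_tube _ (by rwa [hproj]), hproj]
    -- If the image of `p` were also `tube w` with `proj w ∈ M`, then (c) would give `|w 0 - s| <
    -- T`, placing `w - axial s` in the ball where `F` is injective. It would equal `p`,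
    -- contradicting `proj p ∉ M`.
    · rw [hW.eq_zero _ hpM]
      refine hW.off_tube _ fun w hwM hw => hpM ?_
      have hwD : ‖proj w‖ ≤ D := hD _ hwM
      have h1 : ‖Γ (w 0) - Γ s‖ ≤ R + D := by
        have e : Γ (w 0) - Γ s = h.rot s (F p) - h.rot (w 0) !₂[0, w 1, w 2] := by
          have e' : h.rot s (F p) = tube Γ N B w - Γ s := by rw [hw]; abel
          rw [e', h.rot_apply]
          simp [tube]
          abel
        rw [e]
        refine (norm_sub_le _ _).trans (add_le_add ?_ ?_)
        · rw [LinearIsometryEquiv.norm_map]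
          simpa using hp.1
        · rw [LinearIsometryEquiv.norm_map]
          refine le_trans (le_of_eq ?_) hwD
          rw [← sq_eq_sq₀ (norm_nonneg _) (norm_nonneg _), norm_sq_eq_add_proj]
          simp [proj]
      have h2 : |w 0 - s| < T := by
        by_contra! hcon
        have := hT _ _ hcon
        linarith
      have h3 : w - axial s ∈ Metric.closedBall (0 : E 3) R₁ := by
        rw [mem_closedBall_zero_iff]
        have h4 : ‖w - axial s‖ ^ 2 ≤ (T + D) ^ 2 := by
          rw [norm_sq_eq_add_proj]
          have e : proj (w - axial s) = proj w := by rw [← hproj, sub_add_cancel]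
          have e0 : (w - axial s) 0 = w 0 - s := by simp [axial]
          rw [e, e0, ← sq_abs]
          nlinarith [abs_nonneg (w 0 - s), norm_nonneg (proj w)]
        have h5 := abs_le_of_sq_le_sq h4 (by linarith [abs_nonneg (w 0 - s)])
        rw [abs_norm] at h5
        linarith [le_max_left T 0]
      have h4 : F (w - axial s) = F p := by
        apply (h.rot s).injective
        apply add_left_cancel (a := Γ s)
        rw [hrot, sub_add_cancel, hw]
      have h5 := hinj h3 hp.2 h4
      rw [← h5, ← hproj, sub_add_cancel]
      exact hwM
  have hAm : MeasurableSet A :=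
    (hFc.measurable measurableSet_closedBall).inter measurableSet_closedBall
  have hkm : Measurable fun z => W (Γ s + h.rot s z) :=
    hW.measurable_W.comp (by fun_prop)
  have := hδ F hFc hF0 (fun z hz w hw => (hlin z hz w hw).trans
    (mul_le_mul_of_nonneg_right (min_le_left _ _) (norm_nonneg _))) A Set.inter_subset_right hAm
    (fun z => W (Γ s + h.rot s z)) hkm hk
  rw [hFA] at this
  refine le_trans (le_of_eq (eLpNorm_congr_ae ?_)) this
  filter_upwards [ae_restrict_mem measurableSet_closedBall] with z hz
  rw [Pi.sub_apply, hg, Set.indicator_of_mem]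
  exact Metric.closedBall_subset_closedBall (by linarith) hz

end Convergence

/-! ### Regularization of the profile -/

theorem tube_eq_tubeMap (Γ n b : ℝ → E 3) (α : ℝ → ℝ) (z : E 3) :
    tube Γ (rotatedNormal n b α) (rotatedBinormal n b α) z = tubeMap Γ n b α (z 0, proj z) := by
  simp [tube, tubeMap, proj]

theorem tubeMap_eq_tube (Γ n b : ℝ → E 3) (α : ℝ → ℝ) (p : ℝ × E 2) :
    tubeMap Γ n b α p =
      tube Γ (rotatedNormal n b α) (rotatedBinormal n b α) (splitEquiv.symm p) := by
  rw [tube_eq_tubeMap, ← splitEquiv_apply, MeasurableEquiv.apply_symm_apply]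

theorem proj_splitEquiv_symm (p : ℝ × E 2) : proj (splitEquiv.symm p) = p.2 := by
  have := splitEquiv_apply (splitEquiv.symm p)
  rw [MeasurableEquiv.apply_symm_apply] at this
  exact (congrArg Prod.snd this).symm

section Regularization

variable {Γ n b t : ℝ → E 3} {α k₁ k₂ : ℝ → ℝ} {M : Set (E 2)} {V : E 2 → ℝ}

theorem tubePotential_tubeMap (hd : Set.InjOn (tubeMap Γ n b α) {p | p.2 ∈ M}) (V : E 2 → ℝ)
    {p : ℝ × E 2} (hp : p.2 ∈ M) :
    tubePotential Γ n b α M V (tubeMap Γ n b α p) = V p.2 := by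
  have hinj : Function.Injective
      (fun p : {p : ℝ × E 2 // p.2 ∈ M} => tubeMap Γ n b α p.1) := fun p q h =>
    Subtype.ext (hd p.2 q.2 h)
  exact hinj.extend_apply _ _ ⟨p, hp⟩

theorem tubePotential_of_forall_ne {V : E 2 → ℝ} {x : E 3}
    (hx : ∀ p : ℝ × E 2, p.2 ∈ M → tubeMap Γ n b α p ≠ x) : tubePotential Γ n b α M V x = 0 :=
  Function.extend_apply' _ _ _ fun ⟨p, hp⟩ => hx p.1 p.2 hp

/-- The tube map is differentiable between spaces of equal dimension and so maps null sets to null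
sets. The operator therefore depends only on the class of `V`. -/
theorem tubePotential_ae_eq
    (h : IsParallelFrame Γ t (rotatedNormal n b α) (rotatedBinormal n b α) k₁ k₂)
    (hd : Set.InjOn (tubeMap Γ n b α) {p | p.2 ∈ M}) {V' : E 2 → ℝ} (hV : V =ᵐ[volume] V') :
    tubePotential Γ n b α M V =ᵐ[volume] tubePotential Γ n b α M V' := by
  have h0 : volume (proj ⁻¹' {u | V u ≠ V' u}) = 0 := quasiMeasurePreserving_proj.ae hV
  have h1 := addHaar_image_eq_zero_of_differentiableOn_of_addHaar_eq_zero volume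
    h.differentiable_tube.differentiableOn h0
  refine measure_mono_null (fun x hx => ?_) h1
  by_contra hcon
  refine hx ?_
  by_cases hp : ∃ p : ℝ × E 2, p.2 ∈ M ∧ tubeMap Γ n b α p = x
  · obtain ⟨p, hpM, rfl⟩ := hp
    change tubePotential Γ n b α M V _ = tubePotential Γ n b α M V' _
    rw [tubePotential_tubeMap hd V hpM, tubePotential_tubeMap hd V' hpM]
    by_contra hne
    refine hcon ⟨splitEquiv.symm p, ?_, (tubeMap_eq_tube Γ n b α p).symm⟩
    change V (proj _) ≠ V' (proj _)
    rwa [proj_splitEquiv_symm]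
  · push Not at hp
    change tubePotential Γ n b α M V _ = tubePotential Γ n b α M V' _
    rw [tubePotential_of_forall_ne hp, tubePotential_of_forall_ne hp]

/-- A Borel representative of `V`, clipped to `[0, C]` and set to zero off `M`, satisfies everywhere
what is assumed almost everywhere. -/
theorem exists_isTubePotential
    (h : IsParallelFrame Γ t (rotatedNormal n b α) (rotatedBinormal n b α) k₁ k₂)
    (hM_open : IsOpen M) (hd : Set.InjOn (tubeMap Γ n b α) {p | p.2 ∈ M})
    (hV_mem : MemLp V ⊤ volume) (hV_nonneg : 0 ≤ᵐ[volume] V)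
    (hV_supp : ∀ᵐ u, u ∉ M → V u = 0) :
    ∃ V' C, V =ᵐ[volume] V' ∧
      tubePotential Γ n b α M V =ᵐ[volume] tubePotential Γ n b α M V' ∧
      IsTubePotential Γ (rotatedNormal n b α) (rotatedBinormal n b α) M V'
        (tubePotential Γ n b α M V') C := by
  obtain ⟨C, hC0, hC⟩ := exists_bound_of_memLp_top hV_mem
  set V₁ := hV_mem.aestronglyMeasurable.mk V with hV₁
  have hV₁m : Measurable V₁ := hV_mem.aestronglyMeasurable.stronglyMeasurable_mk.measurable
  set V' : E 2 → ℝ := M.indicator fun u => max 0 (min C (V₁ u)) with hV'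
  have hV'm : Measurable V' :=
    (measurable_const.max (measurable_const.min hV₁m)).indicator hM_open.measurableSet
  have hV'C : ∀ u, V' u ∈ Set.Icc 0 C := fun u => by
    by_cases hu : u ∈ M
    · rw [hV', Set.indicator_of_mem hu]
      exact ⟨le_max_left _ _, max_le hC0 (min_le_left _ _)⟩
    · rw [hV', Set.indicator_of_notMem hu]
      exact ⟨le_rfl, hC0⟩
  have hVV' : V =ᵐ[volume] V' := by
    filter_upwards [hV_mem.aestronglyMeasurable.ae_eq_mk, hC, hV_nonneg, hV_supp]
      with u h1 h2 h3 h4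
    by_cases hu : u ∈ M
    · rw [hV', Set.indicator_of_mem hu, hV₁, ← h1, min_eq_right ((le_abs_self _).trans h2),
        max_eq_right (show 0 ≤ V u from h3)]
    · rw [hV', Set.indicator_of_notMem hu, h4 hu]
  refine ⟨V', C, hVV', tubePotential_ae_eq h hd hVV', hV'm, ?_, fun z hz => ?_, fun x hx => ?_,
    fun u hu => Set.indicator_of_notMem hu _, hV'C, fun x => ?_⟩
  · have hm : MeasurableSet {p : ℝ × E 2 | p.2 ∈ M} :=
      (hM_open.preimage continuous_snd).measurableSet
    have : StandardBorelSpace {p : ℝ × E 2 // p.2 ∈ M} := hm.standardBorel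
    have hcont : Measurable (tubeMap Γ n b α) := by
      have e : tubeMap Γ n b α = fun p => tube Γ (rotatedNormal n b α) (rotatedBinormal n b α)
        (splitEquiv.symm p) := funext (tubeMap_eq_tube Γ n b α)
      rw [e]
      exact h.differentiable_tube.continuous.measurable.comp splitEquiv.symm.measurable
    -- Lusin–Souslin: an injective Borel map on a standard Borel space has Borel images, so the
    -- extension by zero is measurable.
    have hemb : MeasurableEmbedding
        (fun p : {p : ℝ × E 2 // p.2 ∈ M} => tubeMap Γ n b α p.1) :=
      (hcont.comp measurable_subtype_coe).measurableEmbedding fun p q hpq =>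
        Subtype.ext (hd p.2 q.2 hpq)
    exact hemb.measurable_extend (hV'm.comp (measurable_snd.comp measurable_subtype_coe))
      measurable_const
  · rw [tube_eq_tubeMap, tubePotential_tubeMap hd V' (p := (z 0, proj z)) hz]
  · refine tubePotential_of_forall_ne fun p hp hpx => hx (splitEquiv.symm p) ?_ ?_
    · rwa [proj_splitEquiv_symm]
    · rw [← tubeMap_eq_tube, hpx]
  · by_cases hp : ∃ p : ℝ × E 2, p.2 ∈ M ∧ tubeMap Γ n b α p = x
    · obtain ⟨p, hpM, rfl⟩ := hp
      rw [tubePotential_tubeMap hd V' hpM]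
      exact hV'C _
    · push Not at hp
      rw [tubePotential_of_forall_ne hp]
      exact ⟨le_rfl, hC0⟩

theorem mulL2_congr {d : ℕ} {W W' : E d → ℝ} (h : W =ᵐ[volume] W') : mulL2 W = mulL2 W' := by
  have hae : ∀ ψ : L2 d, (fun x => (W x : ℂ) * ψ x) =ᵐ[volume] fun x => (W' x : ℂ) * ψ x :=
    fun ψ => by filter_upwards [h] with x hx; rw [hx]
  refine LinearPMap.ext (Submodule.ext fun ψ => memLp_congr_ae (hae ψ)) fun ψ hψ hψ' => ?_
  exact MemLp.toLp_congr (memLp_of_mem_mulDomain ⟨ψ, hψ⟩) (memLp_of_mem_mulDomain ⟨ψ, hψ'⟩) (hae ψ)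

theorem schrodinger_congr {d : ℕ} {W W' : E d → ℝ} (h : W =ᵐ[volume] W') :
    schrodinger W = schrodinger W' := by
  rw [schrodinger, schrodinger, mulL2_congr h]

end Regularization

/-! ### The straight cylinder -/

section Cylinder

/-- The embedding of the cross section. -/
def crossEmb : E 2 →ₗᵢ[ℝ] E 3 where
  toFun u := !₂[0, u 0, u 1]
  map_add' u v := by ext i; fin_cases i <;> simp
  map_smul' c u := by ext i; fin_cases i <;> simp
  norm_map' u := by
    rw [← sq_eq_sq₀ (norm_nonneg _) (norm_nonneg _)]
    simp [EuclideanSpace.norm_sq_eq, Fin.sum_univ_three]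

theorem splitEquiv_symm_eq (s : ℝ) (u : E 2) : splitEquiv.symm (s, u) = axial s + crossEmb u := by
  rw [splitEquiv_symm_apply]
  ext i
  fin_cases i <;> simp [axial, crossEmb]

theorem IsTest.comp_affineIsometry {F : Type*} [NormedAddCommGroup F] [NormedSpace ℝ F] {m d : ℕ}
    {f : E d → F} (hf : IsTest f) (a : E d) (L : E m →ₗᵢ[ℝ] E d) :
    IsTest (fun u => f (a + L u)) where
  smooth := hf.smooth.comp (contDiff_const.add L.toContinuousLinearMap.contDiff)
  compact := by
    have h : Isometry fun u => a + L u := (IsometryEquiv.addLeft a).isometry.comp L.isometry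
    exact hf.compact.comp_isClosedEmbedding h.isClosedEmbedding

theorem fderiv_comp_affineIsometry {F : Type*} [NormedAddCommGroup F] [NormedSpace ℝ F] {m d : ℕ}
    {f : E d → F} (hf : Differentiable ℝ f) (a : E d) (L : E m →ₗᵢ[ℝ] E d) (u : E m) :
    fderiv ℝ (fun u => f (a + L u)) u = (fderiv ℝ f (a + L u)).comp L.toContinuousLinearMap := by
  have h1 : HasFDerivAt (fun u => a + L u) L.toContinuousLinearMap u :=
    L.toContinuousLinearMap.hasFDerivAt.const_add a
  exact ((hf _).hasFDerivAt.comp u h1).fderiv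

theorem norm_fderiv_comp_affineIsometry_le {F : Type*} [NormedAddCommGroup F] [NormedSpace ℝ F]
    {m d : ℕ} {f : E d → F} (hf : Differentiable ℝ f) (a : E d) (L : E m →ₗᵢ[ℝ] E d) (u : E m) :
    ‖fderiv ℝ (fun u => f (a + L u)) u‖ ≤ ‖fderiv ℝ f (a + L u)‖ := by
  rw [fderiv_comp_affineIsometry hf]
  refine (ContinuousLinearMap.opNorm_comp_le _ _).trans ?_
  exact mul_le_of_le_one_right (norm_nonneg _) L.norm_toContinuousLinearMap_le

theorem integral_energy_density_sub {d : ℕ} {W f : E d → ℝ} (hW : MemLp W ⊤ volume)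
    (hf : IsTest f) (e : ℝ) :
    ∫ x, (‖fderiv ℝ f x‖ ^ 2 - W x * f x ^ 2 - e * f x ^ 2) = energy W f - e * ∫ x, f x ^ 2 := by
  have i1 := hf.integrable_fderiv_sq
  have i2 := integrable_mul_of_memLp_top hW hf.integrable_sq
  have h1 := integral_sub (i1.sub i2) (hf.integrable_sq.const_mul e)
  have h2 := integral_sub i1 i2
  simp only [Pi.sub_apply] at h1
  rw [h1, h2, integral_const_mul, energy]

/-- A lower bound for the energy in the cross section is one for the straight cylinder. -/
theorem cylinder_energy_ge {V : E 2 → ℝ} (hV : MemLp V ⊤ volume)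
    (hVc : MemLp (fun z => V (proj z)) ⊤ (volume : Measure (E 3))) {e : ℝ}
    (he : ∀ f : E 2 → ℝ, IsTest f → e * ∫ u, f u ^ 2 ≤ energy V f) {f : E 3 → ℝ}
    (hf : IsTest f) : e * ∫ z, f z ^ 2 ≤ energy (fun z => V (proj z)) f := by
  set G : E 3 → ℝ := fun z => ‖fderiv ℝ f z‖ ^ 2 - V (proj z) * f z ^ 2 - e * f z ^ 2 with hG
  have i1 := hf.integrable_fderiv_sq
  have i2 := integrable_mul_of_memLp_top hVc hf.integrable_sq
  have i3 := hf.integrable_sq.const_mul e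
  have hGi : Integrable G volume := (i1.sub i2).sub i3
  have hGint : ∫ z, G z = energy (fun z => V (proj z)) f - e * ∫ z, f z ^ 2 :=
    integral_energy_density_sub hVc hf e
  have hmp := measurePreserving_splitEquiv.symm
  have hprod : ∫ z, G z = ∫ s, ∫ u, G (splitEquiv.symm (s, u)) := by
    rw [← hmp.integral_comp', Measure.volume_eq_prod]
    refine integral_prod (fun p => G (splitEquiv.symm p)) ?_
    rw [← Measure.volume_eq_prod]
    exact hmp.integrable_comp_of_integrable hGi
  have hpos : 0 ≤ ∫ s, ∫ u, G (splitEquiv.symm (s, u)) := by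
    refine integral_nonneg fun s => ?_
    change 0 ≤ ∫ u, G (splitEquiv.symm (s, u))
    -- On a non-integrable slice the integral is zero by convention, which suffices here.
    by_cases hi : Integrable (fun u => G (splitEquiv.symm (s, u))) volume
    swap
    · rw [integral_undef hi]
    set fs : E 2 → ℝ := fun u => f (axial s + crossEmb u) with hfs
    have hfst : IsTest fs := hf.comp_affineIsometry _ _
    have j1 := hfst.integrable_fderiv_sq
    have j2 := integrable_mul_of_memLp_top hV hfst.integrable_sq
    have j3 := hfst.integrable_sq.const_mul e
    have h1 : ∫ u, (‖fderiv ℝ fs u‖ ^ 2 - V u * fs u ^ 2 - e * fs u ^ 2) =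
        energy V fs - e * ∫ u, fs u ^ 2 :=
      integral_energy_density_sub hV hfst e
    have h2 := he fs hfst
    -- The gradient along the slice is a restriction of the full one; the axial derivative is
    -- dropped.
    have h3 : ∫ u, (‖fderiv ℝ fs u‖ ^ 2 - V u * fs u ^ 2 - e * fs u ^ 2) ≤
        ∫ u, G (splitEquiv.symm (s, u)) := by
      refine integral_mono ((j1.sub j2).sub j3) hi fun u => ?_
      change _ ≤ G (splitEquiv.symm (s, u))
      rw [hG]
      simp only
      rw [proj_splitEquiv_symm, splitEquiv_symm_eq]
      have := norm_fderiv_comp_affineIsometry_le hf.differentiable (axial s) crossEmb u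
      gcongr
    linarith
  rw [← hprod, hGint] at hpos
  linarith

end Cylinder

/-! ### Perturbation of the energy by a potential which is small in `L²` -/

section Perturbation

/-- Hölder gives `‖U‖₂ ‖f‖₄²`, and in dimension three the Sobolev inequality bounds `‖f‖₄` by
`‖∇f‖₂` for supports in a fixed ball. Smallness of the potential in `L²` is thus enough for a form
bound. -/
theorem exists_integral_mul_sq_le {R : ℝ} : ∃ K : ℝ, 0 ≤ K ∧ ∀ (f : E 3 → ℝ), IsTest f →
    Function.support f ⊆ Metric.closedBall 0 R → ∀ (U : E 3 → ℝ), Measurable U → ∀ ξ : ℝ, 0 ≤ ξ →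
    eLpNorm U 2 (volume.restrict (Metric.closedBall 0 R)) ≤ ENNReal.ofReal ξ →
    |∫ z, U z * f z ^ 2| ≤ ξ * K * ∫ z, ‖fderiv ℝ f z‖ ^ 2 := by
  set k : NNReal := eLpNormLESNormFDerivOfLeConst ℝ (volume : Measure (E 3))
    (Metric.closedBall (0 : E 3) R) 2 4 with hk
  refine ⟨k ^ 2, by positivity, fun f hf hsupp U hU ξ hξ hUξ => ?_⟩
  have h4 : eLpNorm f 4 volume ≤ k * eLpNorm (fderiv ℝ f) 2 volume := by
    have := eLpNorm_le_eLpNorm_fderiv_of_le (volume : Measure (E 3)) (hf.smooth.of_le (by simp))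
      hsupp (p := 2) (q := 4) (by norm_num) (by simp; norm_num) (by simp; norm_num)
      Metric.isBounded_closedBall
    exact_mod_cast this
  have hsq : eLpNorm (fun z => f z ^ 2) 2 volume = eLpNorm f 4 volume ^ 2 := by
    have := eLpNorm_norm_rpow (μ := volume) (p := 2) f (q := 2) (by norm_num)
    have e1 : (fun x => ‖f x‖ ^ (2 : ℝ)) = fun z => f z ^ 2 := by
      ext x
      rw [Real.rpow_two, Real.norm_eq_abs, sq_abs]
    have e2 : (2 : ENNReal) * ENNReal.ofReal 2 = 4 := by
      rw [ENNReal.ofReal_ofNat]; norm_num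
    rw [e1, e2, ENNReal.rpow_two] at this
    exact this
  have hgrad : eLpNorm (fderiv ℝ f) 2 volume ^ 2 =
      ENNReal.ofReal (∫ z, ‖fderiv ℝ f z‖ ^ 2) := by
    rw [ofReal_integral_eq_lintegral_ofReal hf.integrable_fderiv_sq
      (ae_of_all _ fun _ => by positivity)]
    have := eLpNorm_nnreal_pow_eq_lintegral (p := 2) (μ := volume) (f := fderiv ℝ f) (by norm_num)
    simp only [NNReal.coe_ofNat, ENNReal.rpow_two, ENNReal.coe_ofNat] at this
    rw [this]
    refine lintegral_congr fun z => ?_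
    rw [ENNReal.ofReal_pow (norm_nonneg _), ofReal_norm]
  have hint : ∫ z, U z * f z ^ 2 = ∫ z in Metric.closedBall 0 R, U z * f z ^ 2 := by
    refine (setIntegral_eq_integral_of_forall_compl_eq_zero fun z hz => ?_).symm
    have : f z = 0 := by
      by_contra h
      exact hz (hsupp h)
    rw [this]; simp
  have hmain : ‖∫ z, U z * f z ^ 2‖ₑ ≤ ENNReal.ofReal (ξ * k ^ 2 * ∫ z, ‖fderiv ℝ f z‖ ^ 2) := by
    rw [hint]
    refine (enorm_integral_le_lintegral_enorm _).trans ?_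
    rw [← eLpNorm_one_eq_lintegral_enorm]
    have hH := eLpNorm_smul_le_mul_eLpNorm (p := 2) (q := 2) (r := 1)
      (μ := (volume : Measure (E 3)).restrict (Metric.closedBall 0 R))
      (f := fun z => f z ^ 2) (φ := U) (hf.continuous.pow 2).aestronglyMeasurable
      hU.aestronglyMeasurable
    refine (le_trans (le_of_eq rfl) hH).trans ?_
    calc eLpNorm U 2 (volume.restrict (Metric.closedBall 0 R)) *
          eLpNorm (fun z => f z ^ 2) 2 (volume.restrict (Metric.closedBall 0 R))
        ≤ ENNReal.ofReal ξ * eLpNorm (fun z => f z ^ 2) 2 volume := by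
          refine mul_le_mul' hUξ (eLpNorm_mono_measure _ Measure.restrict_le_self)
      _ ≤ ENNReal.ofReal ξ * (k * eLpNorm (fderiv ℝ f) 2 volume) ^ 2 := by
          rw [hsq]
          gcongr
      _ = _ := by
          rw [mul_pow, hgrad, ENNReal.ofReal_mul (by positivity), ENNReal.ofReal_mul hξ, mul_assoc,
            ENNReal.ofReal_pow NNReal.zero_le_coe, ENNReal.ofReal_coe_nnreal]
  rw [← ofReal_norm, Real.norm_eq_abs] at hmain
  refine (ENNReal.ofReal_le_ofReal_iff ?_).1 hmain
  have : 0 ≤ ∫ z, ‖fderiv ℝ f z‖ ^ 2 := integral_nonneg fun _ => by positivity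
  positivity

end Perturbation

/-! ### Rigid motions -/

section RigidMotion

variable {d : ℕ}

theorem measurePreserving_rigid (a : E d) (L : E d ≃ₗᵢ[ℝ] E d) :
    MeasurePreserving (fun z => a + L z) volume volume :=
  (measurePreserving_add_left volume a).comp L.measurePreserving

theorem measurableEmbedding_rigid (a : E d) (L : E d ≃ₗᵢ[ℝ] E d) :
    MeasurableEmbedding (fun z => a + L z) :=
  (measurableEmbedding_addLeft a).comp L.toHomeomorph.measurableEmbedding

theorem integral_rigid {F : Type*} [NormedAddCommGroup F] [NormedSpace ℝ F] (a : E d)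
    (L : E d ≃ₗᵢ[ℝ] E d) (G : E d → F) : ∫ z, G (a + L z) = ∫ x, G x :=
  (measurePreserving_rigid a L).integral_comp (measurableEmbedding_rigid a L) G

theorem energy_rigid {f : E d → ℝ} (hf : IsTest f) (W : E d → ℝ) (a : E d) (L : E d ≃ₗᵢ[ℝ] E d) :
    energy (fun z => W (a + L z)) (fun z => f (a + L z)) = energy W f := by
  rw [energy, energy, integral_rigid a L (fun x => W x * f x ^ 2),
    ← integral_rigid a L (fun x => ‖fderiv ℝ f x‖ ^ 2)]
  congr 2
  ext z
  have h := fderiv_comp_affineIsometry hf.differentiable a L.toLinearIsometry z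
  have h' : fderiv ℝ (fun z => f (a + L z)) z =
    (fderiv ℝ f (a + L z)).comp (L.toLinearIsometry.toContinuousLinearMap) := h
  rw [h']
  congr 1
  exact ContinuousLinearMap.opNorm_comp_linearIsometryEquiv _ L

end RigidMotion

/-! ### Localization -/

section Localization

variable {d : ℕ}

theorem norm_add_sq_add_norm_sub_sq (p q : E d →L[ℝ] ℝ) :
    ‖p + q‖ ^ 2 + ‖p - q‖ ^ 2 = 2 * ‖p‖ ^ 2 + 2 * ‖q‖ ^ 2 := by
  simp only [norm_sq_eq_sum_apply, Finset.mul_sum, ← Finset.sum_add_distrib]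
  refine Finset.sum_congr rfl fun i _ => ?_
  simp only [add_apply, sub_apply]
  ring

theorem fderiv_bump_neg (R : ℝ) (x : E d) :
    fderiv ℝ (bump d R) (-x) = -fderiv ℝ (bump d R) x := by
  have h : bump d R = fun x => bump d R ((-1 : ℝ) • x) := by
    ext x
    rw [neg_one_smul, bump_neg]
  conv_rhs => rw [h]
  rw [fderiv_comp_smul, neg_one_smul, neg_one_smul, neg_neg]

theorem integrable_smul_add_fderiv_bump_sq {R : ℝ} (hR : 0 < R) (a : E d →L[ℝ] ℝ) (t : ℝ) :
    Integrable (fun w => ‖bump d R w • a + t • fderiv ℝ (bump d R) w‖ ^ 2) volume := by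
  have hb := isTest_bump (d := d) hR
  refine Continuous.integrable_of_hasCompactSupport ?_ ?_
  · have := hb.continuous
    have := hb.continuous_fderiv
    fun_prop
  · refine HasCompactSupport.intro (isCompact_closedBall (0 : E d) (2 * R)) fun x hx => ?_
    rw [mem_closedBall_zero_iff, not_le] at hx
    rw [bump_eq_zero hR hx.le, fderiv_bump_eq_zero hR (Or.inr hx.le)]
    simp

/-- The cutoff is even and its derivative odd, so the cross term integrates to zero; averaging with
the reflected integrand and the parallelogram law make it disappear. -/
theorem integral_smul_add_fderiv_bump_sq {R : ℝ} (hR : 0 < R) (a : E d →L[ℝ] ℝ) (t : ℝ) :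
    ∫ w, ‖bump d R w • a + t • fderiv ℝ (bump d R) w‖ ^ 2 =
      ‖a‖ ^ 2 * (∫ w, bump d R w ^ 2) + t ^ 2 * ∫ w, ‖fderiv ℝ (bump d R) w‖ ^ 2 := by
  have hb := isTest_bump (d := d) hR
  have h1 : ∫ w, ‖bump d R w • a + t • fderiv ℝ (bump d R) w‖ ^ 2 =
      ∫ w, ‖bump d R w • a - t • fderiv ℝ (bump d R) w‖ ^ 2 := by
    rw [← integral_neg_eq_self]
    simp only [bump_neg, fderiv_bump_neg, smul_neg, sub_eq_add_neg]
  have i1 := integrable_smul_add_fderiv_bump_sq hR a t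
  have i2 : Integrable (fun w => ‖bump d R w • a - t • fderiv ℝ (bump d R) w‖ ^ 2) volume := by
    simpa only [neg_smul, sub_eq_add_neg] using integrable_smul_add_fderiv_bump_sq hR a (-t)
  have h2 := integral_add i1 i2
  have h3 : ∀ w, ‖bump d R w • a + t • fderiv ℝ (bump d R) w‖ ^ 2 +
      ‖bump d R w • a - t • fderiv ℝ (bump d R) w‖ ^ 2 =
      2 * ‖a‖ ^ 2 * bump d R w ^ 2 + 2 * t ^ 2 * ‖fderiv ℝ (bump d R) w‖ ^ 2 := fun w => by
    rw [norm_add_sq_add_norm_sub_sq, norm_smul, norm_smul, mul_pow, mul_pow, Real.norm_eq_abs,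
      Real.norm_eq_abs, sq_abs, sq_abs]
    ring
  simp only [h3] at h2
  rw [integral_add (hb.integrable_sq.const_mul _) (hb.integrable_fderiv_sq.const_mul _),
    integral_const_mul, integral_const_mul, ← h1] at h2
  linarith

theorem IsTest.bump_mul {f : E d → ℝ} (hf : IsTest f) {R : ℝ} (hR : 0 < R) (y : E d) :
    IsTest (fun x => bump d R (x - y) * f x) :=
  ⟨((isTest_bump hR).smooth.comp (contDiff_id.sub contDiff_const)).mul hf.smooth,
    hf.compact.mul_left⟩

theorem fderiv_bump_mul {f : E d → ℝ} (hf : IsTest f) {R : ℝ} (hR : 0 < R) (x y : E d) :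
    fderiv ℝ (fun x => bump d R (x - y) * f x) x =
      bump d R (x - y) • fderiv ℝ f x + f x • fderiv ℝ (bump d R) (x - y) := by
  have h1 : DifferentiableAt ℝ (fun x => bump d R (x - y)) x :=
    ((isTest_bump hR).differentiable.comp (differentiable_id.sub_const y)) x
  rw [fderiv_fun_mul h1 (hf.differentiable x), fderiv_comp_sub]

/-- If the energy is nonnegative on all functions localized at the scale `R`, then it is bounded
from below by the localization error. -/
theorem energy_ge_of_localized {W f : E d → ℝ} (hWm : Measurable W) {C : ℝ} (hC : ∀ x, |W x| ≤ C)
    (hf : IsTest f) {R : ℝ} (hR : 0 < R)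
    (h : ∀ y, 0 ≤ energy W (fun x => bump d R (x - y) * f x)) :
    0 ≤ (∫ w, bump d R w ^ 2) * energy W f +
      (∫ w, ‖fderiv ℝ (bump d R) w‖ ^ 2) * ∫ x, f x ^ 2 := by
  have hb := isTest_bump (d := d) hR
  have hbc := hb.continuous
  have hb'c := hb.continuous_fderiv
  have hfc := hf.continuous
  have hf'c := hf.continuous_fderiv
  set c₀ := ∫ w, bump d R w ^ 2
  set c₁ := ∫ w, ‖fderiv ℝ (bump d R) w‖ ^ 2
  -- A continuous version of the IMS formula: the energies of the pieces `bump (· - y) f` are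
  -- integrated over all centres `y`, and Fubini exchanges `x` and `y`.
  set F : E d × E d → ℝ := fun p =>
    ‖bump d R (p.1 - p.2) • fderiv ℝ f p.1 + f p.1 • fderiv ℝ (bump d R) (p.1 - p.2)‖ ^ 2 with hF
  set K : E d × E d → ℝ := fun p => (bump d R (p.1 - p.2) * f p.1) ^ 2 with hK
  have hWtop : MemLp W ⊤ volume := memLp_top_of_bound hWm.aestronglyMeasurable C (ae_of_all _ hC)
  obtain ⟨ρ, hρ⟩ := hf.compact.isCompact.isBounded.subset_closedBall 0
  have hfz : ∀ x, ρ < ‖x‖ → f x = 0 ∧ fderiv ℝ f x = 0 := fun x hx => by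
    have hx' : x ∉ tsupport f := fun hxt => by
      have := hρ hxt
      rw [mem_closedBall_zero_iff] at this
      linarith
    exact ⟨image_eq_zero_of_notMem_tsupport hx', by
      by_contra hne
      exact hx' (support_fderiv_subset ℝ hne)⟩
  have hcomp : IsCompact (Metric.closedBall (0 : E d) ρ ×ˢ Metric.closedBall (0 : E d) (ρ + 2 * R)) :=
    (isCompact_closedBall _ _).prod (isCompact_closedBall _ _)
  have hout : ∀ p : E d × E d,
      p ∉ Metric.closedBall (0 : E d) ρ ×ˢ Metric.closedBall (0 : E d) (ρ + 2 * R) →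
      (f p.1 = 0 ∧ fderiv ℝ f p.1 = 0) ∨ 2 * R ≤ ‖p.1 - p.2‖ := fun p hp => by
    by_cases h1 : ρ < ‖p.1‖
    · exact Or.inl (hfz _ h1)
    · right
      by_contra! h2
      refine hp ⟨by simpa using h1, ?_⟩
      rw [mem_closedBall_zero_iff]
      have := norm_sub_le p.1 (p.1 - p.2)
      rw [sub_sub_cancel] at this
      linarith
  have hFi : Integrable F volume := by
    refine Continuous.integrable_of_hasCompactSupport (by fun_prop)
      (HasCompactSupport.intro hcomp fun p hp => ?_)
    rcases hout p hp with ⟨h1, h2⟩ | h1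
    · simp [hF, h1, h2]
    · simp [hF, bump_eq_zero hR h1, fderiv_bump_eq_zero hR (Or.inr h1)]
  have hKi : Integrable K volume := by
    refine Continuous.integrable_of_hasCompactSupport (by fun_prop)
      (HasCompactSupport.intro hcomp fun p hp => ?_)
    rcases hout p hp with ⟨h1, h2⟩ | h1
    · simp [hK, h1]
    · simp [hK, bump_eq_zero hR h1]
  have hWKi : Integrable (fun p => W p.1 * K p) volume :=
    hKi.bdd_mul (c := C) (hWm.comp measurable_fst).aestronglyMeasurable
      (ae_of_all _ fun p => hC _)
  have hHi := hFi.sub hWKi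
  have hy : ∀ y, ∫ x, (F (x, y) - W x * K (x, y)) =
      energy W (fun x => bump d R (x - y) * f x) := fun y => by
    have ht := hf.bump_mul hR y
    have i1 := ht.integrable_fderiv_sq
    have i2 := integrable_mul_of_memLp_top hWtop ht.integrable_sq
    rw [energy, ← integral_sub i1 i2]
    refine integral_congr_ae (ae_of_all _ fun x => ?_)
    simp only [hF, hK]
    rw [fderiv_bump_mul hf hR]
  -- For fixed `x` the integral over the centres returns `c₀` times the energy density of `f`, plus
  -- the localization error `c₁ f²`.
  have hx : ∀ x, ∫ y, (F (x, y) - W x * K (x, y)) =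
      c₀ * (‖fderiv ℝ f x‖ ^ 2 - W x * f x ^ 2) + c₁ * f x ^ 2 := fun x => by
    have e : ∀ y, F (x, y) - W x * K (x, y) = (fun w =>
        ‖bump d R w • fderiv ℝ f x + f x • fderiv ℝ (bump d R) w‖ ^ 2 -
          W x * f x ^ 2 * bump d R w ^ 2) (x - y) := fun y => by
      simp only [hF, hK]
      ring
    simp only [e]
    rw [integral_sub_left_eq_self (fun w =>
        ‖bump d R w • fderiv ℝ f x + f x • fderiv ℝ (bump d R) w‖ ^ 2 -
          W x * f x ^ 2 * bump d R w ^ 2) volume x,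
      integral_sub (integrable_smul_add_fderiv_bump_sq hR _ _) (hb.integrable_sq.const_mul _),
      integral_smul_add_fderiv_bump_sq hR, integral_const_mul]
    ring
  have h1 : ∫ p, (F p - W p.1 * K p) = ∫ y, energy W (fun x => bump d R (x - y) * f x) := by
    rw [Measure.volume_eq_prod] at hHi ⊢
    have := integral_prod_symm _ hHi
    simp only [Pi.sub_apply, hy] at this
    exact this
  have h2 : ∫ p, (F p - W p.1 * K p) =
      ∫ x, (c₀ * (‖fderiv ℝ f x‖ ^ 2 - W x * f x ^ 2) + c₁ * f x ^ 2) := by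
    rw [Measure.volume_eq_prod] at hHi ⊢
    have := integral_prod _ hHi
    simp only [Pi.sub_apply, hx] at this
    exact this
  have i1 := hf.integrable_fderiv_sq
  have i2 := integrable_mul_of_memLp_top hWtop hf.integrable_sq
  have i3 : Integrable (fun x => ‖fderiv ℝ f x‖ ^ 2 - W x * f x ^ 2) volume := i1.sub i2
  rw [h1, integral_add (i3.const_mul _) (hf.integrable_sq.const_mul _),
    integral_const_mul, integral_const_mul, integral_sub i1 i2] at h2
  rw [energy, ← h2]
  exact integral_nonneg h

/-- The localization error tends to zero. -/
theorem exists_localization_error_le (d : ℕ) {δ : ℝ} (hδ : 0 < δ) : ∃ R > 0,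
    0 < (∫ w, bump d R w ^ 2) ∧
    (∫ w, ‖fderiv ℝ (bump d R) w‖ ^ 2) ≤ δ * ∫ w, bump d R w ^ 2 := by
  have hpos : ∀ {R : ℝ}, 0 < R → 0 < ∫ w, bump d R w ^ 2 := fun {R} hR => by
    rw [integral_pos_iff_support_of_nonneg (fun _ => by positivity) (isTest_bump hR).integrable_sq]
    refine lt_of_lt_of_le (Metric.measure_ball_pos volume (0 : E d) hR) (measure_mono fun x hx => ?_)
    rw [mem_ball_zero_iff] at hx
    simp [bump_eq_one hR hx.le]
  set a := ∫ w, bump d 1 w ^ 2 with ha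
  set c := ∫ w, ‖fderiv ℝ (bump d 1) w‖ ^ 2 with hc
  have ha0 : 0 < a := hpos one_pos
  have hc0 : 0 ≤ c := integral_nonneg fun _ => by positivity
  -- The two integrals scale with a relative factor `R⁻²`, so `R² ≥ c / (δ a)` is needed; the added
  -- one keeps `R` positive.
  set R := Real.sqrt (c / (δ * a)) + 1 with hRdef
  have hR : 0 < R := by positivity
  have hR2 : c ≤ δ * a * R ^ 2 := by
    have h1 : c / (δ * a) ≤ R ^ 2 := by
      have := Real.sq_sqrt (show 0 ≤ c / (δ * a) by positivity)
      have h0 := Real.sqrt_nonneg (c / (δ * a))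
      rw [hRdef]
      nlinarith
    rw [div_le_iff₀ (by positivity)] at h1
    linarith
  refine ⟨R, hR, hpos hR, ?_⟩
  have h1 : ∀ x : E d, ‖fderiv ℝ (bump d R) x‖ ^ 2 =
      (R⁻¹) ^ 2 * (fun y => ‖fderiv ℝ (bump d 1) y‖ ^ 2) (R⁻¹ • x) := fun x => by
    rw [fderiv_bump, norm_smul, mul_pow, Real.norm_eq_abs, sq_abs]
  have h2 : ∀ x : E d, bump d R x ^ 2 = (fun y => bump d 1 y ^ 2) (R⁻¹ • x) := fun x => by
    simp [bump]
  simp only [h1, h2]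
  rw [integral_const_mul,
    Measure.integral_comp_inv_smul volume (fun y : E d => ‖fderiv ℝ (bump d 1) y‖ ^ 2) R,
    Measure.integral_comp_inv_smul volume (fun y : E d => bump d 1 y ^ 2) R, ← ha, ← hc,
    smul_eq_mul, smul_eq_mul]
  have hn : 0 < |R ^ Module.finrank ℝ (E d)| := abs_pos.2 (pow_pos hR _).ne'
  have h3 : (R⁻¹) ^ 2 * c ≤ δ * a := by
    rw [inv_pow, inv_mul_le_iff₀ (by positivity)]
    linarith
  nlinarith

end Localization

/-! ### The spectrum of the waveguide below the ground-state energy -/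

section Below

variable {Γ t N B : ℝ → E 3} {k₁ k₂ : ℝ → ℝ} {M : Set (E 2)} {V : E 2 → ℝ} {W : E 3 → ℝ} {C : ℝ}

theorem memLp_top_of_mem_Icc {d : ℕ} {W : E d → ℝ} {C : ℝ} (hm : Measurable W)
    (hC : ∀ x, W x ∈ Set.Icc 0 C) : MemLp W ⊤ volume :=
  memLp_top_of_bound hm.aestronglyMeasurable C (ae_of_all _ fun x => by
    rw [Real.norm_eq_abs, abs_of_nonneg (hC x).1]; exact (hC x).2)

theorem IsTubePotential.memLp_W (hW : IsTubePotential Γ N B M V W C) : MemLp W ⊤ volume :=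
  memLp_top_of_mem_Icc hW.measurable_W hW.W_mem

theorem IsTubePotential.memLp_V (hW : IsTubePotential Γ N B M V W C) : MemLp V ⊤ volume :=
  memLp_top_of_mem_Icc hW.measurable_V hW.V_mem

theorem IsTubePotential.memLp_proj (hW : IsTubePotential Γ N B M V W C) :
    MemLp (fun z => V (proj z)) ⊤ (volume : Measure (E 3)) :=
  memLp_top_of_mem_Icc (hW.measurable_V.comp continuous_proj.measurable) fun _ => hW.V_mem _

theorem integral_mul_sq_le_of_mem_Icc {d : ℕ} {W f : E d → ℝ} {C : ℝ} (hm : Measurable W)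
    (hC : ∀ x, W x ∈ Set.Icc 0 C) (hf : IsTest f) : ∫ x, W x * f x ^ 2 ≤ C * ∫ x, f x ^ 2 := by
  rw [← integral_const_mul]
  refine integral_mono (integrable_mul_of_memLp_top (memLp_top_of_mem_Icc hm hC) hf.integrable_sq)
    (hf.integrable_sq.const_mul C) fun x => ?_
  exact mul_le_mul_of_nonneg_right (hC x).2 (sq_nonneg _)

/-- A rigid motion brings the window to the origin, where the cylinder bound holds and the
difference of the potentials is form-small relative to the Dirichlet integral. -/
theorem IsTubePotential.exists_local_energy_ge (hW : IsTubePotential Γ N B M V W C)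
    (h : IsParallelFrame Γ t N B k₁ k₂) (hM : Bornology.IsBounded M)
    (hc : ∀ R : ℝ, ∃ T, ∀ s s', T ≤ |s - s'| → R ≤ ‖Γ s - Γ s'‖) {e : ℝ} (he0 : e ≤ 0)
    (he : ∀ f : E 2 → ℝ, IsTest f → e * ∫ u, f u ^ 2 ≤ energy V f) {R δ : ℝ} (hR : 0 < R)
    (hδ : 0 < δ) : ∃ S, ∀ s, S < |s| → ∀ f : E 3 → ℝ, IsTest f →
      (∀ x, f x ≠ 0 → ‖x - Γ s‖ ≤ R) → (e - δ) * ∫ x, f x ^ 2 ≤ energy W f := by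
  obtain ⟨K, hK0, hK⟩ := exists_integral_mul_sq_le (R := R)
  have hC0 : 0 ≤ C := (hW.W_mem 0).1.trans (hW.W_mem 0).2
  -- Chosen so that `ξ K C ≤ δ`; the added one avoids a zero denominator.
  set ξ := δ / (K * C + 1) with hξ
  have hξ0 : 0 < ξ := by positivity
  have hκ : ξ * K * C ≤ δ := by
    have h1 : ξ * (K * C + 1) = δ := by rw [hξ]; field_simp
    nlinarith
  obtain ⟨S, hS⟩ := hW.exists_eLpNorm_le h hM hc hR (ENNReal.ofReal_pos.2 hξ0).ne'
  refine ⟨S, fun s hs f hf hsupp => ?_⟩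
  set g : E 3 → ℝ := fun z => f (Γ s + h.rot s z) with hg
  have hgt : IsTest g := hf.comp_affineIsometry (Γ s) (h.rot s).toLinearIsometry
  have hgs : Function.support g ⊆ Metric.closedBall 0 R := fun z hz => by
    have := hsupp _ hz
    rw [add_sub_cancel_left, LinearIsometryEquiv.norm_map] at this
    simpa using this
  have hWsm : Measurable fun z => W (Γ s + h.rot s z) := hW.measurable_W.comp (by fun_prop)
  have hVm : Measurable fun z : E 3 => V (proj z) :=
    hW.measurable_V.comp continuous_proj.measurable
  have hWs : MemLp (fun z => W (Γ s + h.rot s z)) ⊤ volume :=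
    memLp_top_of_mem_Icc hWsm fun _ => hW.W_mem _
  rw [← energy_rigid hf W (Γ s) (h.rot s), ← integral_rigid (Γ s) (h.rot s) (fun x => f x ^ 2)]
  change (e - δ) * ∫ z, g z ^ 2 ≤ energy (fun z => W (Γ s + h.rot s z)) g
  have h1 := cylinder_energy_ge hW.memLp_V hW.memLp_proj he hgt
  have h2 := hK g hgt hgs (fun z => W (Γ s + h.rot s z) - V (proj z)) (hWsm.sub hVm) ξ hξ0.le
    (hS s hs)
  have h3 := integral_mul_sq_le_of_mem_Icc hWsm (fun _ => hW.W_mem _) hgt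
  have h4 : ∫ z, (W (Γ s + h.rot s z) - V (proj z)) * g z ^ 2 =
      (∫ z, W (Γ s + h.rot s z) * g z ^ 2) - ∫ z, V (proj z) * g z ^ 2 := by
    rw [← integral_sub (integrable_mul_of_memLp_top hWs hgt.integrable_sq)
      (integrable_mul_of_memLp_top hW.memLp_proj hgt.integrable_sq)]
    simp only [sub_mul]
  rw [h4, abs_le] at h2
  have hn : 0 ≤ ∫ z, g z ^ 2 := integral_nonneg fun _ => sq_nonneg _
  rw [energy] at h1 ⊢
  set A := ∫ z, ‖fderiv ℝ g z‖ ^ 2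
  set P := ∫ z, W (Γ s + h.rot s z) * g z ^ 2
  set n := ∫ z, g z ^ 2
  have hκ0 : 0 ≤ ξ * K := by positivity
  have h5 : ξ * K * A ≤ ξ * K * (A - P) + δ * n := by
    have := mul_le_mul_of_nonneg_left h3 hκ0
    have := mul_le_mul_of_nonneg_right hκ hn
    linarith
  -- If the energy `A - P` is nonnegative, the claim is trivial since `e ≤ 0`. Otherwise `A < P ≤ C
  -- n`, so the Dirichlet integral in the perturbation error is bounded by the mass.
  rcases le_or_gt 0 (A - P) with h6 | h6
  · have : (e - δ) * n ≤ 0 := mul_nonpos_of_nonpos_of_nonneg (by linarith) hn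
    linarith
  · have : ξ * K * (A - P) ≤ 0 := mul_nonpos_of_nonneg_of_nonpos hκ0 h6.le
    linarith [h2.2]

/-- The loss `δ` is shared equally by the localization and the local comparison with the cylinder. A
localized piece is near the origin, where the added potential on a ball compensates `W`, or misses
the tube, where the energy is nonnegative, or meets the tube far out, where the cylinder bound
applies. -/
theorem IsTubePotential.exists_energy_ge (hW : IsTubePotential Γ N B M V W C)
    (h : IsParallelFrame Γ t N B k₁ k₂) (hM : Bornology.IsBounded M)
    (hc : ∀ R : ℝ, ∃ T, ∀ s s', T ≤ |s - s'| → R ≤ ‖Γ s - Γ s'‖) {e : ℝ} (he0 : e ≤ 0)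
    (he : ∀ f : E 2 → ℝ, IsTest f → e * ∫ u, f u ^ 2 ≤ energy V f) {δ : ℝ} (hδ : 0 < δ) :
    ∃ ρ, ∀ f : E 3 → ℝ, IsTest f →
      (e - δ) * (∫ x, f x ^ 2) - C * ∫ x in Metric.ball 0 ρ, f x ^ 2 ≤ energy W f := by
  obtain ⟨R, hR, hc0, hc1⟩ := exists_localization_error_le 3 (half_pos hδ)
  obtain ⟨D, hD0, hD⟩ := hM.exists_pos_norm_le
  have hC0 : 0 ≤ C := (hW.W_mem 0).1.trans (hW.W_mem 0).2
  -- Two points of the support of a piece are less than `4R` apart, and a tube point lies within `D`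
  -- of the axis.
  obtain ⟨S, hS⟩ := hW.exists_local_energy_ge h hM hc he0 he (R := 4 * R + D) (by positivity)
    (half_pos hδ)
  have hΓc : Continuous Γ := continuous_iff_continuousAt.2 fun s => (h.deriv_curve s).continuousAt
  obtain ⟨m, hm⟩ := (isCompact_closedBall (0 : ℝ) S).exists_bound_of_continuousOn hΓc.continuousOn
  -- A piece centred at distance at least `ρ'` cannot meet the part of the tube with `|s| ≤ S`,
  -- where `‖Γ s‖ ≤ m`.
  set ρ' := 2 * R + D + m + 1 with hρ'
  set W' : E 3 → ℝ := fun x =>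
    W x + (e - δ / 2) - (Metric.ball (0 : E 3) (ρ' + 2 * R)).indicator (fun _ => C) x with hW'
  have hW'm : Measurable W' := (hW.measurable_W.add measurable_const).sub
    (measurable_const.indicator measurableSet_ball)
  have hW'C : ∀ x, |W' x| ≤ 2 * C + |e - δ / 2| := fun x => by
    have h1 : |(Metric.ball (0 : E 3) (ρ' + 2 * R)).indicator (fun _ => C) x| ≤ C := by
      by_cases hx : x ∈ Metric.ball (0 : E 3) (ρ' + 2 * R)
      · rw [Set.indicator_of_mem hx, abs_of_nonneg hC0]
      · rw [Set.indicator_of_notMem hx, abs_zero]; exact hC0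
    have h2 : |W x| ≤ C := by rw [abs_of_nonneg (hW.W_mem x).1]; exact (hW.W_mem x).2
    have := abs_sub (W x + (e - δ / 2))
      ((Metric.ball (0 : E 3) (ρ' + 2 * R)).indicator (fun _ => C) x)
    have := abs_add_le (W x) (e - δ / 2)
    simp only [hW']
    linarith
  have henergy : ∀ f : E 3 → ℝ, IsTest f → energy W' f = energy W f - (e - δ / 2) * (∫ x, f x ^ 2)
      + C * ∫ x in Metric.ball 0 (ρ' + 2 * R), f x ^ 2 := fun f hf => by
    have i1 := integrable_mul_of_memLp_top hW.memLp_W hf.integrable_sq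
    have i2 := hf.integrable_sq.const_mul (e - δ / 2)
    have i3 := (hf.integrable_sq.const_mul C).indicator
      (measurableSet_ball (x := (0 : E 3)) (ε := ρ' + 2 * R))
    have i12 : Integrable (fun x => W x * f x ^ 2 + (e - δ / 2) * f x ^ 2) volume := i1.add i2
    have e1 : ∀ x, W' x * f x ^ 2 = W x * f x ^ 2 + (e - δ / 2) * f x ^ 2 -
        (Metric.ball (0 : E 3) (ρ' + 2 * R)).indicator (fun x => C * f x ^ 2) x := fun x => by
      by_cases hx : x ∈ Metric.ball (0 : E 3) (ρ' + 2 * R)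
      · simp only [hW', Set.indicator_of_mem hx]; ring
      · simp only [hW', Set.indicator_of_notMem hx]; ring
    rw [energy, energy]
    simp only [e1]
    rw [integral_sub i12 i3, integral_add i1 i2, integral_indicator measurableSet_ball,
      integral_const_mul, integral_const_mul]
    ring
  refine ⟨ρ' + 2 * R, fun f hf => ?_⟩
  have hloc : ∀ y, 0 ≤ energy W' (fun x => bump 3 R (x - y) * f x) := fun y => by
    set φ : E 3 → ℝ := fun x => bump 3 R (x - y) * f x with hφ
    have hφt : IsTest φ := hf.bump_mul hR y
    have hφs : ∀ x, φ x ≠ 0 → ‖x - y‖ < 2 * R := fun x hx => by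
      by_contra! hcon
      exact hx (by rw [hφ]; simp only; rw [bump_eq_zero hR hcon, zero_mul])
    have hn : 0 ≤ ∫ x, φ x ^ 2 := integral_nonneg fun _ => sq_nonneg _
    have hnb : 0 ≤ C * ∫ x in Metric.ball 0 (ρ' + 2 * R), φ x ^ 2 :=
      mul_nonneg hC0 (integral_nonneg fun _ => sq_nonneg _)
    rw [henergy φ hφt]
    by_cases hy : ‖y‖ < ρ'
    · have h1 : ∫ x in Metric.ball 0 (ρ' + 2 * R), φ x ^ 2 = ∫ x, φ x ^ 2 := by
        refine setIntegral_eq_integral_of_forall_compl_eq_zero fun x hx => ?_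
        by_contra hne
        have h2 := hφs x fun h0 => hne (by rw [h0]; simp)
        refine hx ?_
        rw [mem_ball_zero_iff]
        have := norm_add_le (x - y) y
        rw [sub_add_cancel] at this
        linarith
      have h2 := energy_ge_neg hW.memLp_W (ae_of_all _ fun x => by
        rw [abs_of_nonneg (hW.W_mem x).1]; exact (hW.W_mem x).2) hφt
      rw [h1]
      have h3 : (e - δ / 2) * ∫ x, φ x ^ 2 ≤ 0 :=
        mul_nonpos_of_nonpos_of_nonneg (by linarith) hn
      linarith
    · suffices (e - δ / 2) * ∫ x, φ x ^ 2 ≤ energy W φ by linarith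
      by_cases hWφ : ∀ x, φ x ≠ 0 → W x = 0
      · have h1 : ∫ x, W x * φ x ^ 2 = 0 := by
          refine integral_eq_zero_of_ae (ae_of_all _ fun x => ?_)
          by_cases hx : φ x = 0
          · simp [hx]
          · simp [hWφ x hx]
        have h2 : 0 ≤ ∫ x, ‖fderiv ℝ φ x‖ ^ 2 := integral_nonneg fun _ => by positivity
        have h3 : (e - δ / 2) * ∫ x, φ x ^ 2 ≤ 0 :=
          mul_nonpos_of_nonpos_of_nonneg (by linarith) hn
        rw [energy, h1]
        linarith
      · push Not at hWφ
        obtain ⟨x, hx, hWx⟩ := hWφ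
        obtain ⟨z, hz, rfl⟩ : ∃ z, proj z ∈ M ∧ tube Γ N B z = x := by
          by_contra! hcon
          exact hWx (hW.off_tube x hcon)
        have h1 := hφs _ hx
        have h2 : ‖tube Γ N B z - Γ (z 0)‖ ≤ D := by
          have e1 : tube Γ N B z - Γ (z 0) = h.rot (z 0) (crossEmb (proj z)) := by
            rw [h.rot_apply]
            simp [tube, crossEmb, proj]
          rw [e1, LinearIsometryEquiv.norm_map, LinearIsometry.norm_map]
          exact hD _ hz
        have h3 : S < |z 0| := by
          by_contra! hcon
          have h4 := hm (z 0) (by simpa using hcon)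
          have h5 : ‖y‖ ≤ ‖tube Γ N B z - y‖ + ‖tube Γ N B z - Γ (z 0)‖ + ‖Γ (z 0)‖ := by
            have e1 : y = -(tube Γ N B z - y) + (tube Γ N B z - Γ (z 0)) + Γ (z 0) := by abel
            conv_lhs => rw [e1]
            refine (norm_add_le _ _).trans (add_le_add ((norm_add_le _ _).trans ?_) le_rfl)
            rw [norm_neg]
          linarith
        refine hS (z 0) h3 φ hφt fun x hx => ?_
        have h4 := hφs x hx
        have e1 : x - Γ (z 0) = (x - y) - (tube Γ N B z - y) + (tube Γ N B z - Γ (z 0)) := by abel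
        rw [e1]
        refine (norm_add_le _ _).trans ?_
        have := norm_sub_le (x - y) (tube Γ N B z - y)
        linarith
  have h1 := energy_ge_of_localized hW'm hW'C hf hR hloc
  rw [henergy f hf] at h1
  have hn : 0 ≤ ∫ x, f x ^ 2 := integral_nonneg fun _ => sq_nonneg _
  have h2 := mul_le_mul_of_nonneg_right hc1 hn
  set c₀ := ∫ w, bump 3 R w ^ 2
  have h3 : 0 ≤ c₀ * (energy W f - (e - δ / 2) * (∫ x, f x ^ 2)
      + C * (∫ x in Metric.ball 0 (ρ' + 2 * R), f x ^ 2) + δ / 2 * ∫ x, f x ^ 2) := by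
    linarith
  have h4 := nonneg_of_mul_nonneg_right h3 hc0
  linarith

theorem IsTubePotential.mem_discSpec (hW : IsTubePotential Γ N B M V W C)
    (h : IsParallelFrame Γ t N B k₁ k₂) (hM : Bornology.IsBounded M)
    (hc : ∀ R : ℝ, ∃ T, ∀ s s', T ≤ |s - s'| → R ≤ ‖Γ s - Γ s'‖) {e : ℝ} (he0 : e ≤ 0)
    (he : ∀ f : E 2 → ℝ, IsTest f → e * ∫ u, f u ^ 2 ≤ energy V f) {l : ℝ} (hl : l < e)
    (hspec : (l : ℂ) ∈ spec (schrodinger W)) : (l : ℂ) ∈ discSpec (schrodinger W) := by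
  refine mem_discSpec_of_form_ge (by norm_num) hW.memLp_W (fun δ hδ => ?_) hl hspec
  obtain ⟨ρ, hρ⟩ := hW.exists_energy_ge h hM hc he0 he hδ
  exact ⟨ρ, C, form_ge_of_energy_ge_sub hW.memLp_W measurableSet_ball hρ⟩

end Below

/-! ### The Laplacian along lines -/

section LaplacianLines

variable {d : ℕ}

theorem deriv_deriv_line {f : E d → ℂ} (hf : ContDiff ℝ ∞ f) (z v : E d) :
    deriv (deriv fun r : ℝ => f (z + r • v)) 0 = iteratedFDeriv ℝ 2 f z ![v, v] := by
  have hline : ∀ r : ℝ, HasDerivAt (fun r : ℝ => z + r • v) v r := fun r => by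
    simpa using ((hasDerivAt_id r).smul_const v).const_add z
  have hf1 : Differentiable ℝ f := hf.differentiable (by simp)
  have hf2 : Differentiable ℝ (fderiv ℝ f) :=
    (hf.fderiv_right (m := ∞) (by simp)).differentiable (by simp)
  have h1 : (deriv fun r : ℝ => f (z + r • v)) = fun r => fderiv ℝ f (z + r • v) v := by
    ext r
    exact ((hf1 _).hasFDerivAt.comp_hasDerivAt r (hline r)).deriv
  rw [h1, iteratedFDeriv_two_apply]
  have h2 := (hf2 (z + (0 : ℝ) • v)).hasFDerivAt.comp_hasDerivAt (0 : ℝ) (hline 0)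
  have h3 := ((ContinuousLinearMap.apply ℝ ℂ v).hasFDerivAt).comp_hasDerivAt (0 : ℝ) h2
  have h4 := h3.deriv
  simp only [zero_smul, add_zero] at h4
  exact h4

/-- The freedom in the orthonormal basis yields rotation invariance, and one-variable derivatives
yield the product formula on the cylinder. -/
theorem laplacian_eq_sum_line {f : E d → ℂ} (hf : ContDiff ℝ ∞ f)
    (v : OrthonormalBasis (Fin d) ℝ (E d)) (z : E d) :
    Δ f z = ∑ i, deriv (deriv fun r : ℝ => f (z + r • v i)) 0 := by
  rw [InnerProductSpace.laplacian_eq_iteratedFDeriv_orthonormalBasis f v]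
  exact Finset.sum_congr rfl fun i _ => (deriv_deriv_line hf z (v i)).symm

theorem laplacian_rigid {f : E d → ℂ} (hf : IsTest f) (a : E d) (L : E d ≃ₗᵢ[ℝ] E d) (z : E d) :
    Δ (fun z => f (a + L z)) z = Δ f (a + L z) := by
  have ht : IsTest fun z => f (a + L z) := hf.comp_affineIsometry a L.toLinearIsometry
  rw [laplacian_eq_sum_line ht.smooth (EuclideanSpace.basisFun (Fin d) ℝ),
    laplacian_eq_sum_line hf.smooth ((EuclideanSpace.basisFun (Fin d) ℝ).map L)]
  refine Finset.sum_congr rfl fun i _ => ?_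
  simp only [map_add, map_smul, add_assoc, OrthonormalBasis.map_apply]

theorem proj_add_smul_basisFun_succ (z : E 3) (r : ℝ) (i : Fin 2) :
    proj (z + r • EuclideanSpace.basisFun (Fin 3) ℝ i.succ) =
      proj z + r • EuclideanSpace.basisFun (Fin 2) ℝ i := by
  ext j
  fin_cases i <;> fin_cases j <;> simp [proj]

theorem contDiff_proj : ContDiff ℝ ∞ proj := by
  unfold proj
  rw [contDiff_euclidean]
  intro i
  fin_cases i <;> simp <;> fun_prop

theorem isTest_tensor {η : ℝ → ℂ} (hη : ContDiff ℝ ∞ η) (hηc : HasCompactSupport η) {g : E 2 → ℂ}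
    (hg : IsTest g) : IsTest fun z : E 3 => η (z 0) * g (proj z) where
  smooth := (hη.comp (by fun_prop)).mul (hg.smooth.comp contDiff_proj)
  compact := by
    obtain ⟨r₁, h₁⟩ := hηc.isCompact.isBounded.subset_closedBall 0
    obtain ⟨r₂, h₂⟩ := hg.compact.isCompact.isBounded.subset_closedBall 0
    refine HasCompactSupport.intro (isCompact_closedBall (0 : E 3) (r₁ + r₂)) fun z hz => ?_
    by_contra hne
    have h3 := h₁ (subset_tsupport _ (left_ne_zero_of_mul hne))
    have h4 := h₂ (subset_tsupport _ (right_ne_zero_of_mul hne))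
    rw [mem_closedBall_zero_iff] at h3 h4
    refine hz ?_
    rw [mem_closedBall_zero_iff]
    have h5 := norm_sq_eq_add_proj z
    rw [Real.norm_eq_abs] at h3
    refine abs_le_of_sq_le_sq' ?_ (by linarith [abs_nonneg (z 0), norm_nonneg (proj z)]) |>.2
    rw [h5, ← sq_abs (z 0)]
    nlinarith [abs_nonneg (z 0), norm_nonneg (proj z)]

theorem laplacian_tensor {η : ℝ → ℂ} (hη : ContDiff ℝ ∞ η) (hηc : HasCompactSupport η)
    {g : E 2 → ℂ} (hg : IsTest g) (z : E 3) :
    Δ (fun z : E 3 => η (z 0) * g (proj z)) z =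
      deriv (deriv η) (z 0) * g (proj z) + η (z 0) * Δ g (proj z) := by
  rw [laplacian_eq_sum_line (isTest_tensor hη hηc hg).smooth (EuclideanSpace.basisFun (Fin 3) ℝ),
    laplacian_eq_sum_line hg.smooth (EuclideanSpace.basisFun (Fin 2) ℝ), Fin.sum_univ_succ]
  congr 1
  · have e : ∀ r : ℝ, η ((z + r • EuclideanSpace.basisFun (Fin 3) ℝ 0) 0) *
        g (proj (z + r • EuclideanSpace.basisFun (Fin 3) ℝ 0)) = η (z 0 + r) * g (proj z) :=
      fun r => by
        congr 1
        · simp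
        · congr 1
          ext j
          fin_cases j <;> simp [proj]
    simp only [e]
    have h1 : (deriv fun r : ℝ => η (z 0 + r) * g (proj z)) =
        fun r => deriv η (z 0 + r) * g (proj z) := by
      ext r
      rw [deriv_mul_const_field, deriv_comp_const_add]
    rw [h1, deriv_mul_const_field, deriv_comp_const_add, add_zero]
  · rw [Finset.mul_sum]
    refine Finset.sum_congr rfl fun i _ => ?_
    have e : ∀ r : ℝ, η ((z + r • EuclideanSpace.basisFun (Fin 3) ℝ i.succ) 0) *
        g (proj (z + r • EuclideanSpace.basisFun (Fin 3) ℝ i.succ)) =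
        η (z 0) * g (proj z + r • EuclideanSpace.basisFun (Fin 2) ℝ i) := fun r => by
      rw [proj_add_smul_basisFun_succ]
      congr 2
      simp [Fin.succ_ne_zero]
    simp only [e]
    have h1 : (deriv fun r : ℝ => η (z 0) * g (proj z + r • EuclideanSpace.basisFun (Fin 2) ℝ i)) =
        fun r => η (z 0) *
          deriv (fun r : ℝ => g (proj z + r • EuclideanSpace.basisFun (Fin 2) ℝ i)) r := by
      ext r
      rw [deriv_const_mul_field]
    rw [h1, deriv_const_mul_field]

end LaplacianLines

/-! ### Approximate eigenfunctions -/

section Approximate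

theorem integrable_norm_sq_of_contDiff {u : ℝ → ℂ} (hu : ContDiff ℝ ∞ u)
    (huc : HasCompactSupport u) : Integrable (fun x => ‖u x‖ ^ 2) volume := by
  refine Continuous.integrable_of_hasCompactSupport (hu.continuous.norm.pow 2)
    (HasCompactSupport.intro huc.isCompact fun x hx => ?_)
  rw [image_eq_zero_of_notMem_tsupport hx, norm_zero, zero_pow two_ne_zero]

theorem exists_bump_line : ∃ φ : ℝ → ℂ, ContDiff ℝ ∞ φ ∧ HasCompactSupport φ ∧
    0 < ∫ x, ‖φ x‖ ^ 2 := by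
  let χ : ContDiffBump (0 : ℝ) := ⟨1, 2, one_pos, one_lt_two⟩
  have hφs : ContDiff ℝ ∞ fun x => (χ x : ℂ) := Complex.ofRealCLM.contDiff.comp χ.contDiff
  have hφc : HasCompactSupport fun x => (χ x : ℂ) :=
    χ.hasCompactSupport.comp_left (g := Complex.ofReal) rfl
  refine ⟨fun x => (χ x : ℂ), hφs, hφc, ?_⟩
  rw [integral_pos_iff_support_of_nonneg (fun _ => by positivity)
    (integrable_norm_sq_of_contDiff hφs hφc)]
  refine lt_of_lt_of_le (Metric.measure_ball_pos volume (0 : ℝ) one_pos)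
    (measure_mono fun x hx => ?_)
  have : χ x = 1 := χ.one_of_mem_closedBall (Metric.ball_subset_closedBall hx)
  simp [this]

/-- The plane wave on the line. -/
def wave (p x : ℝ) : ℂ := Complex.exp ((p * x : ℝ) * Complex.I)

theorem norm_wave (p x : ℝ) : ‖wave p x‖ = 1 := Complex.norm_exp_ofReal_mul_I _

theorem contDiff_wave (p : ℝ) : ContDiff ℝ ∞ (wave p) :=
  Complex.contDiff_exp.comp
    ((Complex.ofRealCLM.contDiff.comp (contDiff_const.mul contDiff_id)).mul contDiff_const)

theorem hasDerivAt_wave (p x : ℝ) : HasDerivAt (wave p) (p * Complex.I * wave p x) x := by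
  have h1 : HasDerivAt (fun x : ℝ => ((p * x : ℝ) : ℂ) * Complex.I) (p * Complex.I) x := by
    have := (((hasDerivAt_id x).const_mul p).ofReal_comp).mul_const Complex.I
    simpa using this
  have := h1.cexp
  rwa [mul_comm] at this

theorem hasDerivAt_comp_mul {u : ℝ → ℂ} (hu : ContDiff ℝ ∞ u) (c x : ℝ) :
    HasDerivAt (fun x => u (c * x)) (c * deriv u (c * x)) x := by
  have h1 : HasDerivAt (fun x => c * x) c x := by
    simpa using (hasDerivAt_id x).const_mul c
  have h2 := (hu.differentiable (by simp) (c * x)).hasDerivAt.scomp x h1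
  rwa [Complex.real_smul] at h2

/-- The terms in which both derivatives fall on the wave cancel with `p²`; all others carry a factor
`c`. -/
theorem deriv_deriv_modulated {φ : ℝ → ℂ} (hφ : ContDiff ℝ ∞ φ) (c p x : ℝ) :
    deriv (deriv fun x => φ (c * x) * wave p x) x + (p ^ 2 : ℝ) * (φ (c * x) * wave p x) =
      (c ^ 2 * deriv (deriv φ) (c * x) + 2 * p * Complex.I * c * deriv φ (c * x)) * wave p x := by
  have hφ' : ContDiff ℝ ∞ (deriv φ) := (contDiff_infty_iff_deriv.1 hφ).2
  have hd1 : (deriv fun x => φ (c * x) * wave p x) =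
      fun x => (c * deriv φ (c * x) + p * Complex.I * φ (c * x)) * wave p x := by
    ext x
    rw [((hasDerivAt_comp_mul hφ c x).fun_mul (hasDerivAt_wave p x)).deriv]
    ring
  rw [hd1, ((((hasDerivAt_comp_mul hφ' c x).const_mul (c : ℂ)).fun_add
    ((hasDerivAt_comp_mul hφ c x).const_mul (p * Complex.I))).fun_mul (hasDerivAt_wave p x)).deriv]
  push_cast
  linear_combination (p ^ 2 * φ (c * x) * wave p x) * Complex.I_sq

theorem norm_modulated_sq_le {a b : ℂ} {c p : ℝ} (hc : 0 ≤ c) (hc1 : c ≤ 1) :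
    ‖c ^ 2 * a + 2 * p * Complex.I * c * b‖ ^ 2 ≤
      c ^ 2 * (2 * ‖a‖ ^ 2 + 8 * p ^ 2 * ‖b‖ ^ 2) := by
  have h2 : ‖c ^ 2 * a + 2 * p * Complex.I * c * b‖ ≤ c * (‖a‖ + 2 * |p| * ‖b‖) := by
    refine (norm_add_le _ _).trans ?_
    have e1 : ‖c ^ 2 * a‖ = c * (c * ‖a‖) := by
      rw [norm_mul, norm_pow, Complex.norm_real, Real.norm_eq_abs, abs_of_nonneg hc]
      ring
    have e2 : ‖2 * p * Complex.I * c * b‖ = c * (2 * |p| * ‖b‖) := by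
      simp only [norm_mul, Complex.norm_real, Complex.norm_I, Real.norm_eq_abs, abs_of_nonneg hc,
        Complex.norm_ofNat]
      ring
    rw [e1, e2, ← mul_add]
    gcongr
    exact mul_le_of_le_one_left (norm_nonneg _) hc1
  refine (pow_le_pow_left₀ (norm_nonneg _) h2 2).trans ?_
  rw [mul_pow]
  gcongr
  have h3 : p ^ 2 = |p| ^ 2 := (sq_abs p).symm
  rw [h3]
  linarith [sq_nonneg (‖a‖ - 2 * |p| * ‖b‖)]

/-- Approximate eigenfunctions of the second derivative on the line. -/
theorem exists_approx_line (p : ℝ) {δ : ℝ} (hδ : 0 < δ) : ∃ η : ℝ → ℂ, ContDiff ℝ ∞ η ∧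
    HasCompactSupport η ∧ 0 < ∫ x, ‖η x‖ ^ 2 ∧
    ∫ x, ‖deriv (deriv η) x + (p ^ 2 : ℝ) * η x‖ ^ 2 ≤ δ ^ 2 * ∫ x, ‖η x‖ ^ 2 := by
  obtain ⟨φ, hφs, hφc, ha0⟩ := exists_bump_line
  have hφ's : ContDiff ℝ ∞ (deriv φ) := (contDiff_infty_iff_deriv.1 hφs).2
  have hφ''s : ContDiff ℝ ∞ (deriv (deriv φ)) := (contDiff_infty_iff_deriv.1 hφ's).2
  have i1 := integrable_norm_sq_of_contDiff hφ's hφc.deriv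
  have i2 := integrable_norm_sq_of_contDiff hφ''s hφc.deriv.deriv
  set a := ∫ x, ‖φ x‖ ^ 2 with ha
  set Q := 2 * (∫ x, ‖deriv (deriv φ) x‖ ^ 2) + 8 * p ^ 2 * ∫ x, ‖deriv φ x‖ ^ 2 with hQ
  have hQ0 : 0 ≤ Q := by
    have h1 : 0 ≤ ∫ x, ‖deriv (deriv φ) x‖ ^ 2 := integral_nonneg fun _ => by positivity
    have h2 : 0 ≤ ∫ x, ‖deriv φ x‖ ^ 2 := integral_nonneg fun _ => by positivity
    positivity
  -- Stretching by `c⁻¹` multiplies both sides of the claim by `c⁻¹`, but the residual gains an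
  -- additional `c²`.
  obtain ⟨c, hc0, hc1, hcQ⟩ : ∃ c : ℝ, 0 < c ∧ c ≤ 1 ∧ c ^ 2 * Q ≤ δ ^ 2 * a := by
    have h1 : Tendsto (fun c : ℝ => c ^ 2 * Q) (𝓝[>] 0) (𝓝 0) := by
      have : Tendsto (fun c : ℝ => c ^ 2 * Q) (𝓝 0) (𝓝 (0 ^ 2 * Q)) :=
        ((continuous_pow 2).mul continuous_const).tendsto 0
      rw [zero_pow two_ne_zero, zero_mul] at this
      exact this.mono_left nhdsWithin_le_nhds
    have h2 := h1.eventually_le_const (show 0 < δ ^ 2 * a by positivity)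
    obtain ⟨c, hc, hc'⟩ := (h2.and (Ioc_mem_nhdsGT one_pos)).exists
    exact ⟨c, hc'.1, hc'.2, hc⟩
  have hηn : ∀ x, ‖φ (c * x) * wave p x‖ ^ 2 = (fun y => ‖φ y‖ ^ 2) (c * x) := fun x => by
    simp [norm_wave]
  have hηint : ∫ x, ‖φ (c * x) * wave p x‖ ^ 2 = c⁻¹ * a := by
    simp only [hηn]
    rw [Measure.integral_comp_mul_left (fun y => ‖φ y‖ ^ 2), abs_of_pos (inv_pos.2 hc0),
      smul_eq_mul]
  refine ⟨fun x => φ (c * x) * wave p x, (hφs.comp (by fun_prop)).mul (contDiff_wave p),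
    HasCompactSupport.mul_right (hφc.comp_homeomorph (Homeomorph.mulLeft₀ c hc0.ne')), ?_, ?_⟩
  · rw [hηint]
    positivity
  · rw [hηint]
    have h1 : ∀ x, ‖deriv (deriv fun x => φ (c * x) * wave p x) x +
        (p ^ 2 : ℝ) * (φ (c * x) * wave p x)‖ ^ 2 ≤ (fun y =>
        c ^ 2 * (2 * ‖deriv (deriv φ) y‖ ^ 2 + 8 * p ^ 2 * ‖deriv φ y‖ ^ 2)) (c * x) :=
      fun x => by
        rw [deriv_deriv_modulated hφs, norm_mul, norm_wave, mul_one]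
        exact norm_modulated_sq_le hc0.le hc1
    have i3 : Integrable (fun y => c ^ 2 * (2 * ‖deriv (deriv φ) y‖ ^ 2 +
        8 * p ^ 2 * ‖deriv φ y‖ ^ 2)) volume :=
      ((i2.const_mul 2).add (i1.const_mul _)).const_mul _
    have h2 := integral_mono_of_nonneg (ae_of_all _ fun x => by positivity)
      (i3.comp_mul_left' hc0.ne') (ae_of_all _ h1)
    refine h2.trans ?_
    rw [Measure.integral_comp_mul_left (fun y => c ^ 2 * (2 * ‖deriv (deriv φ) y‖ ^ 2 +
        8 * p ^ 2 * ‖deriv φ y‖ ^ 2)), integral_const_mul,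
      integral_add (i2.const_mul 2) (i1.const_mul _), integral_const_mul, integral_const_mul, ← hQ,
      abs_of_pos (inv_pos.2 hc0), smul_eq_mul]
    calc c⁻¹ * (c ^ 2 * Q) ≤ c⁻¹ * (δ ^ 2 * a) := by gcongr
      _ = δ ^ 2 * (c⁻¹ * a) := by ring

end Approximate

/-! ### The spectrum of the waveguide above the ground-state energy -/

section Above

variable {d : ℕ}

theorem coeFn_schrodinger_sub {W : E d → ℝ} (hW : MemLp W ⊤ volume) {u : E d → ℂ} (hu : IsTest u)
    (l : ℝ) : (schrodinger W (ofSobolev hW hu.toDomain) - (l : ℂ) • (hu.toDomain : L2 d) : L2 d)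
      =ᵐ[volume] fun x => -Δ u x - W x * u x - l * u x := by
  rw [schrodinger_apply hW, toSobolev_ofSobolev, coe_ofSobolev]
  filter_upwards [Lp.coeFn_sub (-laplacianL2 d hu.toDomain - mulFun hW (hu.toDomain : L2 d))
      ((l : ℂ) • (hu.toDomain : L2 d)),
    Lp.coeFn_sub (-laplacianL2 d hu.toDomain) (mulFun hW (hu.toDomain : L2 d)),
    Lp.coeFn_neg (laplacianL2 d hu.toDomain), Lp.coeFn_smul (l : ℂ) (hu.toDomain : L2 d),
    coeFn_mulFun hW (hu.toDomain : L2 d), hu.coeFn_toDomain, hu.coeFn_laplacian]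
    with x h1 h2 h3 h4 h5 h6 h7
  rw [h1, Pi.sub_apply, h2, Pi.sub_apply, h3, Pi.neg_apply, h4, Pi.smul_apply, h5, h6, h7,
    smul_eq_mul]

theorem norm_schrodinger_sub_sq {W : E d → ℝ} (hW : MemLp W ⊤ volume) {u : E d → ℂ}
    (hu : IsTest u) (l : ℝ) :
    ‖schrodinger W (ofSobolev hW hu.toDomain) - (l : ℂ) • (hu.toDomain : L2 d)‖ ^ 2 =
      ∫ x, ‖-Δ u x - W x * u x - l * u x‖ ^ 2 := by
  rw [norm_sq_eq_integral]
  refine integral_congr_ae ?_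
  filter_upwards [coeFn_schrodinger_sub hW hu l] with x hx
  rw [hx]

theorem integrable_schrodinger_sub_sq {W : E d → ℝ} (hW : MemLp W ⊤ volume) {u : E d → ℂ}
    (hu : IsTest u) (l : ℝ) :
    Integrable (fun x => ‖-Δ u x - W x * u x - l * u x‖ ^ 2) volume := by
  have h := (Lp.memLp (schrodinger W (ofSobolev hW hu.toDomain) - (l : ℂ) •
    (hu.toDomain : L2 d) : L2 d)).integrable_norm_pow (by norm_num)
  refine h.congr ?_
  filter_upwards [coeFn_schrodinger_sub hW hu l] with x hx
  rw [hx]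

theorem IsTest.norm_toDomain_sq_eq {u : E d → ℂ} (hu : IsTest u) :
    ‖(hu.toDomain : L2 d)‖ ^ 2 = ∫ x, ‖u x‖ ^ 2 := by
  rw [norm_sq_eq_integral]
  refine integral_congr_ae ?_
  filter_upwards [hu.coeFn_toDomain] with x hx
  rw [hx]

theorem IsTest.integrable_norm_sq {u : E d → ℂ} (hu : IsTest u) :
    Integrable (fun x => ‖u x‖ ^ 2) volume := by
  refine Continuous.integrable_of_hasCompactSupport (hu.continuous.norm.pow 2)
    (HasCompactSupport.intro hu.compact.isCompact fun x hx => ?_)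
  rw [image_eq_zero_of_notMem_tsupport hx, norm_zero, zero_pow two_ne_zero]

/-- Approximate eigenfunctions can be chosen to be test functions. -/
theorem exists_approx_test {V : E d → ℝ} (hV : MemLp V ⊤ volume) {l : ℝ}
    (hl : (l : ℂ) ∈ spec (schrodinger V)) {δ : ℝ} (hδ : 0 < δ) : ∃ g : E d → ℂ, IsTest g ∧
      0 < ∫ x, ‖g x‖ ^ 2 ∧
      ∫ x, ‖-Δ g x - V x * g x - l * g x‖ ^ 2 ≤ δ ^ 2 * ∫ x, ‖g x‖ ^ 2 := by
  obtain ⟨C, hC0, hC⟩ := exists_bound_of_memLp_top hV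
  obtain ⟨ψ, hψ1, hψ2⟩ := (isMaxSymmetric_schrodinger hV).exists_approx hl
    (show 0 < δ / 4 by positivity)
  -- The first bound keeps the norm of the approximant at least `1 / 2`; by the second its residual
  -- is at most `δ/4 + δ/4`, hence at most `δ` times that norm.
  set ε := min (1 / 2) (δ / (4 * (1 + C + |l|))) with hε
  have hε0 : 0 < ε := lt_min (by norm_num) (by positivity)
  have hε1 : ε ≤ 1 / 2 := min_le_left _ _
  have hε2 : ε * (1 + C + |l|) ≤ δ / 4 := by
    have : ε ≤ δ / (4 * (1 + C + |l|)) := min_le_right _ _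
    calc ε * (1 + C + |l|) ≤ δ / (4 * (1 + C + |l|)) * (1 + C + |l|) := by gcongr
      _ = δ / 4 := by field_simp
  obtain ⟨g, hg, h1, h2⟩ := exists_test_near (toSobolev hV ψ) hε0
  rw [← hg.laplacian_toDomain] at h2
  change ‖(ψ : L2 d) - (hg.toDomain : L2 d)‖ < ε at h1
  set φ : L2 d := (hg.toDomain : L2 d) with hφ
  have hφn : 1 / 2 ≤ ‖φ‖ := by
    have := norm_sub_norm_le (ψ : L2 d) φ
    linarith
  have hres : ‖schrodinger V (ofSobolev hV hg.toDomain) - (l : ℂ) • φ‖ ≤ δ * ‖φ‖ := by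
    have e : schrodinger V (ofSobolev hV hg.toDomain) - (l : ℂ) • φ =
        (schrodinger V ψ - (l : ℂ) • (ψ : L2 d)) +
        (laplacianL2 d (toSobolev hV ψ) - laplacianL2 d hg.toDomain) +
        mulFun hV ((ψ : L2 d) - φ) + (l : ℂ) • ((ψ : L2 d) - φ) := by
      rw [mulFun_sub, schrodinger_apply hV, schrodinger_apply hV, toSobolev_ofSobolev,
        coe_ofSobolev, smul_sub, ← hφ]
      abel
    rw [e]
    have h3 := norm_mulFun_le hV hC ((ψ : L2 d) - φ)
    have h4 : ‖(l : ℂ) • ((ψ : L2 d) - φ)‖ ≤ |l| * ε := by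
      rw [norm_smul, Complex.norm_real, Real.norm_eq_abs]
      gcongr
    have h5 : C * ‖(ψ : L2 d) - φ‖ ≤ C * ε := by gcongr
    refine (norm_add_le _ _).trans ?_
    refine (add_le_add ((norm_add_le _ _).trans (add_le_add (norm_add_le _ _) le_rfl)) le_rfl).trans
      ?_
    nlinarith
  refine ⟨g, hg, ?_, ?_⟩
  · rw [← hg.norm_toDomain_sq_eq, ← hφ]
    positivity
  · rw [← hg.norm_toDomain_sq_eq, ← norm_schrodinger_sub_sq hV hg, ← mul_pow, ← hφ]
    gcongr

theorem integrable_split {a : ℝ → ℝ} {b : E 2 → ℝ} (ha : Integrable a volume)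
    (hb : Integrable b volume) : Integrable (fun z : E 3 => a (z 0) * b (proj z)) volume := by
  have h := measurePreserving_splitEquiv.integrable_comp_of_integrable (ha.mul_prod hb)
  refine h.congr (ae_of_all _ fun z => ?_)
  simp only [Function.comp_apply, splitEquiv_apply]

theorem integral_split (a : ℝ → ℝ) (b : E 2 → ℝ) :
    ∫ z : E 3, a (z 0) * b (proj z) = (∫ x, a x) * ∫ u, b u := by
  rw [← integral_prod_mul, ← Measure.volume_eq_prod, ← measurePreserving_splitEquiv.integral_comp']
  simp only [splitEquiv_apply]

theorem setIntegral_sq_le_of_eLpNorm_le {U : E d → ℝ} (hU : Measurable U) {B : Set (E d)} {ξ : ℝ}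
    (hξ : 0 ≤ ξ) (h : eLpNorm U 2 (volume.restrict B) ≤ ENNReal.ofReal ξ) :
    ∫ x in B, U x ^ 2 ≤ ξ ^ 2 := by
  rw [integral_eq_lintegral_of_nonneg_ae (ae_of_all _ fun _ => sq_nonneg _)
    (hU.pow_const 2).aestronglyMeasurable]
  refine ENNReal.toReal_le_of_le_ofReal (sq_nonneg ξ) ?_
  have h1 := eLpNorm_nnreal_pow_eq_lintegral (p := 2) (μ := (volume : Measure (E d)).restrict B)
    (f := U) (by norm_num)
  simp only [NNReal.coe_ofNat, ENNReal.rpow_two, ENNReal.coe_ofNat] at h1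
  calc ∫⁻ x in B, ENNReal.ofReal (U x ^ 2) = ∫⁻ x in B, ‖U x‖ₑ ^ 2 := by
        refine lintegral_congr fun x => ?_
        rw [← ofReal_norm, ← ENNReal.ofReal_pow (norm_nonneg _), Real.norm_eq_abs, sq_abs]
    _ = eLpNorm U 2 (volume.restrict B) ^ 2 := h1.symm
    _ ≤ ENNReal.ofReal ξ ^ 2 := by gcongr
    _ = ENNReal.ofReal (ξ ^ 2) := (ENNReal.ofReal_pow hξ 2).symm

theorem norm_add_add_sq_le (x y w : ℂ) :
    ‖x + y + w‖ ^ 2 ≤ 4 * ‖x‖ ^ 2 + 4 * ‖y‖ ^ 2 + 2 * ‖w‖ ^ 2 := by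
  have h := (norm_add_le (x + y) w).trans (add_le_add (norm_add_le x y) le_rfl)
  refine (pow_le_pow_left₀ (norm_nonneg _) h 2).trans ?_
  linarith [sq_nonneg (‖x‖ - ‖y‖), sq_nonneg (‖x‖ + ‖y‖ - ‖w‖)]

variable {Γ t N B : ℝ → E 3} {k₁ k₂ : ℝ → ℝ} {M : Set (E 2)} {V : E 2 → ℝ} {W : E 3 → ℝ} {C : ℝ}

/-- The product of an approximate eigenfunction on the line and one in the cross section is placed
in the rigid frame at a distant point of the curve. It is fixed before that point is chosen, so its
support and supremum are constants and the `L²` error of the potential can be made as small as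
needed. -/
theorem IsTubePotential.mem_spec_add_sq (hW : IsTubePotential Γ N B M V W C)
    (h : IsParallelFrame Γ t N B k₁ k₂) (hM : Bornology.IsBounded M)
    (hc : ∀ R : ℝ, ∃ T, ∀ s s', T ≤ |s - s'| → R ≤ ‖Γ s - Γ s'‖) {e : ℝ}
    (he : (e : ℂ) ∈ spec (schrodinger V)) (p : ℝ) :
    ((e + p ^ 2 : ℝ) : ℂ) ∈ spec (schrodinger W) := by
  refine mem_spec_of_approx fun δ hδ => ?_
  have hδ₁ : 0 < δ / 4 := by positivity
  obtain ⟨g, hg, hg0, hgδ⟩ := exists_approx_test hW.memLp_V he hδ₁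
  obtain ⟨η, hηs, hηc, hη0, hηδ⟩ := exists_approx_line p hδ₁
  set f : E 3 → ℂ := fun z => η (z 0) * g (proj z) with hf
  have hft : IsTest f := isTest_tensor hηs hηc hg
  set T := ∫ z, ‖f z‖ ^ 2 with hT
  have hTeq : T = (∫ x, ‖η x‖ ^ 2) * ∫ u, ‖g u‖ ^ 2 := by
    rw [← integral_split, hT]
    refine integral_congr_ae (ae_of_all _ fun z => ?_)
    simp only [hf, norm_mul, mul_pow]
  have hT0 : 0 < T := by rw [hTeq]; positivity
  obtain ⟨m, hm⟩ := hft.compact.exists_bound_of_continuous hft.continuous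
  have hm0 : 0 ≤ m := (norm_nonneg _).trans (hm 0)
  obtain ⟨R₀, hR₀⟩ := hft.compact.isCompact.isBounded.subset_closedBall 0
  set R := max R₀ 1 with hR
  have hR0 : 0 < R := lt_max_of_lt_right one_pos
  have hsupp : ∀ z ∉ Metric.closedBall (0 : E 3) R, f z = 0 := fun z hz =>
    image_eq_zero_of_notMem_tsupport fun hzt =>
      hz (Metric.closedBall_subset_closedBall (le_max_left _ _) (hR₀ hzt))
  -- With `|f| ≤ m`, the potential error satisfies `∫ U² |f|² ≤ m² ξ²`.
  obtain ⟨ξ, hξ0, hξ⟩ : ∃ ξ : ℝ, 0 < ξ ∧ m ^ 2 * ξ ^ 2 ≤ (δ / 4) ^ 2 * T := by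
    have h1 : Tendsto (fun c : ℝ => m ^ 2 * c ^ 2) (𝓝[>] 0) (𝓝 0) := by
      have : Tendsto (fun c : ℝ => m ^ 2 * c ^ 2) (𝓝 0) (𝓝 (m ^ 2 * 0 ^ 2)) :=
        (continuous_const.mul (continuous_pow 2)).tendsto 0
      rw [zero_pow two_ne_zero, mul_zero] at this
      exact this.mono_left nhdsWithin_le_nhds
    have h2 := h1.eventually_le_const (show 0 < (δ / 4) ^ 2 * T by positivity)
    obtain ⟨c, hc, hc'⟩ := (h2.and self_mem_nhdsWithin).exists
    exact ⟨c, hc', hc⟩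
  obtain ⟨S, hS⟩ := hW.exists_eLpNorm_le h hM hc hR0 (ENNReal.ofReal_pos.2 hξ0).ne'
  set s := |S| + 1 with hs
  have hsS : S < |s| := by
    rw [hs, abs_of_nonneg (by positivity)]
    linarith [le_abs_self S]
  set U : E 3 → ℝ := fun z => W (Γ s + h.rot s z) - V (proj z) with hU
  have hUm : Measurable U := (hW.measurable_W.comp (by fun_prop)).sub
    (hW.measurable_V.comp continuous_proj.measurable)
  have hUC : ∀ z, |U z| ≤ C := fun z => by
    have h1 := hW.W_mem (Γ s + h.rot s z)
    have h2 := hW.V_mem (proj z)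
    rw [abs_le]
    constructor <;> linarith [h1.1, h1.2, h2.1, h2.2]
  set ψ : E 3 → ℂ := fun x => f (-(h.rot s).symm (Γ s) + (h.rot s).symm x) with hψ
  have hψt : IsTest ψ := hft.comp_affineIsometry _ (h.rot s).symm.toLinearIsometry
  have hback : ∀ z, -(h.rot s).symm (Γ s) + (h.rot s).symm (Γ s + h.rot s z) = z := fun z => by
    rw [map_add, LinearIsometryEquiv.symm_apply_apply]
    abel
  have hψf : ∀ z, ψ (Γ s + h.rot s z) = f z := fun z => by
    simp only [hψ, hback]
  have hψΔ : ∀ z, Δ ψ (Γ s + h.rot s z) = Δ f z := fun z => by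
    rw [hψ, laplacian_rigid hft, hback]
  have hψT : ∫ x, ‖ψ x‖ ^ 2 = T := by
    rw [← integral_rigid (Γ s) (h.rot s)]
    simp only [hψf, hT]
  set A₁ : E 3 → ℝ := fun z =>
    ‖deriv (deriv η) (z 0) + (p ^ 2 : ℝ) * η (z 0)‖ ^ 2 * ‖g (proj z)‖ ^ 2 with hA₁
  set A₂ : E 3 → ℝ := fun z => ‖η (z 0)‖ ^ 2 *
    ‖-Δ g (proj z) - V (proj z) * g (proj z) - e * g (proj z)‖ ^ 2 with hA₂
  set A₃ : E 3 → ℝ := fun z => U z ^ 2 * ‖f z‖ ^ 2 with hA₃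
  have hη'' : ContDiff ℝ ∞ (deriv (deriv η)) :=
    (contDiff_infty_iff_deriv.1 (contDiff_infty_iff_deriv.1 hηs).2).2
  have i₁ : Integrable A₁ volume := by
    refine integrable_split (a := fun x => ‖deriv (deriv η) x + (p ^ 2 : ℝ) * η x‖ ^ 2)
      (b := fun u => ‖g u‖ ^ 2) ?_ hg.integrable_norm_sq
    exact integrable_norm_sq_of_contDiff (u := fun x => deriv (deriv η) x + (p ^ 2 : ℝ) * η x)
      (hη''.add (contDiff_const.mul hηs)) (hηc.deriv.deriv.add hηc.mul_left)
  have i₂ : Integrable A₂ volume :=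
    integrable_split (a := fun x => ‖η x‖ ^ 2)
      (b := fun u => ‖-Δ g u - V u * g u - e * g u‖ ^ 2)
      (integrable_norm_sq_of_contDiff hηs hηc) (integrable_schrodinger_sub_sq hW.memLp_V hg e)
  have i₃ : Integrable A₃ volume := by
    refine hft.integrable_norm_sq.bdd_mul (c := C ^ 2) (hUm.pow_const 2).aestronglyMeasurable
      (ae_of_all _ fun z => ?_)
    rw [norm_pow, Real.norm_eq_abs]
    exact pow_le_pow_left₀ (abs_nonneg _) (hUC z) 2
  have b₁ : ∫ z, A₁ z ≤ (δ / 4) ^ 2 * T := by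
    have e1 := integral_split (fun x => ‖deriv (deriv η) x + (p ^ 2 : ℝ) * η x‖ ^ 2)
      (fun u => ‖g u‖ ^ 2)
    rw [hA₁, e1, hTeq, ← mul_assoc]
    gcongr
  have b₂ : ∫ z, A₂ z ≤ (δ / 4) ^ 2 * T := by
    have e1 := integral_split (fun x => ‖η x‖ ^ 2)
      (fun u => ‖-Δ g u - V u * g u - e * g u‖ ^ 2)
    rw [hA₂, e1, hTeq, mul_left_comm]
    gcongr
  have b₃ : ∫ z, A₃ z ≤ (δ / 4) ^ 2 * T := by
    have e1 : ∫ z, A₃ z = ∫ z in Metric.closedBall 0 R, A₃ z := by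
      refine (setIntegral_eq_integral_of_forall_compl_eq_zero fun z hz => ?_).symm
      simp only [hA₃, hsupp z hz, norm_zero, zero_pow two_ne_zero, mul_zero]
    have hfin : Integrable (fun z => m ^ 2 * U z ^ 2)
        (volume.restrict (Metric.closedBall (0 : E 3) R)) := by
      have : IsFiniteMeasure ((volume : Measure (E 3)).restrict (Metric.closedBall 0 R)) :=
        ⟨by rw [Measure.restrict_apply_univ]; exact measure_closedBall_lt_top⟩
      refine Integrable.of_bound (hUm.pow_const 2 |>.const_mul _).aestronglyMeasurable
        (m ^ 2 * C ^ 2) (ae_of_all _ fun z => ?_)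
      rw [norm_mul, norm_pow, norm_pow, Real.norm_eq_abs, Real.norm_eq_abs, abs_of_nonneg hm0]
      have := pow_le_pow_left₀ (abs_nonneg _) (hUC z) 2
      gcongr
    rw [e1]
    refine le_trans ?_ hξ
    refine le_trans (integral_mono i₃.integrableOn hfin fun z => ?_) ?_
    · simp only [hA₃]
      rw [mul_comm]
      have := pow_le_pow_left₀ (norm_nonneg _) (hm z) 2
      gcongr
    · rw [integral_const_mul]
      gcongr
      exact setIntegral_sq_le_of_eLpNorm_le hUm hξ0.le (hS s hsS)
  have hpt : ∀ z, ‖-Δ ψ (Γ s + h.rot s z) - W (Γ s + h.rot s z) * ψ (Γ s + h.rot s z) -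
      (e + p ^ 2 : ℝ) * ψ (Γ s + h.rot s z)‖ ^ 2 ≤ 4 * A₁ z + 4 * A₂ z + 2 * A₃ z := fun z => by
    rw [hψΔ, hψf, hf, laplacian_tensor hηs hηc hg]
    have e1 : -(deriv (deriv η) (z 0) * g (proj z) + η (z 0) * Δ g (proj z)) -
        W (Γ s + h.rot s z) * (η (z 0) * g (proj z)) -
        (e + p ^ 2 : ℝ) * (η (z 0) * g (proj z)) =
        -((deriv (deriv η) (z 0) + (p ^ 2 : ℝ) * η (z 0)) * g (proj z)) +
        η (z 0) * (-Δ g (proj z) - V (proj z) * g (proj z) - e * g (proj z)) +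
        -((U z : ℂ) * f z) := by
      simp only [hU, hf]
      push_cast
      ring
    rw [e1]
    refine (norm_add_add_sq_le _ _ _).trans (le_of_eq ?_)
    rw [norm_neg, norm_neg, norm_mul, norm_mul, norm_mul, Complex.norm_real, Real.norm_eq_abs,
      mul_pow, mul_pow, mul_pow, sq_abs]
  -- The three residuals, from the line, the cross section and the potential, add up to at most `(4
  -- + 4 + 2)(δ/4)² T`, which is below `δ² T`.
  have htotal : ∫ x, ‖-Δ ψ x - W x * ψ x - (e + p ^ 2 : ℝ) * ψ x‖ ^ 2 ≤ δ ^ 2 * T := by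
    rw [← integral_rigid (Γ s) (h.rot s)]
    have i12 : Integrable (fun z => 4 * A₁ z + 4 * A₂ z) volume :=
      (i₁.const_mul 4).add (i₂.const_mul 4)
    refine (integral_mono_of_nonneg (ae_of_all _ fun z => by positivity)
      (i12.add (i₃.const_mul 2)) (ae_of_all _ hpt)).trans ?_
    simp only [Pi.add_apply]
    rw [integral_add i12 (i₃.const_mul 2), integral_add (i₁.const_mul 4) (i₂.const_mul 4),
      integral_const_mul, integral_const_mul, integral_const_mul]
    have : 0 ≤ δ ^ 2 * T := by positivity
    linarith
  have hnorm := hψt.norm_toDomain_sq_eq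
  rw [hψT] at hnorm
  refine ⟨ofSobolev hW.memLp_W hψt.toDomain, ?_, ?_⟩
  · rw [coe_ofSobolev]
    refine le_of_sq_le_sq ?_ (by positivity)
    rw [norm_schrodinger_sub_sq, mul_pow, hnorm]
    exact htotal
  · rw [coe_ofSobolev]
    intro h0
    rw [h0, norm_zero, zero_pow two_ne_zero] at hnorm
    exact hT0.ne hnorm

/-- The spectrum is real and discrete below `e`, and it contains every point of the half-line, none
of which is isolated. -/
theorem IsTubePotential.essSpec_eq (hW : IsTubePotential Γ N B M V W C)
    (h : IsParallelFrame Γ t N B k₁ k₂) (hM : Bornology.IsBounded M)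
    (hc : ∀ R : ℝ, ∃ T, ∀ s s', T ≤ |s - s'| → R ≤ ‖Γ s - Γ s'‖) {e : ℝ} (he0 : e ≤ 0)
    (he : ∀ f : E 2 → ℝ, IsTest f → e * ∫ u, f u ^ 2 ≤ energy V f)
    (hes : (e : ℂ) ∈ spec (schrodinger V)) :
    essSpec (schrodinger W) = (fun l : ℝ => (l : ℂ)) '' Set.Ici e := by
  have hmem : ∀ l : ℝ, e ≤ l → (l : ℂ) ∈ spec (schrodinger W) := fun l hl => by
    have := hW.mem_spec_add_sq h hM hc hes (Real.sqrt (l - e))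
    rwa [Real.sq_sqrt (sub_nonneg.2 hl), add_sub_cancel] at this
  ext z
  constructor
  · rintro ⟨hz, hzd⟩
    have him := (isMaxSymmetric_schrodinger hW.memLp_W).im_eq_zero_of_mem_spec hz
    obtain ⟨l, rfl⟩ : ∃ l : ℝ, (l : ℂ) = z := ⟨z.re, Complex.ext rfl (by simp [him])⟩
    refine ⟨l, ?_, rfl⟩
    by_contra hl
    exact hzd (hW.mem_discSpec h hM hc he0 he (not_le.1 hl) hz)
  · rintro ⟨l, hl, rfl⟩
    refine ⟨hmem l hl, ?_⟩
    rintro ⟨-, ⟨ε, hε, hiso⟩, -⟩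
    -- Moving to the right stays in the half-line, so this works at the endpoint `e` as well.
    have h1 : ((l + ε / 2 : ℝ) : ℂ) ∈ spec (schrodinger W) ∩ Metric.ball (l : ℂ) ε := by
      refine ⟨hmem _ (by have : e ≤ l := hl; linarith), ?_⟩
      rw [Metric.mem_ball, Complex.dist_of_im_eq (by simp), Complex.ofReal_re, Complex.ofReal_re,
        Real.dist_eq, add_sub_cancel_left, abs_of_pos (half_pos hε)]
      linarith
    have h2 := hiso h1
    rw [Set.mem_singleton_iff, Complex.ofReal_inj] at h2
    linarith

theorem exists_le_norm_sub_of_tendsto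
    (hc : Tendsto (fun p : ℝ × ℝ => ‖Γ p.1 - Γ p.2‖)
      (comap (fun p : ℝ × ℝ => |p.1 - p.2|) atTop) atTop) (R : ℝ) :
    ∃ T, ∀ s s', T ≤ |s - s'| → R ≤ ‖Γ s - Γ s'‖ := by
  have h := hc.eventually_ge_atTop R
  rw [eventually_comap] at h
  obtain ⟨T, hT⟩ := eventually_atTop.1 h
  exact ⟨T, fun s s' hs => hT _ hs (s, s') rfl⟩

theorem groundEnergy_mul_le_energy {V : E 2 → ℝ} (hV : MemLp V ⊤ volume)
    (hform : ∀ ψ : (schrodinger V).domain,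
      groundEnergy V * ‖(ψ : L2 2)‖ ^ 2 ≤ form (schrodinger V) ψ) {f : E 2 → ℝ} (hf : IsTest f) :
    groundEnergy V * ∫ u, f u ^ 2 ≤ energy V f := by
  have h := hform (ofSobolev hV hf.ofReal.toDomain)
  rw [form_ofReal hV hf, coe_ofSobolev, hf.ofReal.norm_toDomain_sq_eq] at h
  simpa using h

theorem energy_congr {V V' f : E d → ℝ} (h : V =ᵐ[volume] V') : energy V f = energy V' f := by
  rw [energy, energy]
  congr 1
  refine integral_congr_ae ?_
  filter_upwards [h] with x hx
  rw [hx]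

end Above

end SoftWaveguide

end

/-! ### The proposition -/

open SoftWaveguide in
theorem proposition3p1
    (Γ n b : ℝ → E 3) (γ τ α : ℝ → ℝ) (Z : Set ℝ) (M : Set (E 2)) (V : E 2 → ℝ)
    -- an arc-length parametrized curve without self-intersections
    (hΓ_inj : Function.Injective Γ)
    (hΓ_arc : ∀ s, ‖deriv Γ s‖ = 1)
    -- Frenet triads, joined at the points of the closed countable set `Z` (e.g. `Z = ∅`)
    (hZ : IsClosed Z) (hZc : Z.Countable)
    (hframe : IsFrenetFrame Γ n b γ τ Z)
    (hglue₁ : Continuous (rotatedNormal n b α))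
    (hglue₂ : Continuous (rotatedBinormal n b α))
    -- the cross section
    (hM_open : IsOpen M) (hM_bdd : Bornology.IsBounded M) (hM_zero : (0 : E 2) ∈ M)
    -- (a)
    (ha : ContDiff ℝ 2 Γ)
    -- (b)
    (hb : AsymptoticallyStraight Γ γ τ Z)
    -- (c)
    (hc : Tendsto (fun p : ℝ × ℝ => ‖Γ p.1 - Γ p.2‖)
      (comap (fun p : ℝ × ℝ => |p.1 - p.2|) atTop) atTop)
    -- (d)
    (hd : Set.InjOn (tubeMap Γ n b α) {p | p.2 ∈ M})
    -- (e)
    (he : ∀ s, s ∉ Z → HasDerivAt α (τ s) s)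
    -- (f)
    (hV_mem : MemLp V ⊤ volume) (hV_nonneg : 0 ≤ᵐ[volume] V) (hV_ne : ¬ V =ᵐ[volume] 0)
    (hV_supp : ∀ᵐ u, u ∉ M → V u = 0) :
    groundEnergy V < 0 ∧
    IsLeast {l : ℝ | (l : ℂ) ∈ discSpec (schrodinger V)} (groundEnergy V) ∧
    IsLeast {l : ℝ | (l : ℂ) ∈ spec (schrodinger V)} (groundEnergy V) ∧
    essSpec (schrodinger (tubePotential Γ n b α M V)) =
      (fun l : ℝ => (l : ℂ)) '' Set.Ici (groundEnergy V) := by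
  obtain ⟨hneg, hdisc, hspec, hform⟩ :=
    groundEnergy_spec hM_bdd hV_mem hV_nonneg hV_ne hV_supp
  refine ⟨hneg, hdisc, hspec, ?_⟩
  obtain ⟨k₁, k₂, hfr⟩ := exists_isParallelFrame hZc hframe hglue₁ hglue₂ ha hb he
  obtain ⟨V', C, hVV', hWW', hW⟩ :=
    exists_isTubePotential hfr hM_open hd hV_mem hV_nonneg hV_supp
  -- Both operators are unchanged on passing to the regular representative of the profile.
  rw [schrodinger_congr hWW']
  refine hW.essSpec_eq hfr hM_bdd (exists_le_norm_sub_of_tendsto hc) hneg.le (fun f hf => ?_) ?_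
  · rw [← energy_congr hVV']
    exact groundEnergy_mul_le_energy hV_mem hform hf
  · rw [← schrodinger_congr hVV']
    exact hspec.1
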